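/- Let $X$ be a finite CW complex, let $E$ be a nonempty finite set, and let $G$ be a finite group acting on $E$ and acting cellularly on $X$; that is, $G$ acts by homeomorphisms permuting the open cells, and an element of $G$ that maps an open cell to itself fixes that cell pointwise. Set $$\Delta^\circ=\Big\{\ell\colon E\to\mathbb{R}_{>0}\ \Big|\ \sum_{e\in E}\ell(e)=1\Big\},$$ with $G$ acting by $(g\ell)(e)=\ell(g^{-1}e)$. For $n\ge 0$ let $\mathrm{Conf}_n(X)$ be the space of ordered $n$-tuples of distinct points of $X$, and let $(\mathrm{Conf}_n(X)\times\Delta^\circ)/G$ be the quotient by the diagonal action of $G$; the symmetric group $S_n$ acts on it by permuting the $n$ points. For a space $Y$ whose total compactly supported cohomology $H^*_c(Y;\mathbb{Q})$ is finite dimensional, put $\chi_c(Y)=\sum_i(-1)^i\dim_{\mathbb{Q}}H^i_c(Y;\mathbb{Q})$, and, if $S_n$ acts on $Y$, $$\chi_c^{S_n}(Y)=\sum_i(-1)^i\,\mathrm{ch}_n\big(H^i_c(Y;\mathbb{Q})\big),\qquad \mathrm{ch}_n(V)=\frac1{n!}\sum_{\sigma\in S_n}\mathrm{Tr}(\sigma|_V)\,p_1^{k_1(\sigma)}\cdots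 p_n^{k_n(\sigma)},$$ where $k_i(\sigma)$ is the number of cycles of length $i$ of $\sigma$ and $p_k=\sum_j x_j^k$ is the $k$-th power sum symmetric function in countably many variables. For $g\in G$ and $k\ge1$ let $X_k(g)\subseteq X$ be the subspace of the points whose orbit under the cyclic group $\langle g\rangle$ has exactly $k$ elements. Then the spaces $(\mathrm{Conf}_n(X)\times\Delta^\circ)/G$ and $X_k(g)$ have finite-dimensional total compactly supported rational cohomology, and, in the degree completion of the ring of symmetric functions over $\mathbb{Q}$, $$\sum_{n\ge0}\chi_c^{S_n}\Big(\big(\mathrm{Conf}_n(X)\times\Delta^\circ\big)/G\Big)=-\frac{(-1)^{|E|}}{|G|}\sum_{g\in G}\mathrm{sgn}(g|_E)\prod_{k\ge1}(1+p_k)^{\chi_c(X_k(g))/k},$$ where $\mathrm{sgn}(g|_E)$ is the sign of the permutation of $E$ induced by $g$ and $(1+p_k)^a=\sum_{j\ge0}\binom{a}{j}p_k^j$. -/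

import Mathlib

open scoped Topology
open scoped MvPowerSeries.WithPiTopology

noncomputable section

/-! ### Cohomology with compact supports (Alexander–Spanier model), rational coefficients -/

namespace CompactSupportCohomology

/-- Alexander–Spanier `p`-cochains: arbitrary functions on `(p+1)`-tuples of points. -/
abbrev Cochain (Y : Type*) (p : ℕ) : Type _ := (Fin (p + 1) → Y) → ℚ

/-- The cochain `φ` vanishes on all tuples of points lying in some neighbourhood of `y`. -/
def VanishesNear {Y : Type*} [TopologicalSpace Y] {p : ℕ} (φ : Cochain Y p) (y : Y) : Prop :=
  ∃ V ∈ 𝓝 y, ∀ v : Fin (p + 1) → Y, (∀ i, v i ∈ V) → φ v = 0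

/-- The support of a cochain. -/
def support {Y : Type*} [TopologicalSpace Y] {p : ℕ} (φ : Cochain Y p) : Set Y :=
  {y | ¬ VanishesNear φ y}

section

variable {Y : Type*} [TopologicalSpace Y] {p : ℕ}

theorem VanishesNear.zero (y : Y) : VanishesNear (0 : Cochain Y p) y :=
  ⟨Set.univ, Filter.univ_mem, fun _ _ => rfl⟩

theorem VanishesNear.add {φ ψ : Cochain Y p} {y : Y} (hφ : VanishesNear φ y)
    (hψ : VanishesNear ψ y) : VanishesNear (φ + ψ) y := by
  obtain ⟨V, hV, h⟩ := hφ
  obtain ⟨W, hW, h'⟩ := hψ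
  refine ⟨V ∩ W, Filter.inter_mem hV hW, fun v hv => ?_⟩
  simp [h v fun i => (hv i).1, h' v fun i => (hv i).2]

theorem VanishesNear.smul (c : ℚ) {φ : Cochain Y p} {y : Y} (hφ : VanishesNear φ y) :
    VanishesNear (c • φ) y := by
  obtain ⟨V, hV, h⟩ := hφ
  exact ⟨V, hV, fun v hv => by simp [h v hv]⟩

theorem isClosed_support (φ : Cochain Y p) : IsClosed (support φ) := by
  rw [← isOpen_compl_iff, isOpen_iff_mem_nhds]
  intro y hy
  obtain ⟨V, hV, h⟩ := not_not.mp hy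
  obtain ⟨U, hUV, hU, hyU⟩ := mem_nhds_iff.mp hV
  refine Filter.mem_of_superset (hU.mem_nhds hyU) fun z hz => ?_
  exact not_not.mpr ⟨U, hU.mem_nhds hz, fun v hv => h v fun i => hUV (hv i)⟩

end

/-- The locally zero cochains: those with empty support. -/
def locallyZero (Y : Type*) [TopologicalSpace Y] (p : ℕ) : Submodule ℚ (Cochain Y p) where
  carrier := {φ | ∀ y, VanishesNear φ y}
  zero_mem' := VanishesNear.zero
  add_mem' hφ hψ y := (hφ y).add (hψ y)
  smul_mem' c _ hφ y := (hφ y).smul c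

/-- The cochains with compact support. -/
def compactlySupported (Y : Type*) [TopologicalSpace Y] (p : ℕ) :
    Submodule ℚ (Cochain Y p) where
  carrier := {φ | IsCompact (support φ)}
  zero_mem' := by
    have : support (0 : Cochain Y p) = ∅ :=
      Set.eq_empty_of_forall_notMem fun y hy => hy (VanishesNear.zero y)
    change IsCompact (support (0 : Cochain Y p))
    rw [this]
    exact isCompact_empty
  add_mem' {φ ψ} hφ hψ := by
    refine IsCompact.of_isClosed_subset (IsCompact.union hφ hψ) (isClosed_support _) ?_
    intro y hy
    by_contra hn
    rw [Set.mem_union, not_or] at hn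
    exact hy ((not_not.mp hn.1).add (not_not.mp hn.2))
  smul_mem' c φ hφ := by
    refine IsCompact.of_isClosed_subset hφ (isClosed_support _) ?_
    intro y hy hn
    exact hy (hn.smul c)

/-- The Alexander–Spanier coboundary
`(δφ)(y₀, …, y_{p+1}) = ∑ᵢ (-1)ⁱ φ(y₀, …, ŷᵢ, …, y_{p+1})`. -/
def coboundary (Y : Type*) (p : ℕ) : Cochain Y p →ₗ[ℚ] Cochain Y (p + 1) where
  toFun φ v := ∑ i : Fin (p + 2), (-1 : ℚ) ^ (i : ℕ) * φ (v ∘ i.succAbove)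
  map_add' φ ψ := by
    funext v
    simp [mul_add, Finset.sum_add_distrib]
  map_smul' c φ := by
    funext v
    simp [Finset.mul_sum, mul_left_comm]

/-- Compactly supported cochains whose coboundary is locally zero. -/
def cocycles (Y : Type*) [TopologicalSpace Y] (p : ℕ) : Submodule ℚ (Cochain Y p) :=
  compactlySupported Y p ⊓ (locallyZero Y (p + 1)).comap (coboundary Y p)

/-- Cochains which, up to a locally zero cochain, are coboundaries of compactly supported
cochains. -/
def coboundaries (Y : Type*) [TopologicalSpace Y] : (p : ℕ) → Submodule ℚ (Cochain Y p)
  | 0 => locallyZero Y 0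
  | p + 1 => (compactlySupported Y p).map (coboundary Y p) ⊔ locallyZero Y (p + 1)

/-- `Hᵖ_c(Y; ℚ)`: the cohomology of the complex of compactly supported Alexander–Spanier cochains
modulo the locally zero ones. -/
abbrev Hc (Y : Type*) [TopologicalSpace Y] (p : ℕ) : Type _ :=
  cocycles Y p ⧸ (coboundaries Y p).submoduleOf (cocycles Y p)

section Functoriality

variable {Y Z : Type*} [TopologicalSpace Y] [TopologicalSpace Z]

/-- Pullback of cochains. -/
def pullback (f : Y → Z) (p : ℕ) : Cochain Z p →ₗ[ℚ] Cochain Y p where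
  toFun φ v := φ (f ∘ v)
  map_add' _ _ := rfl
  map_smul' _ _ := rfl

theorem VanishesNear.pullback {f : Y → Z} (hf : Continuous f) {p : ℕ} {φ : Cochain Z p} {y : Y}
    (h : VanishesNear φ (f y)) : VanishesNear (pullback f p φ) y := by
  obtain ⟨V, hV, h⟩ := h
  exact ⟨f ⁻¹' V, hf.continuousAt hV, fun v hv => h _ hv⟩

theorem pullback_mem_locallyZero (h : Y ≃ₜ Z) {p : ℕ} {φ : Cochain Z p}
    (hφ : φ ∈ locallyZero Z p) : pullback h p φ ∈ locallyZero Y p :=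
  fun y => (hφ (h y)).pullback h.continuous

theorem pullback_mem_compactlySupported (h : Y ≃ₜ Z) {p : ℕ} {φ : Cochain Z p}
    (hφ : φ ∈ compactlySupported Z p) : pullback h p φ ∈ compactlySupported Y p := by
  refine IsCompact.of_isClosed_subset (h.isCompact_preimage.mpr hφ) (isClosed_support _) ?_
  intro y hy hn
  exact hy (VanishesNear.pullback h.continuous hn)

theorem pullback_mem_cocycles (h : Y ≃ₜ Z) {p : ℕ} {φ : Cochain Z p}
    (hφ : φ ∈ cocycles Z p) : pullback h p φ ∈ cocycles Y p :=
  ⟨pullback_mem_compactlySupported h hφ.1, pullback_mem_locallyZero h hφ.2⟩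

theorem pullback_mem_coboundaries (h : Y ≃ₜ Z) {p : ℕ} {φ : Cochain Z p}
    (hφ : φ ∈ coboundaries Z p) : pullback h p φ ∈ coboundaries Y p := by
  cases p with
  | zero => exact pullback_mem_locallyZero h hφ
  | succ p =>
    obtain ⟨_, ⟨ψ, hψ, rfl⟩, ω, hω, rfl⟩ := Submodule.mem_sup.mp hφ
    rw [map_add]
    exact Submodule.add_mem_sup ⟨_, pullback_mem_compactlySupported h hψ, rfl⟩
      (pullback_mem_locallyZero h hω)

/-- The map `h^* : Hᵖ_c(Z) → Hᵖ_c(Y)` induced by a homeomorphism `h : Y ≃ Z`. -/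
def Hc.map (h : Y ≃ₜ Z) (p : ℕ) : Hc Z p →ₗ[ℚ] Hc Y p :=
  Submodule.mapQ _ _
    ((pullback h p).restrict (p := cocycles Z p) (q := cocycles Y p)
      fun _ => pullback_mem_cocycles h)
    fun _ hφ => pullback_mem_coboundaries h hφ

end Functoriality

/-- The representation of a group `Γ` acting on `Y` by homeomorphisms on `Hᵖ_c(Y; ℚ)`:
the element `γ` acts as `(γ⁻¹)^*`. -/
def Hc.rep (Γ : Type*) [Group Γ] (Y : Type*) [TopologicalSpace Y] [MulAction Γ Y]
    [ContinuousConstSMul Γ Y] (p : ℕ) : Representation ℚ Γ (Hc Y p) where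
  toFun γ := Hc.map (Homeomorph.smul γ⁻¹) p
  map_one' := by
    refine LinearMap.ext fun x => ?_
    obtain ⟨⟨φ, hφ⟩, rfl⟩ := Submodule.Quotient.mk_surjective _ x
    refine congrArg (Submodule.Quotient.mk) (Subtype.ext (funext fun v => ?_))
    exact congrArg φ (funext fun i => by simp)
  map_mul' γ γ' := by
    refine LinearMap.ext fun x => ?_
    obtain ⟨⟨φ, hφ⟩, rfl⟩ := Submodule.Quotient.mk_surjective _ x
    refine congrArg (Submodule.Quotient.mk) (Subtype.ext (funext fun v => ?_))
    exact congrArg φ (funext fun i => by simp [mul_smul])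

/-- The total compactly supported rational cohomology of `Y` is finite dimensional, so that its
compactly supported Euler characteristics are defined. -/
def HasFiniteHc (Y : Type*) [TopologicalSpace Y] : Prop :=
  (∀ p, FiniteDimensional ℚ (Hc Y p)) ∧ ∃ N, ∀ p, N ≤ p → Subsingleton (Hc Y p)

/-- The compactly supported Euler characteristic `∑ᵢ (-1)ⁱ dim Hⁱ_c(Y; ℚ)`. -/
def chiC (Y : Type*) [TopologicalSpace Y] : ℤ :=
  ∑ᶠ p : ℕ, (-1 : ℤ) ^ p * (Module.finrank ℚ (Hc Y p) : ℤ)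

end CompactSupportCohomology

/-! ### Symmetric functions

The degree completion of the ring of symmetric functions over `ℚ` is regarded as a subring of the
ring of formal power series in countably many variables `x₀, x₁, …`. -/

namespace SymmetricFunction

/-- The power sum `p_k = ∑ₙ xₙᵏ` for `k ≥ 1`. -/
def powerSum (k : ℕ) : MvPowerSeries ℕ ℚ :=
  open Classical in fun d => if ∃ n : ℕ, d = Finsupp.single n k then 1 else 0

/-- The Frobenius characteristic `(1/n!) ∑_σ Tr(σ) p_{λ(σ)}` of a representation of `Sₙ`, where
`λ(σ)` is the cycle type of `σ`, fixed points included. -/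
def frobeniusChar {n : ℕ} {V : Type*} [AddCommGroup V] [Module ℚ V]
    (ρ : Representation ℚ (Equiv.Perm (Fin n)) V) : MvPowerSeries ℕ ℚ :=
  (1 / (n.factorial : ℚ)) • ∑ σ : Equiv.Perm (Fin n),
    LinearMap.trace ℚ V (ρ σ) • (σ.partition.parts.map powerSum).prod

/-- `(1 + f)^a` for a rational exponent `a` and a power series `f` without constant term, by the
binomial series. -/
def onePlusPow (f : MvPowerSeries ℕ ℚ) (a : ℚ) : MvPowerSeries ℕ ℚ :=
  (PowerSeries.binomialSeries ℚ a).subst f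

/-- The `Sₙ`-equivariant compactly supported Euler characteristic
`∑ᵢ (-1)ⁱ ch_n Hⁱ_c(Y; ℚ)`. -/
def equivariantChiC (n : ℕ) (Y : Type*) [TopologicalSpace Y] [MulAction (Equiv.Perm (Fin n)) Y]
    [ContinuousConstSMul (Equiv.Perm (Fin n)) Y] : MvPowerSeries ℕ ℚ :=
  ∑ᶠ p : ℕ, (-1 : ℚ) ^ p •
    frobeniusChar (CompactSupportCohomology.Hc.rep (Equiv.Perm (Fin n)) Y p)

end SymmetricFunction

/-! ### Configuration spaces and the open simplex -/

/-- The ordered configuration space of `n` distinct points of `X`. -/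
def Conf (n : ℕ) (X : Type*) : Type _ := {x : Fin n → X // Function.Injective x}

namespace Conf

variable {n : ℕ} {X : Type*}

instance [TopologicalSpace X] : TopologicalSpace (Conf n X) :=
  inferInstanceAs (TopologicalSpace {x : Fin n → X // Function.Injective x})

instance {G : Type*} [Group G] [MulAction G X] : MulAction G (Conf n X) where
  smul g x := ⟨fun i => g • x.1 i, fun _ _ h => x.2 (MulAction.injective g h)⟩
  one_smul x := Subtype.ext (funext fun i => one_smul G (x.1 i))
  mul_smul g g' x := Subtype.ext (funext fun i => mul_smul g g' (x.1 i))

/-- `Sₙ` acts by relabelling: `(σ • x) i = x (σ⁻¹ i)`. -/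
instance : MulAction (Equiv.Perm (Fin n)) (Conf n X) where
  smul σ x := ⟨fun i => x.1 (σ⁻¹ i), x.2.comp (σ⁻¹ : Equiv.Perm (Fin n)).injective⟩
  one_smul _ := rfl
  mul_smul _ _ _ := rfl

theorem continuous_perm_smul [TopologicalSpace X] (σ : Equiv.Perm (Fin n)) :
    Continuous fun x : Conf n X => σ • x :=
  Continuous.subtype_mk (p := Function.Injective)
    (f := fun x : {x : Fin n → X // Function.Injective x} => fun i => x.1 (σ⁻¹ i))
    (continuous_pi fun i => (continuous_apply (σ⁻¹ i)).comp continuous_subtype_val) _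

end Conf

/-- The open simplex of functions `ℓ : E → ℝ_{>0}` with `∑ₑ ℓ(e) = 1`. -/
def OpenSimplex (E : Type*) [Fintype E] : Type _ :=
  {l : E → ℝ // (∀ e, 0 < l e) ∧ ∑ e, l e = 1}

namespace OpenSimplex

variable {E : Type*} [Fintype E]

instance : TopologicalSpace (OpenSimplex E) :=
  inferInstanceAs (TopologicalSpace {l : E → ℝ // (∀ e, 0 < l e) ∧ ∑ e, l e = 1})

/-- `G` permutes the vertices of the simplex: `(g • ℓ)(e) = ℓ(g⁻¹ • e)`. -/
instance {G : Type*} [Group G] [MulAction G E] : MulAction G (OpenSimplex E) where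
  smul g l := ⟨fun e => l.1 (g⁻¹ • e), fun e => l.2.1 _,
    (Equiv.sum_comp (MulAction.toPerm g⁻¹ : Equiv.Perm E) l.1).trans l.2.2⟩
  one_smul l := Subtype.ext (funext fun e => congrArg l.1 (by simp))
  mul_smul g g' l := Subtype.ext (funext fun e => congrArg l.1 (by simp [mul_smul]))

end OpenSimplex

/-- `(Conf_n(X) × Δ°) / G`, the quotient by the diagonal action, with the quotient topology. -/
def ConfSimplexQuotient (G : Type*) [Group G] (X : Type*) [MulAction G X] (E : Type*) [Fintype E]
    [MulAction G E] (n : ℕ) : Type _ :=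
  MulAction.orbitRel.Quotient G (Conf n X × OpenSimplex E)

namespace ConfSimplexQuotient

variable {G : Type*} [Group G] {X : Type*} [MulAction G X] {E : Type*} [Fintype E]
  [MulAction G E] {n : ℕ}

instance [TopologicalSpace X] : TopologicalSpace (ConfSimplexQuotient G X E n) :=
  inferInstanceAs (TopologicalSpace
    (Quotient (MulAction.orbitRel G (Conf n X × OpenSimplex E))))

/-- `Sₙ` acts on the quotient through its action on `Conf_n(X)`. -/
instance : MulAction (Equiv.Perm (Fin n)) (ConfSimplexQuotient G X E n) where
  smul σ := Quotient.map (fun y : Conf n X × OpenSimplex E => (σ • y.1, y.2)) (by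
    rintro _ b ⟨g, rfl⟩
    exact ⟨g, rfl⟩)
  one_smul y := by
    induction y using Quotient.inductionOn with
    | h y => rfl
  mul_smul σ τ y := by
    induction y using Quotient.inductionOn with
    | h y => rfl

instance [TopologicalSpace X] :
    ContinuousConstSMul (Equiv.Perm (Fin n)) (ConfSimplexQuotient G X E n) where
  continuous_const_smul σ := by
    have h : Continuous fun y : Conf n X × OpenSimplex E => (σ • y.1, y.2) :=
      ((Conf.continuous_perm_smul σ).comp continuous_fst).prodMk continuous_snd
    exact Continuous.quotient_lift (continuous_quotient_mk'.comp h) _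

end ConfSimplexQuotient

/-! ### Group actions on CW complexes -/

/-- The action of `G` on the CW complex `X` is cellular: it permutes the open cells, and an element
mapping an open cell to itself fixes that cell pointwise. -/
def IsCellularAction (G : Type*) [Group G] (X : Type*) [TopologicalSpace X] [MulAction G X]
    [Topology.CWComplex (Set.univ : Set X)] : Prop :=
  ∀ (g : G) (d : ℕ) (i : Topology.RelCWComplex.cell (Set.univ : Set X) d),
    (∃ j : Topology.RelCWComplex.cell (Set.univ : Set X) d,
      (fun x : X => g • x) '' Topology.RelCWComplex.openCell d i = Topology.RelCWComplex.openCell d j) ∧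
    ((fun x : X => g • x) '' Topology.RelCWComplex.openCell d i = Topology.RelCWComplex.openCell d i →
      ∀ x ∈ Topology.RelCWComplex.openCell d i, g • x = x)

/-- `X_k(g)`: the points of `X` whose orbit under the cyclic group generated by `g` has exactly
`k` elements. -/
def orbitLengthLocus {G : Type*} [Group G] (X : Type*) [MulAction G X] (g : G) (k : ℕ) : Set X :=
  {x | (MulAction.orbit (Subgroup.zpowers g) x).ncard = k}

end

/-!
# The equivariant Euler characteristic of `(Conf_n(X) × Δ°) / G`

Both sides of the formula count cells with signs, and both counts are polynomial in a parameter `N`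
evaluated at `N = -1`. For natural `N` they count points of finite models, where the identity is an
elementary statement about orbits of permutations.

**Strata.** Choose characteristic maps of the cells that are compatible with the action and defined
on cubes (`EquivariantCW.exists_cubicalCells`); this is possible because an element that preserves a
cell fixes it pointwise. A point of `Conf_n(X) × Δ°` is then described by the cells of the `n`
points, their coordinates in `(0, 1)` inside these cells, and the coordinates `1 - ℓ(e) / max ℓ` in
`[0, 1)`, at least one of which is `0`. Comparing all these numbers with each other and with `0`
gives the order type of the point. The points of a given order type `r` are parametrized by the
increasing sequences `0 < t₁ < ⋯ < t_m < 1`, where `m` is the depth of `r`, hence by an open cube of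
dimension `m` (`EquivariantCW.levels`). At the boundary of the cube either two levels coincide or a
point moves to a cell of smaller dimension, unless the configuration degenerates, so the order types
stratify the space by open cells. An element of `G` or `S_n` or a product of such elements that
preserves an order type fixes all points of this type; therefore the quotient by `G` is stratified
as well (`isStratification_stratumOf`), and a permutation in `S_n` fixes pointwise each stratum of
the quotient that it preserves (`perm_smul_eq_of_stratum`).

**Lefschetz numbers.** For the Alexander–Spanier model the Lefschetz number of a homeomorphism of a
locally compact Hausdorff space is additive for an invariant closed subset and its complement
(`lefschetzNumber_add`). This rests on tautness of closed subsets (`vanishingOn_acyclic`), proved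
with the prism operator of two maps, which makes sense for discontinuous maps as well. The same
operator shows that half-spaces are acyclic, which gives the cohomology of open cubes. It follows
that `σ ∈ S_n` has as Lefschetz number the sum of `(-1) ^ dim` over the strata that it preserves
(`IsStratification.lefschetzNumber_eq`). By orbit counting (`card_mul_sum_fixed_orbits`) this is the
average over `g ∈ G` of the sum of `(-1) ^ depth` over the order types fixed by `σ g`.

**Reciprocity.** Replace `(-1) ^ m` by the binomial coefficient `C(a, m)`, which equals `(-1) ^ m`
for `a = -1`. The resulting series (`labelSeries`) has coefficients polynomial in `a`. For `a = N`
it counts the fixed families of integers in `{0, …, N}` with all possible order types, that is,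
pairs of a `g`-equivariant embedding of `{1, …, n}`, permuted by `σ`, in the finite set in which
each cell of dimension `m` is replaced by `{1, …, N}^m`, and a `g`-invariant function
`E → {0, …, N}` with a zero (`Label.sum_choose_depth`, `Label.card_fixed_models`). The Frobenius
characteristic of the equivariant embeddings in a finite set with a permutation is the product of
`1 + p_{|ω|}` over the orbits `ω` (`coeff_prod_orbits`), and there are `(N + 1) ^ o - N ^ o` such
functions, where `o` is the number of `g`-orbits on `E`. So the series is `productSeries`, first for
natural numbers and then for all `a` (`coeff_labelSeries`).

At `a = -1` the factor `(a + 1) ^ o - a ^ o` is `-(-1) ^ o`, which is `-(-1) ^ |E|` times the sign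
of `g` on `E` (`neg_one_pow_card_orb`), and the number of points of the model with orbits of length `k`
becomes `χ_c(X_k(g))` (`chiC_orbitLengthLocus`).
-/

noncomputable section

/-! ### Traces and exact sequences -/

namespace GradedTrace

open Module LinearMap

section Trace

variable {M N : Type*} [AddCommGroup M] [Module ℚ M] [AddCommGroup N] [Module ℚ N]

/-- The trace of `f` on a submodule `S`; it is `0` by convention if `S` is not `f`-invariant. -/
def traceOn (f : M →ₗ[ℚ] M) (S : Submodule ℚ M) : ℚ :=
  open Classical in if h : ∀ x ∈ S, f x ∈ S then trace ℚ S (f.restrict h) else 0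

theorem traceOn_of_invariant {f : M →ₗ[ℚ] M} {S : Submodule ℚ M} (h : ∀ x ∈ S, f x ∈ S) :
    traceOn f S = trace ℚ S (f.restrict h) := dif_pos h

theorem traceOn_of_subsingleton (f : M →ₗ[ℚ] M) (S : Submodule ℚ M) [Subsingleton S] :
    traceOn f S = 0 := by
  unfold traceOn
  split_ifs with h
  · rw [Subsingleton.elim (f.restrict h) 0, map_zero]
  · rfl

/-- Rank-nullity for traces: a compatible pair of endomorphisms splits the trace on `M` into the
traces on the kernel and on the range of `φ`. -/
theorem trace_eq_traceOn_ker_add_traceOn_range [FiniteDimensional ℚ M] (φ : M →ₗ[ℚ] N)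
    (f : M →ₗ[ℚ] M) (g : N →ₗ[ℚ] N) (h : ∀ x, φ (f x) = g (φ x)) :
    trace ℚ M f = traceOn f φ.ker + traceOn g φ.range := by
  have hk : ∀ x ∈ φ.ker, f x ∈ φ.ker := fun x hx => by
    rw [mem_ker] at hx ⊢
    rw [h, hx, map_zero]
  have hr : ∀ y ∈ φ.range, g y ∈ φ.range := by
    rintro _ ⟨x, rfl⟩
    exact ⟨f x, h x⟩
  rw [traceOn_of_invariant hk, traceOn_of_invariant hr]
  obtain ⟨s, hs⟩ := φ.rangeRestrict.exists_rightInverse_of_surjective φ.range_rangeRestrict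
  have hs' : ∀ y, φ (s y) = y := fun y => congrArg Subtype.val (LinearMap.congr_fun hs y)
  -- the retraction onto the kernel complementary to the section `s`
  let ρ : M →ₗ[ℚ] φ.ker := (LinearMap.id - s ∘ₗ φ.rangeRestrict).codRestrict φ.ker fun x => by
    rw [mem_ker]
    simp [hs']
  have key : f = (f ∘ₗ φ.ker.subtype) ∘ₗ ρ + (f ∘ₗ s) ∘ₗ φ.rangeRestrict := by
    ext x
    simp [ρ]
  have e1 : ρ ∘ₗ (f ∘ₗ φ.ker.subtype) = f.restrict hk := by
    ext ⟨x, hx⟩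
    have : φ.rangeRestrict (f x) = 0 := Subtype.ext (hk x hx)
    simp [ρ, this]
  have e2 : φ.rangeRestrict ∘ₗ (f ∘ₗ s) = g.restrict hr := by
    ext y
    simp [h, hs']
  conv_lhs => rw [key]
  rw [map_add, trace_comp_comm' ρ, trace_comp_comm' φ.rangeRestrict, e1, e2]

end Trace

section Graded

/-- A graded vector space that is finite dimensional in each degree and vanishes in large degrees.
-/
def IsFin (V : ℕ → Type*) [∀ p, AddCommGroup (V p)] [∀ p, Module ℚ (V p)] : Prop :=
  (∀ p, FiniteDimensional ℚ (V p)) ∧ ∃ N, ∀ p, N ≤ p → Subsingleton (V p)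

/-- The alternating sum of the traces of a graded endomorphism. -/
def lefschetz {V : ℕ → Type*} [∀ p, AddCommGroup (V p)] [∀ p, Module ℚ (V p)]
    (f : ∀ p, V p →ₗ[ℚ] V p) : ℚ :=
  ∑ᶠ p : ℕ, (-1 : ℚ) ^ p * trace ℚ (V p) (f p)

variable {V W U : ℕ → Type*} [∀ p, AddCommGroup (V p)] [∀ p, Module ℚ (V p)]
  [∀ p, AddCommGroup (W p)] [∀ p, Module ℚ (W p)] [∀ p, AddCommGroup (U p)] [∀ p, Module ℚ (U p)]

theorem lefschetz_eq_sum_range (f : ∀ p, V p →ₗ[ℚ] V p) {N : ℕ}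
    (hN : ∀ p, N ≤ p → Subsingleton (V p)) :
    lefschetz f = ∑ p ∈ Finset.range N, (-1 : ℚ) ^ p * trace ℚ (V p) (f p) := by
  refine finsum_eq_sum_of_support_subset _ fun p hp => ?_
  rw [Finset.coe_range, Set.mem_Iio]
  by_contra hn
  have := hN p (not_lt.mp hn)
  refine hp ?_
  simp only
  rw [Subsingleton.elim (f p) 0, map_zero, mul_zero]

theorem IsFin.congr (e : ∀ p, V p ≃ₗ[ℚ] W p) (hV : IsFin V) : IsFin W := by
  obtain ⟨h, N, hN⟩ := hV
  refine ⟨fun p => ?_, N, fun p hp => ?_⟩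
  · have := h p
    exact Module.Finite.equiv (e p)
  · have := hN p hp
    exact (e p).symm.toEquiv.subsingleton

theorem lefschetz_congr (e : ∀ p, V p ≃ₗ[ℚ] W p) {f : ∀ p, V p →ₗ[ℚ] V p}
    {g : ∀ p, W p →ₗ[ℚ] W p} (h : ∀ p x, e p (f p x) = g p (e p x)) :
    lefschetz f = lefschetz g := by
  refine finsum_congr fun p => ?_
  rw [← trace_conj' (f p) (e p)]
  congr 2
  ext x
  simp [LinearEquiv.conj_apply, h]

theorem lefschetz_eq_zero_of_subsingleton [∀ p, Subsingleton (V p)] (f : ∀ p, V p →ₗ[ℚ] V p) :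
    lefschetz f = 0 := by
  simpa using lefschetz_eq_sum_range f (N := 0) fun p _ => inferInstance

theorem isFin_of_subsingleton [∀ p, Subsingleton (V p)] : IsFin V :=
  ⟨fun _ => inferInstance, 0, fun _ _ => inferInstance⟩

/-- Long exact sequences `⋯ → V p → W p → U p → V (p + 1) → ⋯`. -/
structure LongExact (a : ∀ p, V p →ₗ[ℚ] W p) (b : ∀ p, W p →ₗ[ℚ] U p)
    (c : ∀ p, U p →ₗ[ℚ] V (p + 1)) : Prop where
  inj : (a 0).ker = ⊥
  exact_mid : ∀ p, (b p).ker = (a p).range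
  exact_right : ∀ p, (c p).ker = (b p).range
  exact_left : ∀ p, (a (p + 1)).ker = (c p).range

variable {a : ∀ p, V p →ₗ[ℚ] W p} {b : ∀ p, W p →ₗ[ℚ] U p} {c : ∀ p, U p →ₗ[ℚ] V (p + 1)}

theorem finiteDimensional_of_exact {X Y Z : Type*} [AddCommGroup X] [Module ℚ X]
    [AddCommGroup Y] [Module ℚ Y] [AddCommGroup Z] [Module ℚ Z] (i : X →ₗ[ℚ] Y) (j : Y →ₗ[ℚ] Z)
    (h : j.ker = i.range) [FiniteDimensional ℚ X] [FiniteDimensional ℚ Z] :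
    FiniteDimensional ℚ Y := by
  have : FiniteDimensional ℚ j.ker := by rw [h]; infer_instance
  have h1 : FiniteDimensional ℚ (Y ⧸ j.ker) := Module.Finite.equiv j.quotKerEquivRange.symm
  exact Module.Finite.of_submodule_quotient j.ker

theorem subsingleton_of_exact {X Y Z : Type*} [AddCommGroup X] [Module ℚ X]
    [AddCommGroup Y] [Module ℚ Y] [AddCommGroup Z] [Module ℚ Z] (i : X →ₗ[ℚ] Y) (j : Y →ₗ[ℚ] Z)
    (h : j.ker = i.range) [Subsingleton X] [Subsingleton Z] : Subsingleton Y := by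
  refine subsingleton_of_forall_eq 0 fun y => ?_
  have hy : y ∈ j.ker := Subsingleton.elim _ _
  rw [h] at hy
  obtain ⟨x, rfl⟩ := hy
  rw [Subsingleton.elim x 0, map_zero]

theorem LongExact.isFin_mid (hE : LongExact a b c) (hV : IsFin V) (hU : IsFin U) : IsFin W := by
  obtain ⟨hV, N, hN⟩ := hV
  obtain ⟨hU, K, hK⟩ := hU
  refine ⟨fun p => ?_, max N K, fun p hp => ?_⟩
  · have := hV p
    have := hU p
    exact finiteDimensional_of_exact _ _ (hE.exact_mid p)
  · have := hN p (le_of_max_le_left hp)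
    have := hK p (le_of_max_le_right hp)
    exact subsingleton_of_exact _ _ (hE.exact_mid p)

theorem LongExact.isFin_left (hE : LongExact a b c) (hW : IsFin W) (hU : IsFin U) : IsFin V := by
  obtain ⟨hW, N, hN⟩ := hW
  obtain ⟨hU, K, hK⟩ := hU
  refine ⟨fun p => ?_, max N K + 1, fun p hp => ?_⟩
  · have := hW p
    cases p with
    | zero => exact FiniteDimensional.of_injective (a 0) (ker_eq_bot.mp hE.inj)
    | succ p =>
      have := hU p
      exact finiteDimensional_of_exact _ _ (hE.exact_left p)
  · obtain ⟨p, rfl⟩ : ∃ q, p = q + 1 := ⟨p - 1, by omega⟩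
    have := hN (p + 1) (by omega)
    have := hK p (by omega)
    exact subsingleton_of_exact _ _ (hE.exact_left p)

/-- Additivity of the Lefschetz number along a long exact sequence with a compatible triple of
graded endomorphisms. -/
theorem LongExact.lefschetz_eq (hE : LongExact a b c) (hV : IsFin V) (hW : IsFin W) (hU : IsFin U)
    {f : ∀ p, V p →ₗ[ℚ] V p} {g : ∀ p, W p →ₗ[ℚ] W p} {k : ∀ p, U p →ₗ[ℚ] U p}
    (ha : ∀ p x, a p (f p x) = g p (a p x)) (hb : ∀ p x, b p (g p x) = k p (b p x))
    (hc : ∀ p x, c p (k p x) = f (p + 1) (c p x)) :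
    lefschetz g = lefschetz f + lefschetz k := by
  obtain ⟨hV, N₁, hN₁⟩ := hV
  obtain ⟨hW, N₂, hN₂⟩ := hW
  obtain ⟨hU, N₃, hN₃⟩ := hU
  set N := max N₁ (max N₂ N₃) with hN
  rw [lefschetz_eq_sum_range f (N := N) fun p hp => hN₁ p (by omega),
    lefschetz_eq_sum_range g (N := N) fun p hp => hN₂ p (by omega),
    lefschetz_eq_sum_range k (N := N) fun p hp => hN₃ p (by omega)]
  -- the alternating sums telescope, the boundary terms being the traces on the kernels of `a`
  have step : ∀ p, trace ℚ _ (f p) - trace ℚ _ (g p) + trace ℚ _ (k p) =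
      traceOn (f p) (a p).ker + traceOn (f (p + 1)) (a (p + 1)).ker := by
    intro p
    have := hV p
    have := hW p
    have := hU p
    rw [trace_eq_traceOn_ker_add_traceOn_range (a p) (f p) (g p) (ha p),
      trace_eq_traceOn_ker_add_traceOn_range (b p) (g p) (k p) (hb p),
      trace_eq_traceOn_ker_add_traceOn_range (c p) (k p) (f (p + 1)) (hc p),
      hE.exact_mid, hE.exact_right, hE.exact_left]
    ring
  have tele : ∀ n, ∑ p ∈ Finset.range n, (-1 : ℚ) ^ p * trace ℚ _ (g p) =
      ∑ p ∈ Finset.range n, (-1 : ℚ) ^ p * trace ℚ _ (f p) +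
      ∑ p ∈ Finset.range n, (-1 : ℚ) ^ p * trace ℚ _ (k p) +
        (-1) ^ n * traceOn (f n) (a n).ker := by
    intro n
    induction n with
    | zero =>
      have : Subsingleton (a 0).ker := by rw [hE.inj]; infer_instance
      simp [traceOn_of_subsingleton]
    | succ n ih =>
      rw [Finset.sum_range_succ, Finset.sum_range_succ, Finset.sum_range_succ, ih]
      linear_combination (-(-1) ^ n) * step n
  rw [tele N]
  have := hN₁ N (by omega)
  rw [traceOn_of_subsingleton, mul_zero, add_zero]

end Graded

/-! ### Subquotients and the long exact sequence of a triple -/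

section Subquotient

variable {M M' M'' : Type*} [AddCommGroup M] [Module ℚ M] [AddCommGroup M'] [Module ℚ M']
  [AddCommGroup M''] [Module ℚ M'']

/-- The subquotient `Z / (Z ∩ B)`. -/
abbrev SQ (Z B : Submodule ℚ M) : Type _ := Z ⧸ B.submoduleOf Z

/-- The map of subquotients induced by a linear map. -/
def SQ.map {Z B : Submodule ℚ M} {Z' B' : Submodule ℚ M'} (f : M →ₗ[ℚ] M')
    (hZ : ∀ x ∈ Z, f x ∈ Z') (hB : ∀ x ∈ B, f x ∈ B') : SQ Z B →ₗ[ℚ] SQ Z' B' :=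
  Submodule.mapQ _ _ (f.restrict (p := Z) (q := Z') hZ) fun _ hx => hB _ hx

/-- The class of an element of `Z`. -/
def SQ.mk {Z B : Submodule ℚ M} (x : M) (hx : x ∈ Z) : SQ Z B := Submodule.Quotient.mk ⟨x, hx⟩

theorem SQ.exists_rep {Z B : Submodule ℚ M} (q : SQ Z B) : ∃ x hx, q = SQ.mk x hx := by
  obtain ⟨⟨x, hx⟩, rfl⟩ := Submodule.Quotient.mk_surjective _ q
  exact ⟨x, hx, rfl⟩

theorem SQ.map_mk {Z B : Submodule ℚ M} {Z' B' : Submodule ℚ M'} (f : M →ₗ[ℚ] M')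
    (hZ : ∀ x ∈ Z, f x ∈ Z') (hB : ∀ x ∈ B, f x ∈ B') (x : M) (hx : x ∈ Z) :
    SQ.map f hZ hB (SQ.mk x hx : SQ Z B) = SQ.mk (f x) (hZ x hx) := rfl

theorem SQ.mk_eq_mk {Z B : Submodule ℚ M} {x y : M} {hx : x ∈ Z} {hy : y ∈ Z} :
    (SQ.mk x hx : SQ Z B) = SQ.mk y hy ↔ x - y ∈ B :=
  Submodule.Quotient.eq _

theorem SQ.mk_eq_zero {Z B : Submodule ℚ M} {x : M} {hx : x ∈ Z} :
    (SQ.mk x hx : SQ Z B) = 0 ↔ x ∈ B :=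
  Submodule.Quotient.mk_eq_zero _

theorem SQ.map_bijective {Z B : Submodule ℚ M} {Z' B' : Submodule ℚ M'} (f : M →ₗ[ℚ] M')
    (hZ : ∀ x ∈ Z, f x ∈ Z') (hB : ∀ x ∈ B, f x ∈ B')
    (hinj : ∀ x ∈ Z, f x ∈ B' → x ∈ B) (hsurj : ∀ y ∈ Z', ∃ x ∈ Z, f x - y ∈ B') :
    Function.Bijective (SQ.map f hZ hB) := by
  constructor
  · rw [injective_iff_map_eq_zero]
    intro q hq
    obtain ⟨x, hx, rfl⟩ := SQ.exists_rep q
    rw [SQ.map_mk, SQ.mk_eq_zero] at hq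
    exact SQ.mk_eq_zero.mpr (hinj x hx hq)
  · intro q
    obtain ⟨y, hy, rfl⟩ := SQ.exists_rep q
    obtain ⟨x, hx, hxy⟩ := hsurj y hy
    exact ⟨SQ.mk x hx, SQ.mk_eq_mk.mpr hxy⟩

end Subquotient

section Triple

variable {M : ℕ → Type*} [∀ p, AddCommGroup (M p)] [∀ p, Module ℚ (M p)]
  (d : ∀ p, M p →ₗ[ℚ] M (p + 1))

/-- The elements of `C` whose differential lies in `A`. -/
def relCycles (C A : ∀ p, Submodule ℚ (M p)) (p : ℕ) : Submodule ℚ (M p) :=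
  C p ⊓ (A (p + 1)).comap (d p)

/-- `dC + A`. -/
def relBoundaries (C A : ∀ p, Submodule ℚ (M p)) : ∀ p, Submodule ℚ (M p)
  | 0 => A 0
  | p + 1 => (C p).map (d p) ⊔ A (p + 1)

/-- The cohomology of the quotient complex `C / A`. -/
abbrev RelH (C A : ∀ p, Submodule ℚ (M p)) (p : ℕ) : Type _ :=
  SQ (relCycles d C A p) (relBoundaries d C A p)

variable {d}

theorem mem_relBoundaries_of_mem {C A : ∀ p, Submodule ℚ (M p)} {p : ℕ} {x : M p} (hx : x ∈ A p) :
    x ∈ relBoundaries d C A p := by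
  cases p with
  | zero => exact hx
  | succ p => exact Submodule.mem_sup_right hx

theorem mem_relBoundaries_succ {C A : ∀ p, Submodule ℚ (M p)} {p : ℕ} {x : M (p + 1)} :
    x ∈ relBoundaries d C A (p + 1) ↔ ∃ y ∈ C p, x - d p y ∈ A (p + 1) := by
  constructor
  · intro hx
    obtain ⟨_, ⟨y, hy, rfl⟩, z, hz, rfl⟩ := Submodule.mem_sup.mp hx
    exact ⟨y, hy, by simpa using hz⟩
  · rintro ⟨y, hy, h⟩
    exact Submodule.mem_sup.mpr ⟨d p y, ⟨y, hy, rfl⟩, _, h, by abel⟩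

section Functor

variable {M' : ℕ → Type*} [∀ p, AddCommGroup (M' p)] [∀ p, Module ℚ (M' p)]
  {d' : ∀ p, M' p →ₗ[ℚ] M' (p + 1)} (s : ∀ p, M p →ₗ[ℚ] M' p)

theorem map_mem_relCycles (hs : ∀ p x, s (p + 1) (d p x) = d' p (s p x))
    {C A : ∀ p, Submodule ℚ (M p)} {C' A' : ∀ p, Submodule ℚ (M' p)}
    (hC : ∀ p, ∀ x ∈ C p, s p x ∈ C' p) (hA : ∀ p, ∀ x ∈ A p, s p x ∈ A' p) (p : ℕ) :
    ∀ x ∈ relCycles d C A p, s p x ∈ relCycles d' C' A' p := fun x hx =>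
  ⟨hC p x hx.1, by
    change d' p (s p x) ∈ A' (p + 1)
    rw [← hs]
    exact hA _ _ hx.2⟩

theorem map_mem_relBoundaries (hs : ∀ p x, s (p + 1) (d p x) = d' p (s p x))
    {C A : ∀ p, Submodule ℚ (M p)} {C' A' : ∀ p, Submodule ℚ (M' p)}
    (hC : ∀ p, ∀ x ∈ C p, s p x ∈ C' p) (hA : ∀ p, ∀ x ∈ A p, s p x ∈ A' p) (p : ℕ) :
    ∀ x ∈ relBoundaries d C A p, s p x ∈ relBoundaries d' C' A' p := by
  intro x hx
  cases p with
  | zero => exact hA 0 x hx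
  | succ p =>
    obtain ⟨y, hy, h⟩ := mem_relBoundaries_succ.mp hx
    refine mem_relBoundaries_succ.mpr ⟨s p y, hC p y hy, ?_⟩
    rw [← hs, ← map_sub]
    exact hA _ _ h

/-- The map in relative cohomology induced by a cochain map. -/
def RelH.map (hs : ∀ p x, s (p + 1) (d p x) = d' p (s p x))
    {C A : ∀ p, Submodule ℚ (M p)} {C' A' : ∀ p, Submodule ℚ (M' p)}
    (hC : ∀ p, ∀ x ∈ C p, s p x ∈ C' p) (hA : ∀ p, ∀ x ∈ A p, s p x ∈ A' p) (p : ℕ) :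
    RelH d C A p →ₗ[ℚ] RelH d' C' A' p :=
  SQ.map (s p) (map_mem_relCycles s hs hC hA p) (map_mem_relBoundaries s hs hC hA p)

/-- A cochain map that induces an isomorphism of the quotient complexes `C / A → C' / A'` induces
isomorphisms in cohomology. The inverse need not come from a cochain map of the ambient
complexes. -/
theorem RelH.map_bijective (hs : ∀ p x, s (p + 1) (d p x) = d' p (s p x))
    {C A : ∀ p, Submodule ℚ (M p)} {C' A' : ∀ p, Submodule ℚ (M' p)}
    (hC : ∀ p, ∀ x ∈ C p, s p x ∈ C' p) (hA : ∀ p, ∀ x ∈ A p, s p x ∈ A' p)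
    (hdC : ∀ p, ∀ x ∈ C p, d p x ∈ C (p + 1)) (hdA' : ∀ p, ∀ x ∈ A' p, d' p x ∈ A' (p + 1))
    (hinj : ∀ p, ∀ x ∈ C p, s p x ∈ A' p → x ∈ A p)
    (hsurj : ∀ p, ∀ y ∈ C' p, ∃ x ∈ C p, s p x - y ∈ A' p) (p : ℕ) :
    Function.Bijective (RelH.map s hs hC hA p) := by
  refine SQ.map_bijective _ _ _ ?_ ?_
  · intro x hx h
    cases p with
    | zero => exact hinj 0 x hx.1 h
    | succ p =>
      obtain ⟨y, hy, hxy⟩ := mem_relBoundaries_succ.mp h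
      obtain ⟨z, hz, hzy⟩ := hsurj p y hy
      refine mem_relBoundaries_succ.mpr ⟨z, hz, hinj _ _ (sub_mem hx.1 (hdC _ _ hz)) ?_⟩
      have := sub_mem hxy (hdA' _ _ hzy)
      rw [map_sub] at this
      rw [map_sub, hs]
      convert this using 1
      abel
  · intro y hy
    obtain ⟨x, hx, hxy⟩ := hsurj p y hy.1
    refine ⟨x, ⟨hx, hinj _ _ (hdC _ _ hx) ?_⟩, mem_relBoundaries_of_mem hxy⟩
    rw [hs]
    have := add_mem (hdA' _ _ hxy) hy.2
    rwa [map_sub, sub_add_cancel] at this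

end Functor

variable {A B C : ∀ p, Submodule ℚ (M p)}

/-- The connecting map: it is induced by the differential itself. -/
def connecting (hdd : ∀ p x, d (p + 1) (d p x) = 0) (p : ℕ) :
    RelH d C B p →ₗ[ℚ] RelH d B A (p + 1) :=
  SQ.map (d p)
    (fun x hx => ⟨hx.2, by
      change d (p + 1) (d p x) ∈ A (p + 2)
      rw [hdd]
      exact Submodule.zero_mem _⟩)
    (fun x hx => by
      cases p with
      | zero => exact mem_relBoundaries_succ.mpr ⟨x, hx, by simp⟩
      | succ p =>
        obtain ⟨y, hy, h⟩ := mem_relBoundaries_succ.mp hx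
        refine mem_relBoundaries_succ.mpr ⟨_, h, ?_⟩
        rw [map_sub, hdd]
        simp)

/-- The long exact sequence of the short exact sequence `B / A → C / A → C / B` of complexes. -/
theorem longExact_triple (hdd : ∀ p x, d (p + 1) (d p x) = 0)
    (hAB : ∀ p, A p ≤ B p) (hBC : ∀ p, B p ≤ C p) :
    LongExact
      (fun p => RelH.map (C := B) (A := A) (C' := C) (A' := A) (fun _ => LinearMap.id)
        (fun _ _ => rfl) hBC (fun _ _ h => h) p)
      (fun p => RelH.map (C := C) (A := A) (C' := C) (A' := B) (fun _ => LinearMap.id)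
        (fun _ _ => rfl) (fun _ _ h => h) hAB p)
      (connecting hdd) where
  inj := by
    rw [eq_bot_iff]
    intro q hq
    obtain ⟨x, hx, rfl⟩ := SQ.exists_rep q
    exact SQ.mk_eq_zero.mpr (SQ.mk_eq_zero.mp (mem_ker.mp hq))
  exact_mid p := by
    apply le_antisymm
    · intro q hq
      obtain ⟨x, hx, rfl⟩ := SQ.exists_rep q
      have hq' : x ∈ relBoundaries d C B p := SQ.mk_eq_zero.mp (mem_ker.mp hq)
      cases p with
      | zero => exact ⟨SQ.mk x ⟨hq', hx.2⟩, rfl⟩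
      | succ p =>
        obtain ⟨y, hy, h⟩ := mem_relBoundaries_succ.mp hq'
        refine ⟨SQ.mk (x - d p y) ⟨h, ?_⟩, SQ.mk_eq_mk.mpr ?_⟩
        · change d (p + 1) (x - d p y) ∈ A (p + 2)
          rw [map_sub, hdd, sub_zero]
          exact hx.2
        · exact mem_relBoundaries_succ.mpr ⟨-y, neg_mem hy, by simp⟩
    · rintro _ ⟨q, rfl⟩
      obtain ⟨x, hx, rfl⟩ := SQ.exists_rep q
      exact mem_ker.mpr (SQ.mk_eq_zero.mpr (mem_relBoundaries_of_mem hx.1))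
  exact_right p := by
    apply le_antisymm
    · intro q hq
      obtain ⟨x, hx, rfl⟩ := SQ.exists_rep q
      obtain ⟨y, hy, h⟩ := mem_relBoundaries_succ.mp (SQ.mk_eq_zero.mp (mem_ker.mp hq))
      refine ⟨SQ.mk (x - y) ⟨sub_mem hx.1 (hBC p hy), ?_⟩, SQ.mk_eq_mk.mpr ?_⟩
      · refine Submodule.mem_comap.mpr ?_
        rw [map_sub]
        exact h
      · exact mem_relBoundaries_of_mem (by simpa using neg_mem hy)
    · rintro _ ⟨q, rfl⟩
      obtain ⟨x, hx, rfl⟩ := SQ.exists_rep q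
      exact mem_ker.mpr (SQ.mk_eq_zero.mpr (mem_relBoundaries_of_mem hx.2))
  exact_left p := by
    apply le_antisymm
    · intro q hq
      obtain ⟨x, hx, rfl⟩ := SQ.exists_rep q
      obtain ⟨y, hy, h⟩ := mem_relBoundaries_succ.mp (SQ.mk_eq_zero.mp (mem_ker.mp hq))
      have hdy : d p y ∈ B (p + 1) := by
        have := sub_mem hx.1 (hAB _ h)
        simpa using this
      refine ⟨SQ.mk y ⟨hy, hdy⟩, SQ.mk_eq_mk.mpr ?_⟩
      exact mem_relBoundaries_of_mem (by simpa using neg_mem h)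
    · rintro _ ⟨q, rfl⟩
      obtain ⟨x, hx, rfl⟩ := SQ.exists_rep q
      exact mem_ker.mpr (SQ.mk_eq_zero.mpr
        (mem_relBoundaries_succ.mpr ⟨x, hx.1, by
          change d p x - d p x ∈ A (p + 1)
          rw [sub_self]
          exact Submodule.zero_mem _⟩))

section Endomorphism

variable (s : ∀ p, M p →ₗ[ℚ] M p)
  (hs : ∀ p x, s (p + 1) (d p x) = d p (s p x))
  (hsA : ∀ p, ∀ x ∈ A p, s p x ∈ A p) (hsB : ∀ p, ∀ x ∈ B p, s p x ∈ B p)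
  (hsC : ∀ p, ∀ x ∈ C p, s p x ∈ C p)

theorem isFin_triple (hdd : ∀ p x, d (p + 1) (d p x) = 0) (hAB : ∀ p, A p ≤ B p)
    (hBC : ∀ p, B p ≤ C p) (h₁ : IsFin (RelH d B A)) (h₂ : IsFin (RelH d C B)) :
    IsFin (RelH d C A) :=
  (longExact_triple hdd hAB hBC).isFin_mid h₁ h₂

theorem isFin_triple_left (hdd : ∀ p x, d (p + 1) (d p x) = 0) (hAB : ∀ p, A p ≤ B p)
    (hBC : ∀ p, B p ≤ C p) (h₁ : IsFin (RelH d C A)) (h₂ : IsFin (RelH d C B)) :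
    IsFin (RelH d B A) :=
  (longExact_triple hdd hAB hBC).isFin_left h₁ h₂

theorem lefschetz_triple (hdd : ∀ p x, d (p + 1) (d p x) = 0) (hAB : ∀ p, A p ≤ B p)
    (hBC : ∀ p, B p ≤ C p) (h₁ : IsFin (RelH d B A)) (h₂ : IsFin (RelH d C B)) :
    lefschetz (RelH.map s hs hsC hsA) =
      lefschetz (RelH.map s hs hsB hsA) + lefschetz (RelH.map s hs hsC hsB) := by
  have hE := longExact_triple hdd hAB hBC
  refine hE.lefschetz_eq h₁ (hE.isFin_mid h₁ h₂) h₂ ?_ ?_ ?_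
  · intro p q
    obtain ⟨x, hx, rfl⟩ := SQ.exists_rep q
    rfl
  · intro p q
    obtain ⟨x, hx, rfl⟩ := SQ.exists_rep q
    rfl
  · intro p q
    obtain ⟨x, hx, rfl⟩ := SQ.exists_rep q
    refine SQ.mk_eq_mk.mpr ?_
    change d p (s p x) - s (p + 1) (d p x) ∈ _
    rw [hs, sub_self]
    exact Submodule.zero_mem _

end Endomorphism

end Triple

end GradedTrace

/-! ### The prism operator -/

namespace CompactSupportCohomology

section Prism

variable {Y Z : Type*}

/-- Insertion of a first argument: `(contract x φ) w = φ (x, w)`. -/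
def contract (x : Y) {p : ℕ} (φ : Cochain Y (p + 1)) : Cochain Y p := fun w => φ (Fin.cons x w)

theorem cons_comp_succ_succAbove {p : ℕ} (x : Y) (w : Fin (p + 1) → Y) (j : Fin (p + 1)) :
    (Fin.cons x w : Fin (p + 2) → Y) ∘ j.succ.succAbove = Fin.cons x (w ∘ j.succAbove) := by
  funext k
  refine Fin.cases ?_ (fun k => ?_) k
  · simp
  · simp [Fin.succ_succAbove_succ]

theorem coboundary_apply {p : ℕ} (φ : Cochain Y p) (v : Fin (p + 2) → Y) :
    coboundary Y p φ v = ∑ i : Fin (p + 2), (-1 : ℚ) ^ (i : ℕ) * φ (v ∘ i.succAbove) := rfl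

theorem coboundary_cons {p : ℕ} (φ : Cochain Y (p + 1)) (x : Y) (w : Fin (p + 2) → Y) :
    coboundary Y (p + 1) φ (Fin.cons x w) = φ w - coboundary Y p (contract x φ) w := by
  rw [coboundary_apply, coboundary_apply, Fin.sum_univ_succ, sub_eq_add_neg,
    ← Finset.sum_neg_distrib]
  congr 1
  · simp only [Fin.val_zero, pow_zero, one_mul]
    exact congrArg φ (funext fun k => by simp)
  · refine Finset.sum_congr rfl fun j _ => ?_
    rw [cons_comp_succ_succAbove, Fin.val_succ, pow_succ, contract]
    ring

theorem coboundary_zero_cons (φ : Cochain Y 0) (x : Y) (w : Fin 1 → Y) :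
    coboundary Y 0 φ (Fin.cons x w) = φ w - φ fun _ => x := by
  rw [coboundary_apply, Fin.sum_univ_two]
  simp only [Fin.val_zero, pow_zero, one_mul, Fin.val_one, pow_one, neg_mul, ← sub_eq_add_neg]
  congr 2
  funext k
  rw [Subsingleton.elim (α := Fin 1) k 0]
  rfl

theorem cochain_ext_cons {p : ℕ} {φ ψ : Cochain Y (p + 1)}
    (h : ∀ x w, φ (Fin.cons x w) = ψ (Fin.cons x w)) : φ = ψ :=
  funext fun v => by rw [← Fin.cons_self_tail v]; exact h _ _

theorem contract_coboundary {p : ℕ} (φ : Cochain Y (p + 1)) (x : Y) :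
    contract x (coboundary Y (p + 1) φ) = φ - coboundary Y p (contract x φ) :=
  funext fun w => coboundary_cons φ x w

theorem coboundary_coboundary : ∀ (p : ℕ) (φ : Cochain Y p),
    coboundary Y (p + 1) (coboundary Y p φ) = 0
  | 0, φ => cochain_ext_cons fun x w => by
    have : contract x (coboundary Y 0 φ) = φ - fun _ => φ fun _ => x :=
      funext fun w => coboundary_zero_cons φ x w
    rw [coboundary_cons, this, map_sub, Pi.sub_apply]
    have : coboundary Y 0 (fun _ => φ fun _ => x) w = 0 := by
      simp [coboundary_apply, Fin.sum_univ_two]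
    rw [this]
    simp
  | p + 1, φ => cochain_ext_cons fun x w => by
    rw [coboundary_cons, contract_coboundary, map_sub, coboundary_coboundary p]
    simp

/-- The prism operator of a pair of maps `f g : Y → Z`, defined by recursion on the degree through
`(Dφ)(x, w) = φ(f x, g x, g w) - (D (φ(f x, ·)))(w)`. No continuity is required. -/
def prism (f g : Y → Z) : ∀ p : ℕ, Cochain Z (p + 1) → Cochain Y p
  | 0, φ => fun v => φ (Fin.cons (f (v 0)) (g ∘ v))
  | p + 1, φ => fun v => φ (Fin.cons (f (v 0)) (g ∘ v)) -
      prism f g p (contract (f (v 0)) φ) (Fin.tail v)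

variable (f g : Y → Z)

theorem prism_succ_cons {p : ℕ} (φ : Cochain Z (p + 2)) (x : Y) (w : Fin (p + 1) → Y) :
    prism f g (p + 1) φ (Fin.cons x w) =
      φ (Fin.cons (f x) (Fin.cons (g x) (g ∘ w))) - prism f g p (contract (f x) φ) w := by
  simp only [prism, Fin.cons_zero, Fin.tail_cons]
  congr 3
  funext k
  refine Fin.cases ?_ (fun k => ?_) k <;> simp

theorem prism_sub {p : ℕ} (φ ψ : Cochain Z (p + 1)) :
    prism f g p (φ - ψ) = prism f g p φ - prism f g p ψ := by
  induction p with
  | zero => rfl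
  | succ p ih =>
    refine funext fun v => ?_
    have : contract (f (v 0)) (φ - ψ) = contract (f (v 0)) φ - contract (f (v 0)) ψ := rfl
    simp only [prism, this, ih, Pi.sub_apply]
    ring

theorem prism_coboundary_zero (φ : Cochain Z 0) (v : Fin 1 → Y) :
    prism f g 0 (coboundary Z 0 φ) v = φ (g ∘ v) - φ (f ∘ v) := by
  change coboundary Z 0 φ (Fin.cons _ _) = _
  rw [coboundary_zero_cons]
  congr 2
  funext k
  rw [Subsingleton.elim (α := Fin 1) k 0]
  rfl

/-- The prism operator is a cochain homotopy between the pullbacks along `f` and `g`. -/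
theorem prism_homotopy : ∀ {p : ℕ} (φ : Cochain Z (p + 1)) (v : Fin (p + 2) → Y),
    prism f g (p + 1) (coboundary Z (p + 1) φ) v + coboundary Y p (prism f g p φ) v =
      φ (g ∘ v) - φ (f ∘ v)
  | 0, φ, v => by
    obtain ⟨x, w, rfl⟩ : ∃ x w, v = Fin.cons x w := ⟨_, _, (Fin.cons_self_tail v).symm⟩
    have e1 : ∀ h : Y → Z, h ∘ (Fin.cons x w : Fin 2 → Y) = Fin.cons (h x) (h ∘ w) := fun h => by
      funext k; refine Fin.cases ?_ (fun k => ?_) k <;> simp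
    rw [prism_succ_cons, contract_coboundary, prism_sub, Pi.sub_apply, prism_coboundary_zero,
      coboundary_zero_cons, coboundary_cons, coboundary_zero_cons, e1, e1]
    have e2 : prism f g 0 φ (fun _ => x) = contract (f x) φ (fun _ => g x) := rfl
    rw [e2]
    simp only [contract]
    ring
  | p + 1, φ, v => by
    obtain ⟨x, w, rfl⟩ : ∃ x w, v = Fin.cons x w := ⟨_, _, (Fin.cons_self_tail v).symm⟩
    have e1 : ∀ h : Y → Z, h ∘ (Fin.cons x w : Fin (p + 3) → Y) = Fin.cons (h x) (h ∘ w) :=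
      fun h => by funext k; refine Fin.cases ?_ (fun k => ?_) k <;> simp
    have ih := prism_homotopy (contract (f x) φ) w
    have e2 : contract x (prism f g (p + 1) φ) =
        pullback g p (contract (g x) (contract (f x) φ)) - prism f g p (contract (f x) φ) :=
      funext fun w => prism_succ_cons f g φ x w
    have e3 : ∀ ψ : Cochain Z p, coboundary Y p (pullback g p ψ) w = coboundary Z p ψ (g ∘ w) :=
      fun ψ => rfl
    rw [prism_succ_cons, contract_coboundary, prism_sub, Pi.sub_apply, coboundary_cons,
      coboundary_cons, coboundary_cons, e2, map_sub, Pi.sub_apply, e3, e1, e1]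
    simp only [contract] at ih ⊢
    linear_combination ih

/-- The prism operator only evaluates cochains on tuples made of images of the given points. This
is what makes it useful for discontinuous maps: supports are controlled pointwise. -/
theorem prism_eq_zero {T : Set Z} {p : ℕ} {φ : Cochain Z (p + 1)} {v : Fin (p + 1) → Y}
    (hφ : ∀ u : Fin (p + 2) → Z, (∀ i, u i ∈ T) → φ u = 0) (hf : ∀ i, f (v i) ∈ T)
    (hg : ∀ i, g (v i) ∈ T) : prism f g p φ v = 0 := by
  have key : ∀ i : Fin (p + 2), (Fin.cons (f (v 0)) (g ∘ v) : Fin (p + 2) → Z) i ∈ T := fun i => by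
    refine Fin.cases ?_ (fun i => ?_) i
    · simpa using hf 0
    · simpa using hg i
  induction p with
  | zero => exact hφ _ key
  | succ p ih =>
    have h2 : prism f g p (contract (f (v 0)) φ) (Fin.tail v) = 0 := by
      refine ih (fun u hu => hφ _ fun i => ?_) (fun i => hf _) (fun i => hg _) fun i => ?_
      · refine Fin.cases ?_ (fun i => ?_) i
        · simpa using hf 0
        · simpa using hu i
      · refine Fin.cases ?_ (fun i => ?_) i
        · exact hf _
        · exact hg _
    simp only [prism, h2, hφ _ key, sub_zero]

end Prism

end CompactSupportCohomology

/-! ### Lefschetz numbers and cochains on subspaces -/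

namespace CompactSupportCohomology

open GradedTrace

section Cochains

variable {Y : Type*}

theorem pullback_coboundary {Z : Type*} (f : Y → Z) (p : ℕ) (φ : Cochain Z p) :
    pullback f (p + 1) (coboundary Z p φ) = coboundary Y p (pullback f p φ) := rfl

/-- The restriction of a cochain to tuples in `K`, extended by zero. -/
def truncate (K : Set Y) {p : ℕ} (φ : Cochain Y p) : Cochain Y p :=
  open Classical in fun v => if ∀ i, v i ∈ K then φ v else 0

theorem truncate_eq_zero {K : Set Y} {p : ℕ} {φ : Cochain Y p} {v : Fin (p + 1) → Y}
    {i : Fin (p + 1)} (h : v i ∉ K) : truncate K φ v = 0 := if_neg fun h' => h (h' i)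

/-- Extension by zero of a cochain on a subspace. -/
def extend (A : Set Y) {p : ℕ} (φ : Cochain A p) : Cochain Y p :=
  open Classical in fun v => if h : ∀ i, v i ∈ A then φ fun i => ⟨v i, h i⟩ else 0

theorem pullback_extend (A : Set Y) {p : ℕ} (φ : Cochain A p) :
    pullback Subtype.val p (extend A φ) = φ := by
  funext v
  exact dif_pos (c := ∀ i, (v i : Y) ∈ A) fun i => (v i).2

end Cochains

section Basic

variable {Y : Type*} [TopologicalSpace Y]

theorem VanishesNear.coboundary {p : ℕ} {φ : Cochain Y p} {y : Y} (h : VanishesNear φ y) :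
    VanishesNear (coboundary Y p φ) y := by
  obtain ⟨V, hV, h⟩ := h
  refine ⟨V, hV, fun v hv => ?_⟩
  rw [coboundary_apply]
  refine Finset.sum_eq_zero fun i _ => ?_
  rw [h (v ∘ i.succAbove) fun j => hv _, mul_zero]

theorem VanishesNear.neg {p : ℕ} {φ : Cochain Y p} {y : Y} (h : VanishesNear φ y) :
    VanishesNear (-φ) y := by
  simpa using h.smul (-1)

theorem VanishesNear.sub {p : ℕ} {φ ψ : Cochain Y p} {y : Y} (hφ : VanishesNear φ y)
    (hψ : VanishesNear ψ y) : VanishesNear (φ - ψ) y := by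
  rw [sub_eq_add_neg]
  exact hφ.add hψ.neg

theorem notMem_support {p : ℕ} {φ : Cochain Y p} {y : Y} :
    y ∉ support φ ↔ VanishesNear φ y := not_not

theorem mem_compactlySupported_of_subset {p : ℕ} {φ : Cochain Y p} {K : Set Y} (hK : IsCompact K)
    (h : ∀ y ∉ K, VanishesNear φ y) : φ ∈ compactlySupported Y p :=
  hK.of_isClosed_subset (isClosed_support φ) fun y hy => by
    by_contra hn
    exact hy (h y hn)

theorem coboundary_mem_locallyZero {p : ℕ} {φ : Cochain Y p} (h : φ ∈ locallyZero Y p) :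
    coboundary Y p φ ∈ locallyZero Y (p + 1) := fun y => (h y).coboundary

theorem coboundary_mem_compactlySupported {p : ℕ} {φ : Cochain Y p}
    (h : φ ∈ compactlySupported Y p) : coboundary Y p φ ∈ compactlySupported Y (p + 1) :=
  mem_compactlySupported_of_subset h fun _ hy => (notMem_support.mp hy).coboundary

theorem locallyZero_le_compactlySupported (p : ℕ) : locallyZero Y p ≤ compactlySupported Y p :=
  fun _ h => mem_compactlySupported_of_subset isCompact_empty fun y _ => h y

/-- The Lefschetz number `∑ₚ (-1)ᵖ Tr(h^* | Hᵖ_c(Y))` of a self-homeomorphism. -/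
def lefschetzNumber (h : Y ≃ₜ Y) : ℚ := lefschetz (V := fun p => Hc Y p) fun p => Hc.map h p

theorem relBoundaries_eq_coboundaries (p : ℕ) :
    relBoundaries (coboundary Y) (compactlySupported Y) (locallyZero Y) p = coboundaries Y p := by
  cases p <;> rfl

/-- `Hᵖ_c` as the relative cohomology of the compactly supported cochains modulo the locally zero
ones. -/
def hcEquiv (Y : Type*) [TopologicalSpace Y] (p : ℕ) :
    RelH (coboundary Y) (compactlySupported Y) (locallyZero Y) p ≃ₗ[ℚ] Hc Y p :=
  Submodule.quotEquivOfEq _ _ (by rw [relBoundaries_eq_coboundaries]; rfl)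

theorem hasFiniteHc_iff :
    HasFiniteHc Y ↔ IsFin (RelH (coboundary Y) (compactlySupported Y) (locallyZero Y)) :=
  ⟨fun h => IsFin.congr (fun p => (hcEquiv Y p).symm) h, fun h => IsFin.congr (hcEquiv Y) h⟩

/-- The Lefschetz number, computed on the relative cohomology of the compactly supported cochains
modulo the locally zero ones. -/
theorem lefschetzNumber_eq (h : Y ≃ₜ Y) :
    lefschetzNumber h = lefschetz (RelH.map (d := coboundary Y) (d' := coboundary Y)
      (C := compactlySupported Y) (A := locallyZero Y) (fun p => pullback h p)
      (pullback_coboundary h) (fun _ _ => pullback_mem_compactlySupported h)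
      (fun _ _ => pullback_mem_locallyZero h)) := by
  symm
  refine lefschetz_congr (hcEquiv Y) fun p x => ?_
  obtain ⟨x, hx, rfl⟩ := SQ.exists_rep x
  rfl

variable {Z : Type*} [TopologicalSpace Z]

/-- Homeomorphic spaces with conjugate self-homeomorphisms have the same invariants. -/
theorem transport_homeomorph (e : Y ≃ₜ Z) :
    (HasFiniteHc Y → HasFiniteHc Z) ∧ ∀ (h : Y ≃ₜ Y) (k : Z ≃ₜ Z), (∀ y, e (h y) = k (e y)) →
      lefschetzNumber h = lefschetzNumber k := by
  have hinv : ∀ (f : Y ≃ₜ Z) (p : ℕ), Function.LeftInverse (Hc.map f p) (Hc.map f.symm p) ∧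
      Function.RightInverse (Hc.map f p) (Hc.map f.symm p) := by
    intro f p
    constructor
    · intro q
      obtain ⟨x, hx, rfl⟩ := SQ.exists_rep q
      refine SQ.mk_eq_mk.mpr ?_
      have : pullback f p (pullback f.symm p x) = x :=
        funext fun v => congrArg x (funext fun i => by simp)
      change pullback f p (pullback f.symm p x) - x ∈ _
      rw [this, sub_self]
      exact Submodule.zero_mem _
    · intro q
      obtain ⟨x, hx, rfl⟩ := SQ.exists_rep q
      refine SQ.mk_eq_mk.mpr ?_
      have : pullback f.symm p (pullback f p x) = x :=
        funext fun v => congrArg x (funext fun i => by simp)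
      change pullback f.symm p (pullback f p x) - x ∈ _
      rw [this, sub_self]
      exact Submodule.zero_mem _
  let E : ∀ p, Hc Y p ≃ₗ[ℚ] Hc Z p := fun p =>
    { Hc.map e.symm p with
      invFun := Hc.map e p
      left_inv := (hinv e p).1
      right_inv := (hinv e p).2 }
  refine ⟨fun h => IsFin.congr E h, fun h k hk => ?_⟩
  refine lefschetz_congr E fun p q => ?_
  obtain ⟨x, hx, rfl⟩ := SQ.exists_rep q
  refine SQ.mk_eq_mk.mpr ?_
  have : pullback e.symm p (pullback h p x) = pullback k p (pullback e.symm p x) :=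
    funext fun v => congrArg x (funext fun i => by
      apply e.injective
      simp [hk])
  change pullback e.symm p (pullback h p x) - pullback k p (pullback e.symm p x) ∈ _
  rw [this, sub_self]
  exact Submodule.zero_mem _

theorem VanishesNear.truncate {K : Set Y} {p : ℕ} {φ : Cochain Y p} {y : Y}
    (h : VanishesNear φ y) : VanishesNear (truncate K φ) y := by
  obtain ⟨V, hV, h⟩ := h
  refine ⟨V, hV, fun v hv => ?_⟩
  unfold CompactSupportCohomology.truncate
  rw [h v hv, ite_self]

theorem truncate_mem_compactlySupported (K : Set Y) {p : ℕ} {φ : Cochain Y p}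
    (h : φ ∈ compactlySupported Y p) : truncate K φ ∈ compactlySupported Y p :=
  mem_compactlySupported_of_subset h fun _ hy => (notMem_support.mp hy).truncate

theorem truncate_sub_mem_locallyZero {K : Set Y} {p : ℕ} {φ : Cochain Y p}
    (h : support φ ⊆ interior K) : truncate K φ - φ ∈ locallyZero Y p := by
  intro y
  by_cases hy : y ∈ support φ
  · refine ⟨K, mem_interior_iff_mem_nhds.mp (h hy), fun v hv => ?_⟩
    rw [Pi.sub_apply, truncate, if_pos hv, sub_self]
  · exact (notMem_support.mp hy).truncate.sub (notMem_support.mp hy)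

theorem VanishesNear.extend {A : Set Y} {p : ℕ} {φ : Cochain A p} {y : A}
    (h : VanishesNear φ y) : VanishesNear (extend A φ) (y : Y) := by
  obtain ⟨V, hV, h⟩ := h
  obtain ⟨W, hW, hWV⟩ := mem_nhds_subtype A y V |>.mp hV
  refine ⟨W, hW, fun v hv => ?_⟩
  unfold CompactSupportCohomology.extend
  split_ifs with hA
  · exact h _ fun i => hWV (hv i)
  · rfl

end Basic

section Additivity

variable {Y : Type*} [TopologicalSpace Y]

/-- Compactly supported cochains on `Y` whose restriction to `Z` is locally zero. -/
def vanishingOn (Z : Set Y) (p : ℕ) : Submodule ℚ (Cochain Y p) :=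
  compactlySupported Y p ⊓ (locallyZero Z p).comap (pullback Subtype.val p)

/-- Compactly supported cochains on `Y` with support disjoint from `Z`. -/
def vanishingNear (Z : Set Y) (p : ℕ) : Submodule ℚ (Cochain Y p) where
  carrier := {φ | φ ∈ compactlySupported Y p ∧ ∀ z ∈ Z, VanishesNear φ z}
  zero_mem' := ⟨Submodule.zero_mem _, fun z _ => VanishesNear.zero z⟩
  add_mem' hφ hψ := ⟨add_mem hφ.1 hψ.1, fun z hz => (hφ.2 z hz).add (hψ.2 z hz)⟩
  smul_mem' c _ hφ := ⟨Submodule.smul_mem _ c hφ.1, fun z hz => (hφ.2 z hz).smul c⟩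

variable {Z : Set Y}

theorem locallyZero_le_vanishingNear (p : ℕ) : locallyZero Y p ≤ vanishingNear Z p :=
  fun _ h => ⟨locallyZero_le_compactlySupported p h, fun z _ => h z⟩

theorem vanishingNear_le_vanishingOn (p : ℕ) : vanishingNear Z p ≤ vanishingOn Z p :=
  fun _ h => ⟨h.1, fun z => (h.2 z z.2).pullback continuous_subtype_val⟩

theorem vanishingOn_le (p : ℕ) : vanishingOn Z p ≤ compactlySupported Y p := fun _ h => h.1

theorem coboundary_mem_vanishingNear {p : ℕ} {φ : Cochain Y p} (h : φ ∈ vanishingNear Z p) :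
    coboundary Y p φ ∈ vanishingNear Z (p + 1) :=
  ⟨coboundary_mem_compactlySupported h.1, fun z hz => (h.2 z hz).coboundary⟩

theorem restrict_mem_locallyZero {A : Set Y} {p : ℕ} {φ : Cochain Y p}
    (h : φ ∈ locallyZero Y p) : pullback (Subtype.val : A → Y) p φ ∈ locallyZero A p :=
  fun y => (h y).pullback continuous_subtype_val

theorem restrict_mem_compactlySupported_of_isClosed (hZ : IsClosed Z) {p : ℕ} {φ : Cochain Y p}
    (h : φ ∈ compactlySupported Y p) :
    pullback (Subtype.val : Z → Y) p φ ∈ compactlySupported Z p :=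
  mem_compactlySupported_of_subset (hZ.isClosedEmbedding_subtypeVal.isCompact_preimage h)
    fun _ hy => VanishesNear.pullback continuous_subtype_val (notMem_support.mp hy)

theorem restrict_mem_compactlySupported_compl {p : ℕ} {φ : Cochain Y p}
    (h : φ ∈ vanishingNear Z p) :
    pullback (Subtype.val : (Zᶜ : Set Y) → Y) p φ ∈ compactlySupported (Zᶜ : Set Y) p := by
  have hK : support φ ⊆ Set.range (Subtype.val : (Zᶜ : Set Y) → Y) := by
    rw [Subtype.range_coe]
    exact fun x hx hxZ => hx (h.2 x hxZ)
  exact mem_compactlySupported_of_subset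
    ((Topology.IsInducing.subtypeVal.isCompact_preimage_iff hK).mpr h.1)
    fun _ hy => VanishesNear.pullback continuous_subtype_val (notMem_support.mp hy)

/-- The cohomology of a closed subspace, as the cohomology of the compactly supported cochains on
`Y` modulo those that are locally zero on `Z`: cochains on `Z` extend by zero. -/
theorem restrict_closed_bijective (hZ : IsClosed Z) (p : ℕ) : Function.Bijective
    (RelH.map (d := coboundary Y) (d' := coboundary Z) (C := compactlySupported Y)
      (A := vanishingOn Z) (C' := compactlySupported Z) (A' := locallyZero Z)
      (fun p => pullback Subtype.val p) (pullback_coboundary _)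
      (fun _ _ => restrict_mem_compactlySupported_of_isClosed hZ) (fun _ _ h => h.2) p) := by
  refine RelH.map_bijective (d := coboundary Y) (d' := coboundary Z) (C := compactlySupported Y)
    (A := vanishingOn Z) (C' := compactlySupported Z) (A' := locallyZero Z) _
    (pullback_coboundary _) (fun _ _ => restrict_mem_compactlySupported_of_isClosed hZ)
    (fun _ _ h => h.2) (fun _ _ => coboundary_mem_compactlySupported)
    (fun _ _ => coboundary_mem_locallyZero) (fun p x hx h => ⟨hx, h⟩) (fun p y hy => ?_) p
  refine ⟨extend Z y, mem_compactlySupported_of_subset (hy.image continuous_subtype_val) ?_, ?_⟩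
  · intro x hx
    by_cases hxZ : x ∈ Z
    · refine VanishesNear.extend (y := ⟨x, hxZ⟩) (notMem_support.mp fun h => hx ⟨_, h, rfl⟩)
    · exact ⟨Zᶜ, hZ.isOpen_compl.mem_nhds hxZ, fun v hv => dif_neg fun h => hv 0 (h 0)⟩
  · rw [pullback_extend, sub_self]
    exact Submodule.zero_mem _

/-- The cohomology of an open subspace, as the cohomology of the cochains on `Y` with compact
support disjoint from `Z`: truncated to a compact neighbourhood of its support, a cochain on `Zᶜ`
extends by zero. -/
theorem restrict_open_bijective [T2Space Y] [LocallyCompactSpace Y] (hZ : IsClosed Z) (p : ℕ) :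
    Function.Bijective
    (RelH.map (d := coboundary Y) (d' := coboundary (Zᶜ : Set Y)) (C := vanishingNear Z)
      (A := locallyZero Y) (C' := compactlySupported (Zᶜ : Set Y))
      (A' := locallyZero (Zᶜ : Set Y))
      (fun p => pullback Subtype.val p) (pullback_coboundary _)
      (fun _ _ => restrict_mem_compactlySupported_compl)
      (fun _ _ => restrict_mem_locallyZero) p) := by
  have hU : IsOpen Zᶜ := hZ.isOpen_compl
  refine RelH.map_bijective (d := coboundary Y) (d' := coboundary (Zᶜ : Set Y))
    (C := vanishingNear Z) (A := locallyZero Y) (C' := compactlySupported (Zᶜ : Set Y))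
    (A' := locallyZero (Zᶜ : Set Y)) _ (pullback_coboundary _)
    (fun _ _ => restrict_mem_compactlySupported_compl) (fun _ _ => restrict_mem_locallyZero)
    (fun _ _ => coboundary_mem_vanishingNear)
    (fun _ _ => coboundary_mem_locallyZero) (fun p φ hφ h y => ?_) (fun p φ hφ => ?_) p
  · by_cases hy : y ∈ Z
    · exact hφ.2 y hy
    · obtain ⟨V, hV, hV'⟩ := h ⟨y, hy⟩
      refine ⟨Subtype.val '' V, hU.isOpenMap_subtype_val.image_mem_nhds hV, fun v hv => ?_⟩
      choose w hw hwv using hv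
      rw [← hV' w hw]
      exact congrArg φ (funext fun i => (hwv i).symm)
  · have : LocallyCompactSpace (Zᶜ : Set Y) := hU.locallyCompactSpace
    obtain ⟨K, hK, hφK⟩ := exists_compact_superset (show IsCompact (support φ) from hφ)
    have hvan : ∀ x ∉ Subtype.val '' K, VanishesNear (extend Zᶜ (truncate K φ)) x := by
      intro x hx
      refine ⟨(Subtype.val '' K)ᶜ,
        (hK.image continuous_subtype_val).isClosed.isOpen_compl.mem_nhds hx, fun v hv => ?_⟩
      unfold extend
      split_ifs with hA
      · exact truncate_eq_zero (i := 0) fun h => hv 0 ⟨_, h, rfl⟩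
      · rfl
    refine ⟨extend Zᶜ (truncate K φ), ⟨mem_compactlySupported_of_subset
      (hK.image continuous_subtype_val) hvan, fun z hz => hvan z ?_⟩, ?_⟩
    · rintro ⟨w, -, rfl⟩
      exact w.2 hz
    · rw [pullback_extend]
      exact truncate_sub_mem_locallyZero hφK

end Additivity

end CompactSupportCohomology

/-! ### Tautness of closed subspaces and additivity of the Lefschetz number -/

namespace CompactSupportCohomology

open GradedTrace

section Tautness

theorem isFin_vanishingOn_iff {Y : Type*} [TopologicalSpace Y] {Z : Set Y} (hZ : IsClosed Z) :
    IsFin (RelH (coboundary Y) (compactlySupported Y) (vanishingOn Z)) ↔ HasFiniteHc Z := by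
  have e := fun p => LinearEquiv.ofBijective _ (restrict_closed_bijective hZ p)
  rw [hasFiniteHc_iff]
  exact ⟨fun h => IsFin.congr e h, fun h => IsFin.congr (fun p => (e p).symm) h⟩

theorem exists_nhds_of_restrict_vanishesNear {Y : Type*} [TopologicalSpace Y] {Z : Set Y}
    {p : ℕ} {φ : Cochain Y p} {z : Z}
    (h : VanishesNear (pullback (Subtype.val : Z → Y) p φ) z) :
    ∃ V ∈ 𝓝 (z : Y), ∀ v : Fin (p + 1) → Y, (∀ i, v i ∈ V ∩ Z) → φ v = 0 := by
  obtain ⟨V, hV, h⟩ := h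
  obtain ⟨W, hW, hWV⟩ := mem_nhds_subtype Z z V |>.mp hV
  exact ⟨W, hW, fun v hv => h (fun i => ⟨v i, (hv i).2⟩) fun i => hWV (hv i).1⟩

variable {Y : Type*} [TopologicalSpace Y] [T2Space Y] [LocallyCompactSpace Y] {Z : Set Y}

/-- A closed subset `Z` admits, over a compact set `K`, a (discontinuous) map `f` that is the
identity on `Z`, sends the points near `Z` into `Z`, and moves points only within members of a
prescribed family of neighbourhoods. It preserves each member of a finite cover of `Z ∩ K`. -/
theorem exists_collapse (hZ : IsClosed Z) {K : Set Y} (hK : IsCompact K) (T : Y → Set Y)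
    (hT : ∀ z ∈ Z ∩ K, T z ∈ 𝓝 z) :
    ∃ f : Y → Y, (∀ y ∈ Z, f y = y) ∧ (∀ y ∉ K, f y = y) ∧
      ∀ z ∈ Z ∩ K, ∃ V ∈ 𝓝 z, ∃ c ∈ Z ∩ K, V ⊆ T c ∧ (∀ y ∈ V, f y ∈ T c) ∧
        ∀ y ∈ V ∩ K, f y ∈ Z := by
  classical
  have hL : IsCompact (Z ∩ K) := hK.inter_left hZ
  have hF : ∀ z : Y, ∃ F : Set Y, z ∈ Z ∩ K → (F ∈ 𝓝 z ∧ F ⊆ T z ∧ IsCompact F) := fun z => by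
    by_cases hz : z ∈ Z ∩ K
    · obtain ⟨F, h⟩ := local_compact_nhds (hT z hz)
      exact ⟨F, fun _ => h⟩
    · exact ⟨∅, fun h => absurd h hz⟩
  choose F hF using hF
  obtain ⟨t, ht, htL⟩ := hL.elim_nhds_subcover (fun z => interior (F z))
    fun z hz => interior_mem_nhds.mpr (hF z hz).1
  -- `f` picks a point of `Z` lying in all the sets of the cover that contain the given point
  let f : Y → Y := fun y =>
    if h : y ∉ Z ∧ y ∈ K ∧ ∃ z ∈ Z ∩ K, ∀ i ∈ t, y ∈ F i → z ∈ F i then h.2.2.choose else y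
  have hfF : ∀ y, ∀ i ∈ t, y ∈ F i → f y ∈ F i := by
    intro y i hi hy
    by_cases h : y ∉ Z ∧ y ∈ K ∧ ∃ z ∈ Z ∩ K, ∀ i ∈ t, y ∈ F i → z ∈ F i
    · simp only [f, dif_pos h]
      exact h.2.2.choose_spec.2 i hi hy
    · simpa only [f, dif_neg h] using hy
  refine ⟨f, fun y hy => dif_neg fun h => h.1 hy, fun y hy => dif_neg fun h => hy h.2.1, ?_⟩
  intro z hz
  obtain ⟨c, hc, hzc⟩ := Set.mem_iUnion₂.mp (htL hz)
  let N : Set Y := ⋂ i ∈ {i ∈ t | z ∉ F i}, (F i)ᶜ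
  have hN : N ∈ 𝓝 z := by
    refine (Filter.biInter_finset_mem _).mpr fun i hi => ?_
    rw [Finset.mem_filter] at hi
    exact (hF i (ht i hi.1)).2.2.isClosed.isOpen_compl.mem_nhds hi.2
  refine ⟨interior (F c) ∩ N, Filter.inter_mem (isOpen_interior.mem_nhds hzc) hN, c, ht c hc,
    fun y hy => (hF c (ht c hc)).2.1 (interior_subset hy.1),
    fun y hy => (hF c (ht c hc)).2.1 (hfF y c hc (interior_subset hy.1)), fun y hy => ?_⟩
  by_cases hyZ : y ∈ Z
  · simpa only [f, dif_neg fun h : y ∉ Z ∧ _ => h.1 hyZ] using hyZ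
  · have h : y ∉ Z ∧ y ∈ K ∧ ∃ z ∈ Z ∩ K, ∀ i ∈ t, y ∈ F i → z ∈ F i := by
      refine ⟨hyZ, hy.2, z, hz, fun i hi hyi => ?_⟩
      by_contra hzi
      exact Set.mem_iInter₂.mp hy.1.2 i (Finset.mem_filter.mpr ⟨hi, hzi⟩) hyi
    simp only [f, dif_pos h]
    exact h.2.2.choose_spec.1.1

/-- Tautness of closed subspaces: a cochain that restricts to zero on `Z` and is a cocycle near `Z`
is, near `Z`, the coboundary of a cochain that restricts to zero on `Z`. The latter is the prism
between the identity and a map collapsing a neighbourhood of `Z` onto `Z`. -/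
theorem vanishingOn_acyclic (hZ : IsClosed Z) (p : ℕ) :
    Subsingleton (RelH (coboundary Y) (vanishingOn Z) (vanishingNear Z) p) := by
  refine subsingleton_of_forall_eq 0 fun q => ?_
  obtain ⟨φ, hφ, rfl⟩ := SQ.exists_rep q
  refine SQ.mk_eq_zero.mpr ?_
  obtain ⟨⟨hφc, hφZ⟩, hδ⟩ := hφ
  have hδ : ∀ z ∈ Z, VanishesNear (coboundary Y p φ) z := hδ.2
  cases p with
  | zero =>
    refine ⟨hφc, fun z hz => ?_⟩
    obtain ⟨V, hV, hV0⟩ := hδ z hz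
    obtain ⟨W, hW, hW0⟩ := exists_nhds_of_restrict_vanishesNear (hφZ ⟨z, hz⟩)
    refine ⟨V, hV, fun v hv => ?_⟩
    have h1 := hV0 (Fin.cons z v) fun i => by
      refine Fin.cases ?_ (fun i => ?_) i
      · exact mem_of_mem_nhds hV
      · exact hv i
    rw [coboundary_zero_cons, hW0 _ fun _ => ⟨mem_of_mem_nhds hW, hz⟩, sub_zero] at h1
    exact h1
  | succ p =>
    obtain ⟨K, hK, hφK⟩ := exists_compact_superset (show IsCompact (support φ) from hφc)
    -- on `T z` the coboundary of `φ` vanishes, and `φ` itself vanishes on all tuples or, near the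
    -- support, at least on the tuples in `Z`
    have hT : ∀ z : Y, ∃ T : Set Y, z ∈ Z ∩ K → (T ∈ 𝓝 z ∧
        (∀ v : Fin (p + 3) → Y, (∀ i, v i ∈ T) → coboundary Y (p + 1) φ v = 0) ∧
        ((∀ v : Fin (p + 2) → Y, (∀ i, v i ∈ T) → φ v = 0) ∨
          (T ⊆ K ∧ ∀ v : Fin (p + 2) → Y, (∀ i, v i ∈ T ∩ Z) → φ v = 0))) := by
      intro z
      by_cases hz : z ∈ Z ∩ K
      · obtain ⟨V, hV, hV0⟩ := hδ z hz.1
        by_cases hzφ : z ∈ support φ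
        · obtain ⟨W, hW, hW0⟩ := exists_nhds_of_restrict_vanishesNear (hφZ ⟨z, hz.1⟩)
          refine ⟨V ∩ W ∩ K, fun _ => ⟨Filter.inter_mem (Filter.inter_mem hV hW)
            (mem_interior_iff_mem_nhds.mp (hφK hzφ)), fun v hv => hV0 v fun i => (hv i).1.1,
            Or.inr ⟨Set.inter_subset_right, fun v hv => hW0 v fun i => ⟨(hv i).1.1.2, (hv i).2⟩⟩⟩⟩
        · obtain ⟨W, hW, hW0⟩ := notMem_support.mp hzφ
          exact ⟨V ∩ W, fun _ => ⟨Filter.inter_mem hV hW, fun v hv => hV0 v fun i => (hv i).1,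
            Or.inl fun v hv => hW0 v fun i => (hv i).2⟩⟩
      · exact ⟨∅, fun h => absurd h hz⟩
    choose T hT using hT
    obtain ⟨f, hfZ, hfK, hf⟩ := exists_collapse hZ hK T fun z hz => (hT z hz).1
    have hout : ∀ y ∉ K, VanishesNear (prism f id p φ) y := by
      intro y hy
      obtain ⟨W, hW, hW0⟩ := notMem_support.mp fun h => hy (interior_subset (hφK h))
      refine ⟨W ∩ Kᶜ, Filter.inter_mem hW (hK.isClosed.isOpen_compl.mem_nhds hy), fun v hv => ?_⟩
      refine prism_eq_zero f id hW0 (fun i => ?_) fun i => (hv i).1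
      rw [hfK _ (hv i).2]
      exact (hv i).1
    have hψc : prism f id p φ ∈ compactlySupported Y p := mem_compactlySupported_of_subset hK hout
    refine mem_relBoundaries_succ.mpr ⟨prism f id p φ, ⟨hψc, fun z => ?_⟩,
      sub_mem hφc (coboundary_mem_compactlySupported hψc), fun z hz => ?_⟩
    · obtain ⟨W, hW, hW0⟩ := exists_nhds_of_restrict_vanishesNear (hφZ z)
      refine ⟨Subtype.val ⁻¹' W, continuous_subtype_val.continuousAt hW, fun v hv => ?_⟩
      refine prism_eq_zero f id hW0 (fun i => ?_) fun i => ⟨hv i, (v i).2⟩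
      change f (v i) ∈ W ∩ Z
      rw [hfZ _ (v i).2]
      exact ⟨hv i, (v i).2⟩
    · by_cases hzK : z ∈ K
      · obtain ⟨V, hV, c, hc, hVT, hfT, hfV⟩ := hf z ⟨hz, hzK⟩
        obtain ⟨-, h1, h2⟩ := hT c hc
        refine ⟨V, hV, fun v hv => ?_⟩
        have h3 : prism f id (p + 1) (coboundary Y (p + 1) φ) v = 0 :=
          prism_eq_zero f id h1 (fun i => hfT _ (hv i)) fun i => hVT (hv i)
        have h4 : φ (f ∘ v) = 0 := by
          rcases h2 with h2 | ⟨hTK, h2⟩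
          · exact h2 _ fun i => hfT _ (hv i)
          · exact h2 _ fun i => ⟨hfT _ (hv i), hfV _ ⟨hv i, hTK (hVT (hv i))⟩⟩
        have h5 := prism_homotopy f id φ v
        rw [h3, h4, zero_add, sub_zero, Function.id_comp] at h5
        rw [Pi.sub_apply, h5, sub_self]
      · exact (notMem_support.mp fun h => hzK (interior_subset (hφK h))).sub
          (hout z hzK).coboundary

/-- The restriction of a self-homeomorphism to an invariant subset. -/
abbrev restrictHomeo {Y : Type*} [TopologicalSpace Y] (h : Y ≃ₜ Y) {A : Set Y}
    (hA : ∀ y, y ∈ A ↔ h y ∈ A) : A ≃ₜ A := h.subtype hA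

/-- By tautness, cochains locally zero on `Z` may be used instead of cochains vanishing near `Z` to
compute the cohomology of the complement. -/
theorem isFin_vanishingNear_iff (hZ : IsClosed Z) :
    IsFin (RelH (coboundary Y) (vanishingOn Z) (locallyZero Y)) ↔
      HasFiniteHc (Zᶜ : Set Y) := by
  have := fun p => vanishingOn_acyclic hZ p
  have e := fun p => LinearEquiv.ofBijective _ (restrict_open_bijective hZ p)
  rw [hasFiniteHc_iff]
  constructor
  · intro h
    exact IsFin.congr e (isFin_triple_left coboundary_coboundary
      locallyZero_le_vanishingNear vanishingNear_le_vanishingOn h isFin_of_subsingleton)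
  · intro h
    exact isFin_triple coboundary_coboundary locallyZero_le_vanishingNear
      vanishingNear_le_vanishingOn (IsFin.congr (fun p => (e p).symm) h) isFin_of_subsingleton

theorem hasFiniteHc_of_closed (hZ : IsClosed Z) (h₁ : HasFiniteHc Z)
    (h₂ : HasFiniteHc (Zᶜ : Set Y)) : HasFiniteHc Y :=
  hasFiniteHc_iff.mpr (isFin_triple coboundary_coboundary
    (fun p => (locallyZero_le_vanishingNear p).trans (vanishingNear_le_vanishingOn p))
    vanishingOn_le ((isFin_vanishingNear_iff hZ).mpr h₂) ((isFin_vanishingOn_iff hZ).mpr h₁))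

theorem hasFiniteHc_compl (hZ : IsClosed Z) (h₁ : HasFiniteHc Z)
    (h₂ : HasFiniteHc Y) : HasFiniteHc (Zᶜ : Set Y) :=
  (isFin_vanishingNear_iff hZ).mp (isFin_triple_left coboundary_coboundary
    (fun p => (locallyZero_le_vanishingNear p).trans (vanishingNear_le_vanishingOn p))
    vanishingOn_le (hasFiniteHc_iff.mp h₂) ((isFin_vanishingOn_iff hZ).mpr h₁))

/-- Additivity of the Lefschetz number over an invariant closed subset and its complement. -/
theorem lefschetzNumber_add (hZ : IsClosed Z) (h₁ : HasFiniteHc Z)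
    (h₂ : HasFiniteHc (Zᶜ : Set Y)) (h : Y ≃ₜ Y) (hY : ∀ y, y ∈ Z ↔ h y ∈ Z)
    (hY' : ∀ y, y ∈ Zᶜ ↔ h y ∈ Zᶜ) :
    lefschetzNumber h =
      lefschetzNumber (restrictHomeo h hY) + lefschetzNumber (restrictHomeo h hY') := by
  have hac := fun p => vanishingOn_acyclic hZ p
  have sA : ∀ p, ∀ φ ∈ locallyZero Y p, pullback h p φ ∈ locallyZero Y p :=
    fun _ _ => pullback_mem_locallyZero h
  have sC : ∀ p, ∀ φ ∈ compactlySupported Y p, pullback h p φ ∈ compactlySupported Y p :=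
    fun _ _ => pullback_mem_compactlySupported h
  have sN : ∀ p, ∀ φ ∈ vanishingNear Z p, pullback h p φ ∈ vanishingNear Z p :=
    fun p φ hφ => ⟨sC p φ hφ.1, fun z hz => (hφ.2 _ ((hY z).mp hz)).pullback h.continuous⟩
  have sO : ∀ p, ∀ φ ∈ vanishingOn Z p, pullback h p φ ∈ vanishingOn Z p :=
    fun p φ hφ => ⟨sC p φ hφ.1, pullback_mem_locallyZero (restrictHomeo h hY) hφ.2⟩
  have h2' := (isFin_vanishingNear_iff hZ).mpr h₂
  rw [lefschetzNumber_eq h, lefschetz_triple (B := vanishingOn Z) (fun p => pullback h p)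
    (pullback_coboundary h) sA sO sC coboundary_coboundary
    (fun p => (locallyZero_le_vanishingNear p).trans (vanishingNear_le_vanishingOn p))
    vanishingOn_le h2' ((isFin_vanishingOn_iff hZ).mpr h₁),
    lefschetz_triple (B := vanishingNear Z) (fun p => pullback h p)
    (pullback_coboundary h) sA sN sO coboundary_coboundary
    locallyZero_le_vanishingNear vanishingNear_le_vanishingOn
    (isFin_triple_left coboundary_coboundary locallyZero_le_vanishingNear
      vanishingNear_le_vanishingOn h2' isFin_of_subsingleton) isFin_of_subsingleton,
    lefschetz_eq_zero_of_subsingleton (V := RelH (coboundary Y) (vanishingOn Z) (vanishingNear Z)),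
    add_zero, add_comm, lefschetzNumber_eq, lefschetzNumber_eq]
  congr 1
  · refine lefschetz_congr
      (fun p => LinearEquiv.ofBijective _ (restrict_closed_bijective hZ p)) fun p x => ?_
    obtain ⟨x, hx, rfl⟩ := SQ.exists_rep x
    rfl
  · refine lefschetz_congr
      (fun p => LinearEquiv.ofBijective _ (restrict_open_bijective hZ p)) fun p x => ?_
    obtain ⟨x, hx, rfl⟩ := SQ.exists_rep x
    rfl

end Tautness

end CompactSupportCohomology

/-! ### Half-spaces are acyclic -/

namespace CompactSupportCohomology

open GradedTrace

section HalfLine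

open scoped NNReal

variable {Q : Type*}

/-- The map of `[0, ∞) × Q` pushing the first coordinate up to at least `s`. -/
def pushUp (s : ℝ≥0) (y : ℝ≥0 × Q) : ℝ≥0 × Q := (max y.1 s, y.2)

theorem pushUp_of_le {s : ℝ≥0} {y : ℝ≥0 × Q} (h : s ≤ y.1) : pushUp s y = y :=
  Prod.ext (max_eq_left h) rfl

variable [TopologicalSpace Q]

theorem continuous_pushUp (s : ℝ≥0) : Continuous (pushUp (Q := Q) s) :=
  (continuous_fst.max continuous_const).prodMk continuous_snd

/-- A locally zero cochain vanishes on small tuples near the slice `{s} × C`, with smallness in the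
first coordinate uniform over the compact set `C`. -/
theorem exists_uniform_nhds {C : Set Q} (hC : IsCompact C) {p : ℕ}
    {φ : Cochain (ℝ≥0 × Q) p} (hφ : φ ∈ locallyZero (ℝ≥0 × Q) p) (s : ℝ≥0) :
    ∃ O ∈ 𝓝 s, ∀ q ∈ C, ∃ V ∈ 𝓝 q,
      ∀ v : Fin (p + 1) → ℝ≥0 × Q, (∀ i, v i ∈ O ×ˢ V) → φ v = 0 := by
  refine hC.induction_on (p := fun S => ∃ O ∈ 𝓝 s, ∀ q ∈ S, ∃ V ∈ 𝓝 q,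
    ∀ v : Fin (p + 1) → ℝ≥0 × Q, (∀ i, v i ∈ O ×ˢ V) → φ v = 0) ?_ ?_ ?_ ?_
  · exact ⟨Set.univ, Filter.univ_mem, fun q hq => absurd hq (Set.notMem_empty q)⟩
  · rintro S T hST ⟨O, hO, h⟩
    exact ⟨O, hO, fun q hq => h q (hST hq)⟩
  · rintro S T ⟨O, hO, h⟩ ⟨O', hO', h'⟩
    refine ⟨O ∩ O', Filter.inter_mem hO hO', fun q hq => ?_⟩
    rcases hq with hq | hq
    · obtain ⟨V, hV, hV0⟩ := h q hq
      exact ⟨V, hV, fun v hv => hV0 v fun i => ⟨(hv i).1.1, (hv i).2⟩⟩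
    · obtain ⟨V, hV, hV0⟩ := h' q hq
      exact ⟨V, hV, fun v hv => hV0 v fun i => ⟨(hv i).1.2, (hv i).2⟩⟩
  · intro q _
    obtain ⟨W, hW, hW0⟩ := hφ (s, q)
    obtain ⟨O, hO, V, hV, hOV⟩ := mem_nhds_prod_iff.mp hW
    obtain ⟨V', hV', hV'o, hqV'⟩ := mem_nhds_iff.mp hV
    refine ⟨V', mem_nhdsWithin_of_mem_nhds (hV'o.mem_nhds hqV'), O, hO, fun q' hq' =>
      ⟨V', hV'o.mem_nhds hq', fun v hv => hW0 v fun i => hOV ⟨(hv i).1, hV' (hv i).2⟩⟩⟩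

/-- Half-spaces have no compactly supported cohomology: the class of the pullback of a cocycle
along `pushUp s` is locally constant in `s`, and it vanishes for large `s`. -/
theorem subsingleton_hc_halfLine_prod [T2Space Q] [LocallyCompactSpace Q] (p : ℕ) :
    Subsingleton (Hc (ℝ≥0 × Q) p) := by
  refine subsingleton_of_forall_eq 0 fun q => ?_
  obtain ⟨φ₀, hφ₀, rfl⟩ := SQ.exists_rep q
  obtain ⟨C, hC, hKC⟩ := exists_compact_superset
    ((show IsCompact (support φ₀) from hφ₀.1).image continuous_snd)
  -- truncation makes the cochain vanish outright on tuples leaving `[0, ∞) × C`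
  set φ := truncate (Set.univ ×ˢ C) φ₀ with hφdef
  have hsub : φ - φ₀ ∈ locallyZero (ℝ≥0 × Q) p := truncate_sub_mem_locallyZero <| by
    rw [interior_prod_eq, interior_univ]
    exact fun y hy => ⟨trivial, hKC ⟨y, hy, rfl⟩⟩
  have hφc : φ ∈ compactlySupported (ℝ≥0 × Q) p := truncate_mem_compactlySupported _ hφ₀.1
  have hφδ : coboundary _ p φ ∈ locallyZero (ℝ≥0 × Q) (p + 1) := by
    have := add_mem (coboundary_mem_locallyZero hsub) hφ₀.2
    rwa [map_sub, sub_add_cancel] at this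
  have hφC : ∀ v : Fin (p + 1) → ℝ≥0 × Q, (∀ i, v i ∈ {y : ℝ≥0 × Q | y.2 ∉ C}) → φ v = 0 :=
    fun v hv => truncate_eq_zero (i := 0) fun h => hv 0 h.2
  have hφC' : ∀ v : Fin (p + 2) → ℝ≥0 × Q, (∀ i, v i ∈ {y : ℝ≥0 × Q | y.2 ∉ C}) →
      coboundary _ p φ v = 0 := fun v hv => by
    rw [coboundary_apply]
    refine Finset.sum_eq_zero fun i _ => ?_
    rw [hφC (v ∘ i.succAbove) fun j => hv _, mul_zero]
  have hCo : ∀ y : ℝ≥0 × Q, y.2 ∉ C → {y : ℝ≥0 × Q | y.2 ∉ C} ∈ 𝓝 y := fun y hy =>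
    (hC.isClosed.isOpen_compl.preimage continuous_snd).mem_nhds hy
  have hφ : φ ∈ cocycles (ℝ≥0 × Q) p := ⟨hφc, hφδ⟩
  have hmk : (SQ.mk φ₀ hφ₀ : Hc (ℝ≥0 × Q) p) = SQ.mk φ hφ := by
    refine SQ.mk_eq_mk.mpr ?_
    rw [← relBoundaries_eq_coboundaries]
    exact mem_relBoundaries_of_mem (by simpa using neg_mem hsub)
  obtain ⟨b, hb⟩ := ((show IsCompact (support φ) from hφc).image continuous_fst).bddAbove
  have hbK : ∀ y : ℝ≥0 × Q, b < y.1 → VanishesNear φ y := fun y hy =>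
    notMem_support.mp fun h => absurd (hb ⟨y, h, rfl⟩) (not_le.mpr hy)
  have hTc : ∀ s, pullback (pushUp s) p φ ∈ cocycles (ℝ≥0 × Q) p := fun s => by
    refine ⟨mem_compactlySupported_of_subset (isCompact_Icc.prod hC : IsCompact (Set.Icc 0 b ×ˢ C))
      fun y hy => ?_, fun y => (hφδ _).pullback (continuous_pushUp s)⟩
    by_cases hyC : y.2 ∈ C
    · refine (hbK _ ?_).pullback (continuous_pushUp s)
      exact lt_max_of_lt_left (not_le.mp fun h => hy ⟨⟨zero_le, h⟩, hyC⟩)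
    · exact ⟨_, hCo y hyC, fun v hv => hφC _ fun i => hv i⟩
  -- the class of the cocycle pulled back along `pushUp s`
  let c : ℝ≥0 → Hc (ℝ≥0 × Q) p := fun s => SQ.mk _ (hTc s)
  have hc0 : c 0 = SQ.mk φ hφ := SQ.mk_eq_mk.mpr <| by
    have : pullback (pushUp 0) p φ = φ :=
      funext fun v => congrArg φ (funext fun i => pushUp_of_le zero_le)
    rw [this, sub_self]
    exact Submodule.zero_mem _
  have hc1 : c (b + 1) = 0 := SQ.mk_eq_zero.mpr <| by
    rw [← relBoundaries_eq_coboundaries]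
    refine mem_relBoundaries_of_mem fun y => (hbK _ ?_).pullback (continuous_pushUp _)
    exact lt_max_of_lt_right (lt_add_one b)
  have hloc : IsLocallyConstant c := by
    rw [IsLocallyConstant.iff_eventually_eq]
    intro s
    obtain ⟨O, hO, hOC⟩ := exists_uniform_nhds hC hφδ s
    obtain ⟨ε, hε, hεO⟩ := Metric.mem_nhds_iff.mp hO
    refine Filter.eventually_of_mem (Metric.ball_mem_nhds s hε) fun s' hs' => ?_
    -- above both slices the two maps are the identity; elsewhere their first coordinates stay near
    -- `s`, where smallness is uniform
    have hlz : ∀ y, VanishesNear (prism (pushUp s) (pushUp s') p (coboundary _ p φ)) y := by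
      intro y
      by_cases hyC : y.2 ∈ C
      swap
      · exact ⟨_, hCo y hyC, fun v hv => prism_eq_zero _ _ hφC' (fun i => hv i) fun i => hv i⟩
      obtain ⟨V, hV, hV0⟩ := hOC y.2 hyC
      have hVy : {z : ℝ≥0 × Q | z.2 ∈ V} ∈ 𝓝 y := continuous_snd.continuousAt hV
      by_cases hyO : y.1 ∈ Metric.ball s ε
      · refine ⟨_, Filter.inter_mem (continuous_fst.continuousAt
          (Metric.isOpen_ball.mem_nhds hyO)) hVy, fun v hv => prism_eq_zero _ _ hV0
            (fun i => ⟨hεO ?_, (hv i).2⟩) fun i => ⟨hεO ?_, (hv i).2⟩⟩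
        · rcases max_choice (v i).1 s with h | h <;> simp only [pushUp, h]
          · exact (hv i).1
          · exact Metric.mem_ball_self hε
        · rcases max_choice (v i).1 s' with h | h <;> simp only [pushUp, h]
          · exact (hv i).1
          · exact hs'
      have hs : ¬ |(y.1 : ℝ) - s| < ε := hyO
      have hs2 : |(s' : ℝ) - s| < ε := hs'
      rw [abs_lt] at hs2
      rcases le_total y.1 s with hys | hys
      · have h3 : (y.1 : ℝ) ≤ s := hys
        have h1 : y.1 < min s s' := by
          rw [abs_sub_comm, abs_of_nonneg (by linarith)] at hs
          refine lt_min ?_ ?_ <;> rw [← NNReal.coe_lt_coe] <;> linarith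
        refine ⟨_, Filter.inter_mem ((isOpen_Iio.preimage continuous_fst).mem_nhds h1) hVy,
          fun v hv => prism_eq_zero _ _ hV0 (fun i => ⟨hεO ?_, (hv i).2⟩)
            fun i => ⟨hεO ?_, (hv i).2⟩⟩
        · have : (v i).1 ≤ s := ((hv i).1.trans_le (min_le_left _ _)).le
          simp only [pushUp, max_eq_right this]
          exact Metric.mem_ball_self hε
        · have : (v i).1 ≤ s' := ((hv i).1.trans_le (min_le_right _ _)).le
          simp only [pushUp, max_eq_right this]
          exact hs'
      · have h3 : (s : ℝ) ≤ y.1 := hys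
        have h1 : max s s' < y.1 := by
          rw [abs_of_nonneg (by linarith)] at hs
          refine max_lt ?_ ?_ <;> rw [← NNReal.coe_lt_coe] <;> linarith
        obtain ⟨W, hW, hW0⟩ := hφδ y
        refine ⟨_, Filter.inter_mem ((isOpen_Ioi.preimage continuous_fst).mem_nhds h1) hW,
          fun v hv => prism_eq_zero _ _ hW0 (fun i => ?_) fun i => ?_⟩
        · rw [pushUp_of_le ((le_max_left _ _).trans_lt (hv i).1).le]
          exact (hv i).2
        · rw [pushUp_of_le ((le_max_right _ _).trans_lt (hv i).1).le]
          exact (hv i).2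
    refine SQ.mk_eq_mk.mpr ?_
    rw [← relBoundaries_eq_coboundaries]
    cases p with
    | zero =>
      refine mem_relBoundaries_of_mem fun y => ?_
      convert hlz y using 1
      funext v
      rw [prism_coboundary_zero]
      rfl
    | succ p =>
      refine mem_relBoundaries_succ.mpr ⟨prism (pushUp s) (pushUp s') p φ, ?_, fun y => ?_⟩
      · refine mem_compactlySupported_of_subset
          (isCompact_Icc.prod hC : IsCompact (Set.Icc 0 (max b (max s s')) ×ˢ C)) fun y hy => ?_
        by_cases hyC : y.2 ∈ C
        swap
        · exact ⟨_, hCo y hyC, fun v hv => prism_eq_zero _ _ hφC (fun i => hv i) fun i => hv i⟩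
        have hy1 : max b (max s s') < y.1 := not_le.mp fun h => hy ⟨⟨zero_le, h⟩, hyC⟩
        obtain ⟨W, hW, hW0⟩ := hbK y ((le_max_left _ _).trans_lt hy1)
        refine ⟨_, Filter.inter_mem ((isOpen_Ioi.preimage continuous_fst).mem_nhds
          ((le_max_right _ _).trans_lt hy1)) hW,
          fun v hv => prism_eq_zero _ _ hW0 (fun i => ?_) fun i => ?_⟩
        · rw [pushUp_of_le ((le_max_left _ _).trans_lt (hv i).1).le]
          exact (hv i).2
        · rw [pushUp_of_le ((le_max_right _ _).trans_lt (hv i).1).le]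
          exact (hv i).2
      · convert hlz y using 1
        funext v
        have := prism_homotopy (pushUp s) (pushUp s') φ v
        rw [Pi.sub_apply, Pi.sub_apply]
        change φ (pushUp s' ∘ v) - φ (pushUp s ∘ v) - _ = _
        rw [← this, add_sub_cancel_right]
  rw [hmk, ← hc0, ← hc1]
  exact hloc.apply_eq_of_preconnectedSpace _ _

end HalfLine

end CompactSupportCohomology

/-! ### Cohomology of open cells -/

namespace CompactSupportCohomology

open GradedTrace

section Cells

open scoped NNReal

/-- `A` has the compactly supported cohomological invariants of an open cell of dimension `d`. -/
structure IsCell (d : ℕ) (A : Type*) [TopologicalSpace A] : Prop where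
  finite : HasFiniteHc A
  lefschetz : lefschetzNumber (Homeomorph.refl A) = (-1) ^ d

theorem IsCell.congr {d : ℕ} {A B : Type*} [TopologicalSpace A] [TopologicalSpace B]
    (h : IsCell d A) (e : A ≃ₜ B) : IsCell d B :=
  ⟨(transport_homeomorph e).1 h.finite,
    ((transport_homeomorph e).2 (Homeomorph.refl A) (Homeomorph.refl B) fun _ => rfl) ▸ h.lefschetz⟩

/-- The Euler characteristic is the Lefschetz number of the identity. -/
theorem cast_chiC {Y : Type*} [TopologicalSpace Y] (h : HasFiniteHc Y) :
    (chiC Y : ℚ) = lefschetzNumber (Homeomorph.refl Y) := by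
  obtain ⟨hf, N, hN⟩ := h
  unfold lefschetzNumber chiC
  rw [lefschetz_eq_sum_range _ hN, finsum_eq_sum_of_support_subset (s := Finset.range N)]
  · push_cast
    refine Finset.sum_congr rfl fun p _ => ?_
    have : Hc.map (Homeomorph.refl Y) p = LinearMap.id := by
      refine LinearMap.ext fun q => ?_
      obtain ⟨x, hx, rfl⟩ := SQ.exists_rep q
      rfl
    rw [this, LinearMap.trace_id]
  · intro p hp
    rw [Finset.coe_range, Set.mem_Iio]
    by_contra hn
    have := hN p (not_lt.mp hn)
    exact hp (by simp [Module.finrank_zero_of_subsingleton])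

theorem hasFiniteHc_of_isEmpty {Y : Type*} [TopologicalSpace Y] [IsEmpty Y] : HasFiniteHc Y :=
  have : ∀ p, Subsingleton (Hc Y p) := fun _ => inferInstance
  isFin_of_subsingleton

theorem isCell_of_unique (A : Type*) [TopologicalSpace A] [Unique A] : IsCell 0 A := by
  have hlz : ∀ (p : ℕ) (φ : Cochain A p), φ ∈ locallyZero A p → φ = 0 := by
    intro p φ h
    obtain ⟨V, hV, hV0⟩ := h default
    funext v
    refine hV0 v fun i => ?_
    rw [Subsingleton.elim (v i) default]
    exact mem_of_mem_nhds hV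
  have hsub : ∀ p, Subsingleton (Hc A (p + 1)) := by
    intro p
    refine subsingleton_of_forall_eq 0 fun q => ?_
    obtain ⟨φ, hφ, rfl⟩ := SQ.exists_rep q
    refine SQ.mk_eq_zero.mpr ?_
    rw [← relBoundaries_eq_coboundaries]
    refine mem_relBoundaries_succ.mpr ⟨contract default φ,
      mem_compactlySupported_of_subset isCompact_univ fun y hy => absurd trivial hy, ?_⟩
    rw [← contract_coboundary, hlz _ _ hφ.2]
    exact Submodule.zero_mem _
  let e : Hc A 0 ≃ₗ[ℚ] ℚ := LinearEquiv.ofBijective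
    ((coboundaries A 0).submoduleOf (cocycles A 0) |>.liftQ
      ((LinearMap.proj default : Cochain A 0 →ₗ[ℚ] ℚ) ∘ₗ (cocycles A 0).subtype) (by
        rintro ⟨φ, hφ⟩ h
        have : φ = 0 := hlz 0 φ h
        simp [this])) (by
    constructor
    · rw [injective_iff_map_eq_zero]
      intro q hq
      obtain ⟨φ, hφ, rfl⟩ := SQ.exists_rep q
      refine SQ.mk_eq_zero.mpr ?_
      have h1 : φ default = 0 := hq
      have : φ = 0 := funext fun v => by rw [Subsingleton.elim v default, h1]; rfl
      rw [this]
      exact Submodule.zero_mem _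
    · intro c
      refine ⟨SQ.mk (fun _ => c) ⟨mem_compactlySupported_of_subset isCompact_univ
        fun y hy => absurd trivial hy, ?_⟩, rfl⟩
      have : coboundary A 0 (fun _ => c) = 0 := cochain_ext_cons fun x w => by
        rw [coboundary_zero_cons]
        simp
      rw [SetLike.mem_coe, Submodule.mem_comap, this]
      exact Submodule.zero_mem _)
  have hfin : HasFiniteHc A := by
    refine ⟨fun p => ?_, 1, fun p hp => ?_⟩
    · cases p with
      | zero => exact Module.Finite.equiv e.symm
      | succ p =>
        have := hsub p
        infer_instance
    · obtain ⟨p, rfl⟩ : ∃ q, p = q + 1 := ⟨p - 1, by omega⟩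
      exact hsub p
  refine ⟨hfin, ?_⟩
  rw [← cast_chiC hfin, pow_zero]
  unfold chiC
  rw [finsum_eq_single _ 0]
  · simp [LinearEquiv.finrank_eq e]
  · intro p hp
    obtain ⟨p, rfl⟩ : ∃ q, p = q + 1 := ⟨p - 1, by omega⟩
    have := hsub p
    simp [Module.finrank_zero_of_subsingleton]

/-- The half-space `[0, ∞) × Q` is acyclic, so its interior and its boundary `{0} × Q` have opposite
Lefschetz numbers. -/
theorem isCell_pos_prod {d : ℕ} {Q : Type*} [TopologicalSpace Q] [T2Space Q]
    [LocallyCompactSpace Q] (hQ : IsCell d Q) : IsCell (d + 1) ({t : ℝ≥0 // t ≠ 0} × Q) := by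
  let Z : Set (ℝ≥0 × Q) := {y | y.1 = 0}
  have hZ : IsClosed Z := isClosed_singleton.preimage continuous_fst
  let e₁ : Q ≃ₜ Z :=
    { toFun := fun q => ⟨(0, q), rfl⟩
      invFun := fun z => z.1.2
      left_inv := fun q => rfl
      right_inv := fun z => Subtype.ext (Prod.ext z.2.symm rfl)
      continuous_toFun := by fun_prop
      continuous_invFun := by fun_prop }
  let e₂ : (Zᶜ : Set (ℝ≥0 × Q)) ≃ₜ {t : ℝ≥0 // t ≠ 0} × Q :=
    { toFun := fun z => (⟨z.1.1, z.2⟩, z.1.2)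
      invFun := fun y => ⟨(y.1.1, y.2), y.1.2⟩
      left_inv := fun q => rfl
      right_inv := fun z => rfl
      continuous_toFun := by fun_prop
      continuous_invFun := by fun_prop }
  have h0 := fun p => subsingleton_hc_halfLine_prod (Q := Q) p
  have hcZ := hQ.congr e₁
  have hfY : HasFiniteHc (ℝ≥0 × Q) := isFin_of_subsingleton
  have hfU := hasFiniteHc_compl hZ hcZ.finite hfY
  have hadd := lefschetzNumber_add hZ hcZ.finite hfU (Homeomorph.refl _) (fun _ => Iff.rfl)
    (fun _ => Iff.rfl)
  have h1 : lefschetzNumber (Homeomorph.refl (ℝ≥0 × Q)) = 0 :=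
    lefschetz_eq_zero_of_subsingleton (V := fun p => Hc (ℝ≥0 × Q) p) _
  have h2 : lefschetzNumber (restrictHomeo (Homeomorph.refl (ℝ≥0 × Q)) (A := Z)
      fun _ => Iff.rfl) = (-1) ^ d := hcZ.lefschetz
  have hU : IsCell (d + 1) (Zᶜ : Set (ℝ≥0 × Q)) := by
    refine ⟨hfU, ?_⟩
    rw [h1, h2] at hadd
    have h3 : lefschetzNumber (Homeomorph.refl (Zᶜ : Set (ℝ≥0 × Q))) = _ :=
      (neg_eq_of_add_eq_zero_right hadd.symm).symm
    rw [h3, pow_succ]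
    ring
  exact hU.congr e₂

/-- The open unit cube. -/
abbrev OpenCube (m : ℕ) : Type := {v : Fin m → ℝ // ∀ j, 0 < v j ∧ v j < 1}

theorem isCell_pi_pos (m : ℕ) : IsCell m (Fin m → {t : ℝ≥0 // t ≠ 0}) := by
  have : LocallyCompactSpace {t : ℝ≥0 // t ≠ 0} :=
    (isOpen_compl_singleton : IsOpen ({0}ᶜ : Set ℝ≥0)).locallyCompactSpace
  induction m with
  | zero => exact isCell_of_unique _
  | succ m ih =>
    let e : {t : ℝ≥0 // t ≠ 0} × (Fin m → {t : ℝ≥0 // t ≠ 0}) ≃ₜ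
        (Fin (m + 1) → {t : ℝ≥0 // t ≠ 0}) :=
      { Fin.consEquiv (fun _ => {t : ℝ≥0 // t ≠ 0}) with
        continuous_toFun := by
          refine continuous_pi fun i => ?_
          refine Fin.cases ?_ (fun i => ?_) i
          · exact continuous_fst
          · exact (continuous_apply i).comp continuous_snd
        continuous_invFun := (continuous_apply 0).prodMk
          (continuous_pi fun i => continuous_apply i.succ) }
    exact (isCell_pos_prod ih).congr e

theorem isCell_openCube (m : ℕ) : IsCell m (OpenCube m) := by
  -- coordinatewise, `t ↦ t / (1 + t)` maps `(0, ∞)` to `(0, 1)`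
  refine (isCell_pi_pos m).congr
    { toFun := fun w => ⟨fun j => (w j : ℝ≥0) / (1 + (w j : ℝ≥0)), fun j => ?_⟩
      invFun := fun v j => ⟨⟨v.1 j / (1 - v.1 j), ?_⟩, ?_⟩
      left_inv := fun w => ?_
      right_inv := fun v => ?_
      continuous_toFun := ?_
      continuous_invFun := ?_ }
  · have h1 : (0 : ℝ) < (w j : ℝ≥0) := NNReal.coe_pos.mpr (pos_iff_ne_zero.mpr (w j).2)
    constructor
    · positivity
    · rw [div_lt_one (by positivity)]
      linarith
  · exact div_nonneg (v.2 j).1.le (by linarith [(v.2 j).2])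
  · intro h
    have h1 := congrArg NNReal.toReal h
    have h2 : v.1 j / (1 - v.1 j) ≠ 0 :=
      div_ne_zero (v.2 j).1.ne' (by linarith [(v.2 j).2])
    exact h2 h1
  · funext j
    apply Subtype.ext
    apply NNReal.eq
    have h1 : (0 : ℝ) < (w j : ℝ≥0) := NNReal.coe_pos.mpr (pos_iff_ne_zero.mpr (w j).2)
    change ((w j : ℝ≥0) : ℝ) / (1 + (w j : ℝ≥0)) / (1 - (w j : ℝ≥0) / (1 + (w j : ℝ≥0))) = _
    field_simp
    ring
  · apply Subtype.ext
    funext j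
    have h1 := (v.2 j).2
    have h2 : (1 : ℝ) - v.1 j ≠ 0 := by linarith
    change v.1 j / (1 - v.1 j) / (1 + v.1 j / (1 - v.1 j)) = v.1 j
    field_simp
    ring
  · refine Continuous.subtype_mk (continuous_pi fun j => ?_) _
    have h1 : Continuous fun w : Fin m → {t : ℝ≥0 // t ≠ 0} => ((w j : ℝ≥0) : ℝ) := by fun_prop
    exact h1.div (continuous_const.add h1) fun _ => by positivity
  · refine continuous_pi fun j => Continuous.subtype_mk (Continuous.subtype_mk ?_ _) _
    have h1 : Continuous fun v : OpenCube m => v.1 j :=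
      (continuous_apply j).comp continuous_subtype_val
    exact h1.div (continuous_const.sub h1) fun v : OpenCube m => by linarith [(v.2 j).2]

end Cells

/-! ### Homeomorphisms that move all pieces of a partition -/

section Permuted

variable {Y : Type*} [TopologicalSpace Y]

theorem truncate_sub_vanishesNear {A : Set Y} (hA : IsOpen A) {p : ℕ} (φ : Cochain Y p) {y : Y}
    (hy : y ∈ A) : VanishesNear (truncate A φ - φ) y :=
  ⟨A, hA.mem_nhds hy, fun v hv => by rw [Pi.sub_apply, truncate, if_pos hv, sub_self]⟩

theorem truncate_vanishesNear {A : Set Y} (hA : IsClosed A) {p : ℕ} (φ : Cochain Y p) {y : Y}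
    (hy : y ∉ A) : VanishesNear (truncate A φ) y :=
  ⟨Aᶜ, hA.isOpen_compl.mem_nhds hy, fun _ hv => truncate_eq_zero (i := 0) (hv 0)⟩

/-- Truncation to a subset as a linear map. -/
def truncateLinear (A : Set Y) (p : ℕ) : Cochain Y p →ₗ[ℚ] Cochain Y p where
  toFun := truncate A
  map_add' φ ψ := by
    funext v
    simp only [truncate, Pi.add_apply]
    split_ifs <;> simp
  map_smul' c φ := by
    funext v
    simp only [truncate, Pi.smul_apply, RingHom.id_apply]
    split_ifs <;> simp

theorem coboundary_truncate_sub_mem {A : Set Y} (hA : IsClopen A) {p : ℕ} (φ : Cochain Y p) :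
    coboundary Y p (truncate A φ) - truncate A (coboundary Y p φ) ∈ locallyZero Y (p + 1) := by
  intro y
  by_cases hy : y ∈ A
  · have h1 := (truncate_sub_vanishesNear hA.isOpen φ hy).coboundary
    have h2 := truncate_sub_vanishesNear hA.isOpen (coboundary Y p φ) hy
    rw [map_sub] at h1
    have := h1.sub h2
    rwa [sub_sub_sub_cancel_right] at this
  · exact (truncate_vanishesNear hA.isClosed φ hy).coboundary.sub
      (truncate_vanishesNear hA.isClosed _ hy)

/-- The projector of `Hᵖ_c(Y)` onto the summand of a clopen subset. -/
def clopenProjector {A : Set Y} (hA : IsClopen A) (p : ℕ) : Hc Y p →ₗ[ℚ] Hc Y p :=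
  SQ.map (truncateLinear A p)
    (fun φ hφ => ⟨truncate_mem_compactlySupported A hφ.1, by
      have h1 : truncate A (coboundary Y p φ) ∈ locallyZero Y (p + 1) :=
        fun y => VanishesNear.truncate (hφ.2 y)
      have := add_mem (coboundary_truncate_sub_mem hA φ) h1
      rwa [sub_add_cancel] at this⟩)
    (fun φ hφ => by
      rw [← relBoundaries_eq_coboundaries] at hφ ⊢
      cases p with
      | zero => exact fun y => VanishesNear.truncate (hφ y)
      | succ p =>
        obtain ⟨ψ, hψ, h⟩ := mem_relBoundaries_succ.mp hφ
        refine mem_relBoundaries_succ.mpr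
          ⟨truncate A ψ, truncate_mem_compactlySupported A hψ, ?_⟩
        have h1 : truncateLinear A (p + 1) (φ - coboundary Y p ψ) ∈ locallyZero Y (p + 1) :=
          fun y => VanishesNear.truncate (h y)
        have h2 := sub_mem h1 (coboundary_truncate_sub_mem hA ψ)
        rw [map_sub] at h2
        convert h2 using 1
        change _ = truncateLinear A (p + 1) φ - truncateLinear A (p + 1) (coboundary Y p ψ) -
          (coboundary Y p (truncate A ψ) - truncateLinear A (p + 1) (coboundary Y p ψ))
        abel)

/-- A homeomorphism that moves every piece of a finite clopen partition off itself has Lefschetz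
number zero: its matrix with respect to the decomposition of the cohomology has zero diagonal. -/
theorem lefschetzNumber_eq_zero_of_moves {ι : Type*} (J : Finset ι) (S : ι → Set Y)
    (hS : ∀ i ∈ J, IsClopen (S i)) (hd : ∀ i ∈ J, ∀ j ∈ J, i ≠ j → Disjoint (S i) (S j))
    (hcov : ∀ y, ∃ i ∈ J, y ∈ S i) (hfin : HasFiniteHc Y) (h : Y ≃ₜ Y)
    (hh : ∀ i ∈ J, ∀ y ∈ S i, h y ∉ S i) : lefschetzNumber h = 0 := by
  classical
  refine finsum_eq_zero_of_forall_eq_zero fun p => ?_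
  have := hfin.1 p
  let π : J → (Hc Y p →ₗ[ℚ] Hc Y p) := fun i => clopenProjector (hS i i.2) p
  have hsum : ∑ i, π i = LinearMap.id := by
    refine LinearMap.ext fun q => ?_
    obtain ⟨φ, hφ, rfl⟩ := SQ.exists_rep q
    rw [LinearMap.sum_apply, LinearMap.id_apply]
    have h1 : ∀ i : J, π i (SQ.mk φ hφ) = Submodule.mkQ _
        ((truncateLinear (S i) p).restrict (p := cocycles Y p) (q := cocycles Y p) _ ⟨φ, hφ⟩) :=
      fun i => rfl
    rw [Finset.sum_congr rfl fun i _ => h1 i, ← map_sum]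
    refine (Submodule.Quotient.eq _).mpr ?_
    refine Submodule.mem_comap.mpr ?_
    rw [← relBoundaries_eq_coboundaries]
    refine mem_relBoundaries_of_mem fun y => ?_
    rw [map_sub, map_sum]
    change VanishesNear (∑ i : J, truncate (S i) φ - φ) y
    obtain ⟨i, hi, hy⟩ := hcov y
    rw [← Finset.add_sum_erase _ _ (Finset.mem_univ (⟨i, hi⟩ : J)), add_sub_right_comm]
    refine (truncate_sub_vanishesNear (hS i hi).isOpen φ hy).add ?_
    refine Finset.sum_induction _ (fun ψ => VanishesNear ψ y) (fun _ _ => VanishesNear.add)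
      (VanishesNear.zero y) fun j hj => ?_
    refine truncate_vanishesNear (hS j j.2).isClosed φ fun hyj => ?_
    exact Set.disjoint_left.mp (hd i hi j j.2 fun e => (Finset.ne_of_mem_erase hj)
      (Subtype.ext e.symm)) hy hyj
  have hidem : ∀ i, π i ∘ₗ π i = π i := by
    intro i
    refine LinearMap.ext fun q => ?_
    obtain ⟨φ, hφ, rfl⟩ := SQ.exists_rep q
    have : truncate (S i) (truncate (S i) φ) = truncate (S i) φ := by
      funext v
      unfold truncate
      split_ifs <;> rfl
    refine SQ.mk_eq_mk.mpr ?_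
    change truncate (S i) (truncate (S i) φ) - truncate (S i) φ ∈ _
    rw [this, sub_self]
    exact Submodule.zero_mem _
  have hzero : ∀ i, π i ∘ₗ Hc.map h p ∘ₗ π i = 0 := by
    intro i
    refine LinearMap.ext fun q => ?_
    obtain ⟨φ, hφ, rfl⟩ := SQ.exists_rep q
    have : truncate (S i) (pullback h p (truncate (S i) φ)) = 0 := by
      funext v
      by_cases hv : v 0 ∈ S i
      · unfold truncate
        split_ifs
        · exact if_neg fun h' => hh i i.2 _ hv (h' 0)
        · rfl
      · exact truncate_eq_zero hv
    refine SQ.mk_eq_zero.mpr ?_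
    change truncate (S i) (pullback h p (truncate (S i) φ)) ∈ _
    rw [this]
    exact Submodule.zero_mem _
  have key : LinearMap.trace ℚ _ (Hc.map h p) = 0 := by
    have h1 : Hc.map h p = ∑ i, (Hc.map h p ∘ₗ π i) ∘ₗ π i := by
      simp_rw [LinearMap.comp_assoc, hidem]
      have h2 : ∑ i, Hc.map h p ∘ₗ π i = Hc.map h p ∘ₗ ∑ i, π i :=
        (Finset.mul_sum (R := Module.End ℚ (Hc Y p)) _ _ _).symm
      rw [h2, hsum, LinearMap.comp_id]
    rw [h1, map_sum]
    refine Finset.sum_eq_zero fun i _ => ?_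
    rw [LinearMap.trace_comp_comm', hzero, map_zero]
  rw [key, mul_zero]

end Permuted

end CompactSupportCohomology

/-! ### Spaces stratified by open cells -/

namespace CompactSupportCohomology

open GradedTrace

universe u

section Strata

variable {I : Type*}

/-- `typ` stratifies `Y` by the fibres over the finite set `J`: the stratum of index `i` is a cell
of dimension `dm i`, and its frontier consists of points in strata of smaller rank. -/
structure IsStratification {Y : Type*} [TopologicalSpace Y] (typ : Y → I) (rk dm : I → ℕ)
    (J : Finset I) : Prop where
  mem : ∀ y, typ y ∈ J
  frontier : ∀ i ∈ J, ∀ y ∈ closure (typ ⁻¹' {i}), typ y = i ∨ rk (typ y) < rk i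
  cell : ∀ i ∈ J, IsCell (dm i) (typ ⁻¹' {i})

/-- A subset contained in a subset `A`, seen inside the subspace `A`. -/
def preimageHomeo {Y : Type*} [TopologicalSpace Y] {A B : Set Y} (h : B ⊆ A) :
    B ≃ₜ (Subtype.val ⁻¹' B : Set A) where
  toFun b := ⟨⟨b, h b.2⟩, b.2⟩
  invFun a := ⟨a.1, a.2⟩
  left_inv _ := rfl
  right_inv _ := rfl
  continuous_toFun := by fun_prop
  continuous_invFun := by fun_prop

variable {Y : Type*} [TopologicalSpace Y] {typ : Y → I} {rk dm : I → ℕ} {J : Finset I}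

theorem IsStratification.restrict (hS : IsStratification typ rk dm J) {K : Finset I} (hK : K ⊆ J)
    {A : Set Y} (hA : ∀ y, y ∈ A ↔ typ y ∈ K) :
    IsStratification (fun y : A => typ y) rk dm K where
  mem y := (hA y).mp y.2
  frontier i hi y hy :=
    hS.frontier i (hK hi) y (continuous_subtype_val.closure_preimage_subset _ hy)
  cell i hi := (hS.cell i (hK hi)).congr (preimageHomeo fun y hy => (hA y).mpr (by
    rw [Set.mem_preimage, Set.mem_singleton_iff] at hy
    rwa [hy]))

theorem IsStratification.isClosed (hS : IsStratification typ rk dm J) {K : Finset I} (hK : K ⊆ J)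
    (hlow : ∀ i ∈ K, ∀ j ∈ J, rk j < rk i → j ∈ K) : IsClosed {y | typ y ∈ K} := by
  have h : {y | typ y ∈ K} = ⋃ i ∈ K, typ ⁻¹' {i} := by
    ext y
    simp
  rw [h]
  refine isClosed_of_closure_subset ?_
  rw [Finset.closure_biUnion]
  refine Set.iUnion₂_subset fun i hi y hy => ?_
  rw [← h]
  rcases hS.frontier i (hK hi) y hy with h1 | h1
  · exact show typ y ∈ K from h1 ▸ hi
  · exact hlow i hi _ (hS.mem y) h1

/-- Stratified spaces have finite compactly supported cohomology: a stratum of maximal rank is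
open, and the rest has fewer strata. -/
theorem IsStratification.hasFiniteHc {I : Type*} {rk dm : I → ℕ} : ∀ (n : ℕ) {Y : Type u}
    [TopologicalSpace Y] [T2Space Y] [LocallyCompactSpace Y] {typ : Y → I} {J : Finset I},
    J.card = n → IsStratification typ rk dm J → HasFiniteHc Y := by
  classical
  intro n
  induction n with
  | zero =>
    intro Y _ _ _ typ J hJ hS
    have : IsEmpty Y := ⟨fun y => by simpa [Finset.card_eq_zero.mp hJ] using hS.mem y⟩
    exact hasFiniteHc_of_isEmpty
  | succ n ih =>
    intro Y _ _ _ typ J hJ hS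
    obtain ⟨i, hi, hmax⟩ := J.exists_max_image rk (Finset.card_pos.mp (by omega))
    let K := J.erase i
    have hKJ : K ⊆ J := Finset.erase_subset _ _
    have hZ : IsClosed {y | typ y ∈ K} := hS.isClosed hKJ fun j hj k hk hkj => by
      refine Finset.mem_erase.mpr ⟨?_, hk⟩
      rintro rfl
      exact absurd (hmax j (hKJ hj)) (not_le.mpr hkj)
    have : LocallyCompactSpace {y | typ y ∈ K} :=
      hZ.isClosedEmbedding_subtypeVal.locallyCompactSpace
    have hZc : ({y | typ y ∈ K}ᶜ : Set Y) = typ ⁻¹' {i} := by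
      ext y
      have := hS.mem y
      simp only [K, Set.mem_compl_iff, Set.mem_ofPred_eq, Finset.mem_erase, Set.mem_preimage,
        Set.mem_singleton_iff]
      tauto
    refine hasFiniteHc_of_closed hZ (ih (by rw [Finset.card_erase_of_mem hi]; omega)
      (hS.restrict hKJ fun y => Iff.rfl)) ?_
    rw [hZc]
    exact (hS.cell i hi).finite

/-- The Lefschetz number of a homeomorphism permuting the strata of a stratified space, and fixing
pointwise each stratum that it preserves, counts the preserved strata with signs. -/
theorem IsStratification.lefschetzNumber_eq {I : Type*} [DecidableEq I] {rk dm : I → ℕ}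
    (τ : Equiv.Perm I) (hrk : ∀ i, rk (τ i) = rk i) : ∀ (n : ℕ) {Y : Type u}
    [TopologicalSpace Y] [T2Space Y] [LocallyCompactSpace Y] {typ : Y → I} {J : Finset I}
    (_ : J.card = n) (_ : IsStratification typ rk dm J) (h : Y ≃ₜ Y)
    (_ : ∀ y, typ (h y) = τ (typ y)) (_ : ∀ i, i ∈ J ↔ τ i ∈ J)
    (_ : ∀ y, τ (typ y) = typ y → h y = y),
    lefschetzNumber h = ∑ i ∈ J with τ i = i, (-1 : ℚ) ^ dm i := by
  classical
  intro n
  induction n using Nat.strong_induction_on with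
  | _ n ih =>
    intro Y _ _ _ typ J hJ hS h hτ hJτ hfix
    rcases J.eq_empty_or_nonempty with rfl | hne
    · have : IsEmpty Y := ⟨fun y => by simpa using hS.mem y⟩
      have : ∀ p, Subsingleton (Hc Y p) := fun _ => inferInstance
      rw [Finset.filter_empty, Finset.sum_empty]
      exact lefschetz_eq_zero_of_subsingleton (V := fun p => Hc Y p) _
    obtain ⟨i, hi, hmax⟩ := J.exists_max_image rk hne
    -- The orbit of a stratum of maximal rank is removed at once: it is open, and its strata are
    -- clopen in it. It is a single fixed stratum, or all its strata are moved.
    let O := J.filter fun j => τ.SameCycle i j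
    let K := J.filter fun j => ¬ τ.SameCycle i j
    have hOJ : O ⊆ J := Finset.filter_subset _ _
    have hKJ : K ⊆ J := Finset.filter_subset _ _
    have hOrk : ∀ j ∈ O, rk j = rk i := by
      intro j hj
      obtain ⟨k, rfl⟩ := (Finset.mem_filter.mp hj).2
      have h1 : ∀ k : ℕ, ∀ j, rk ((τ ^ k) j) = rk j := by
        intro k
        induction k with
        | zero => intro j; rfl
        | succ k ih => intro j; rw [pow_succ', Equiv.Perm.mul_apply, hrk, ih]
      cases k with
      | ofNat k => exact h1 k i
      | negSucc k =>
        rw [zpow_negSucc, ← h1 (k + 1) ((τ ^ (k + 1))⁻¹ i), ← Equiv.Perm.mul_apply,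
          mul_inv_cancel, Equiv.Perm.one_apply]
    have hZ : IsClosed {y | typ y ∈ K} := hS.isClosed hKJ fun j hj k hk hkj => by
      refine Finset.mem_filter.mpr ⟨hk, fun hik => ?_⟩
      have h1 := hOrk k (Finset.mem_filter.mpr ⟨hk, hik⟩)
      have h2 := hmax j (hKJ hj)
      omega
    have hZc : ∀ y, y ∈ ({y | typ y ∈ K}ᶜ : Set Y) ↔ typ y ∈ O := by
      intro y
      have := hS.mem y
      simp only [K, O, Set.mem_compl_iff, Set.mem_ofPred_eq, Finset.mem_filter]
      tauto
    have hLZ : LocallyCompactSpace {y | typ y ∈ K} :=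
      hZ.isClosedEmbedding_subtypeVal.locallyCompactSpace
    have hLU : LocallyCompactSpace ({y | typ y ∈ K}ᶜ : Set Y) :=
      hZ.isOpen_compl.locallyCompactSpace
    have hSZ : IsStratification (fun y : {y | typ y ∈ K} => typ y) rk dm K :=
      hS.restrict hKJ fun y => Iff.rfl
    have hSU := hS.restrict hOJ hZc
    have hKτ : ∀ j, j ∈ K ↔ τ j ∈ K := fun j => by
      simp only [K, Finset.mem_filter, Equiv.Perm.sameCycle_apply_right]
      rw [hJτ]
    have hinv : ∀ y, y ∈ {y | typ y ∈ K} ↔ h y ∈ {y | typ y ∈ K} := fun y => by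
      rw [Set.mem_ofPred, Set.mem_ofPred, hτ, ← hKτ]
    have hfU := hSU.hasFiniteHc _ rfl
    rw [lefschetzNumber_add hZ (hSZ.hasFiniteHc _ rfl) hfU h hinv
      fun y => not_congr (hinv y)]
    have hcard : K.card < n := by
      rw [← hJ]
      exact Finset.card_lt_card (Finset.filter_ssubset.mpr ⟨i, hi, fun h => h (.refl _ _)⟩)
    rw [ih _ hcard rfl hSZ (restrictHomeo h hinv) (fun y => hτ y) hKτ
      fun y hy => Subtype.ext (hfix y hy)]
    by_cases hτi : τ i = i
    · have hcyc : ∀ j, τ.SameCycle i j ↔ j = i := by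
        intro j
        constructor
        · rintro ⟨k, rfl⟩
          exact Function.IsFixedPt.perm_zpow (e := τ) hτi k
        · rintro rfl
          exact .refl _ _
      have hO : O = {i} := by
        ext j
        simp only [O, Finset.mem_filter, hcyc, Finset.mem_singleton]
        constructor
        · exact fun h => h.2
        · rintro rfl
          exact ⟨hi, rfl⟩
      have hZc' : ({y | typ y ∈ K}ᶜ : Set Y) = typ ⁻¹' {i} := by
        ext y
        rw [hZc, hO, Finset.mem_singleton]
        rfl
      have h1 : restrictHomeo h (A := {y | typ y ∈ K}ᶜ) (fun y => not_congr (hinv y)) =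
          Homeomorph.refl _ := by
        ext y
        have hy : typ y = i := by
          have := (hZc y).mp y.2
          rwa [hO, Finset.mem_singleton] at this
        exact hfix y (by rw [hy, hτi])
      rw [h1, ((hS.cell i hi).congr (Homeomorph.setCongr hZc'.symm)).lefschetz]
      have h2 : J.filter (fun j => τ j = j) = insert i (K.filter fun j => τ j = j) := by
        ext j
        simp only [K, Finset.mem_filter, Finset.mem_insert, hcyc]
        constructor
        · rintro ⟨h3, h4⟩
          by_cases h5 : j = i
          · exact Or.inl h5
          · exact Or.inr ⟨⟨h3, h5⟩, h4⟩
        · rintro (rfl | h3)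
          · exact ⟨hi, hτi⟩
          · exact ⟨h3.1.1, h3.2⟩
      rw [h2, Finset.sum_insert (by simp [K, hcyc]), add_comm]
    · have hne : ∀ j, τ.SameCycle i j → τ j ≠ j := by
        intro j hij hj
        have : j = i := by
          obtain ⟨k, hk⟩ := hij.symm
          rw [← hk]
          exact (Function.IsFixedPt.perm_zpow (e := τ) hj k).symm
        exact hτi (this ▸ hj)
      have hclosed : ∀ L ⊆ O, IsClosed {y : ({y | typ y ∈ K}ᶜ : Set Y) | typ y ∈ L} :=
        fun L hL => hSU.isClosed hL fun j hj k hk hkj => by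
          rw [hOrk j (hL hj), hOrk k hk] at hkj
          exact absurd hkj (lt_irrefl _)
      have hzero : lefschetzNumber (restrictHomeo h (A := {y | typ y ∈ K}ᶜ)
          fun y => not_congr (hinv y)) = 0 := by
        refine lefschetzNumber_eq_zero_of_moves O
          (fun j => {y : ({y | typ y ∈ K}ᶜ : Set Y) | typ y = j}) (fun j hj => ⟨?_, ?_⟩)
          (fun j _ k _ hjk => ?_) (fun y => ⟨typ y, (hZc y).mp y.2, rfl⟩) hfU _
          fun j hj y hy hy' => ?_
        · simpa using hclosed {j} (by simpa using hj)
        · rw [← isClosed_compl_iff]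
          convert hclosed (O.erase j) (Finset.erase_subset _ _) using 1
          ext y
          have := (hZc y).mp y.2
          simp [this]
        · exact Set.disjoint_left.mpr fun y hy hy' => hjk (hy.symm.trans hy')
        · have h1 : typ (h y) = j := hy'
          have h2 : typ y = j := hy
          rw [hτ, h2] at h1
          exact hne j (Finset.mem_filter.mp hj).2 h1
      rw [hzero, add_zero]
      refine Finset.sum_congr ?_ fun _ _ => rfl
      ext j
      simp only [K, Finset.mem_filter]
      constructor
      · exact fun h3 => ⟨h3.1.1, h3.2⟩
      · exact fun h3 => ⟨⟨h3.1, fun h4 => hne j h4 h3.2⟩, h3.2⟩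

end Strata

end CompactSupportCohomology

/-! ### Equivariant parametrizations of the cells of a CW complex -/

namespace EquivariantCW

open Topology

universe u v

variable {X : Type u} {D : ℕ}

/-- The points of the coordinate cube `[0, 1]^D` with vanishing coordinates from the index `d` on.
-/
def ClosedBox (d : ℕ) (y : Fin D → ℝ) : Prop :=
  ∀ a : Fin D, (a < d → 0 ≤ y a ∧ y a ≤ 1) ∧ (d ≤ a → y a = 0)

/-- The points of the cube with the first `d` coordinates in the open interval `(0, 1)` and the
other ones equal to `0`. -/
def OpenBox (d : ℕ) (y : Fin D → ℝ) : Prop :=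
  ∀ a : Fin D, (a < d → 0 < y a ∧ y a < 1) ∧ (d ≤ a → y a = 0)

theorem OpenBox.closedBox {d : ℕ} {y : Fin D → ℝ} (h : OpenBox d y) : ClosedBox d y :=
  fun a => ⟨fun ha => ⟨((h a).1 ha).1.le, ((h a).1 ha).2.le⟩, (h a).2⟩

/-- A finite cell structure on `X` in which all cells are parametrized by cubes, padded by zeros to
a common ambient cube `[0, 1]^D`, in a way compatible with the action of `G`. -/
structure CubicalCells (G : Type v) [Group G] (X : Type u) [TopologicalSpace X]
    [MulAction G X] where
  /-- The set of cells. -/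
  C : Type u
  /-- There are finitely many cells. -/
  fintype : Fintype C
  /-- The action on the set of cells. -/
  action : MulAction G C
  /-- An upper bound for the dimensions. -/
  D : ℕ
  /-- The dimension of a cell. -/
  dim : C → ℕ
  dim_le : ∀ c, dim c ≤ D
  dim_smul : ∀ (g : G) (c : C), dim (g • c) = dim c
  /-- The characteristic maps. -/
  χ : C → (Fin D → ℝ) → X
  continuous_χ : ∀ c, Continuous (χ c)
  smul_χ : ∀ (g : G) (c : C) (y : Fin D → ℝ), χ (g • c) y = g • χ c y
  exists_eq : ∀ x, ∃ c y, OpenBox (dim c) y ∧ χ c y = x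
  eq_of_eq : ∀ {c c' y y'}, OpenBox (dim c) y → OpenBox (dim c') y' → χ c y = χ c' y' →
    c = c' ∧ y = y'
  frontier : ∀ {c y}, ClosedBox (dim c) y → ¬ OpenBox (dim c) y →
    ∃ c' y', OpenBox (dim c') y' ∧ χ c' y' = χ c y ∧ dim c' < dim c

section Construction

variable [TopologicalSpace X] [CWComplex (Set.univ : Set X)]

variable (X) in
/-- The cells of all dimensions. -/
abbrev Cell : Type u := Σ n, RelCWComplex.cell (Set.univ : Set X) n

/-- The open cell as a subset. -/
abbrev Cell.openCell (c : Cell X) : Set X := RelCWComplex.openCell c.1 c.2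

theorem Cell.eq_of_mem {c c' : Cell X} {x : X} (h : x ∈ c.openCell) (h' : x ∈ c'.openCell) :
    c = c' := by
  by_contra hne
  exact Set.disjoint_left.mp (RelCWComplex.disjoint_openCell_of_ne hne) h h'

theorem Cell.exists_mem (x : X) : ∃ c : Cell X, x ∈ c.openCell := by
  have h : x ∈ ⋃ (n : ℕ) (j : RelCWComplex.cell (Set.univ : Set X) n),
      RelCWComplex.openCell n j := by
    rw [CWComplex.iUnion_openCell_eq_complex]
    trivial
  simp only [Set.mem_iUnion] at h
  obtain ⟨n, j, h⟩ := h
  exact ⟨⟨n, j⟩, h⟩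

theorem Cell.nonempty (c : Cell X) : c.openCell.Nonempty := RelCWComplex.openCell_nonempty _ _

/-- The affine reparametrization from `[0, 1]` to `[-1, 1]`, precomposed with the retraction of `ℝ`
onto `[0, 1]`. -/
def clamp (t : ℝ) : ℝ := 2 * max 0 (min 1 t) - 1

theorem continuous_clamp : Continuous clamp := by
  unfold clamp
  fun_prop

theorem clamp_of_mem {t : ℝ} (h0 : 0 ≤ t) (h1 : t ≤ 1) : clamp t = 2 * t - 1 := by
  rw [clamp, min_eq_right h1, max_eq_right h0]

theorem abs_clamp_le (t : ℝ) : |clamp t| ≤ 1 := by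
  have h1 : 0 ≤ max 0 (min 1 t) := le_max_left _ _
  have h2 : max 0 (min 1 t) ≤ 1 := max_le zero_le_one (min_le_left _ _)
  rw [clamp, abs_le]
  constructor <;> linarith

/-- The coordinates in the cube `[-1, 1]^n` of a point of `[0, 1]^D`. -/
def boxCoord {n : ℕ} (hn : n ≤ D) (y : Fin D → ℝ) : Fin n → ℝ :=
  fun a => clamp (y (Fin.castLE hn a))

theorem continuous_boxCoord {n : ℕ} (hn : n ≤ D) : Continuous (boxCoord (D := D) hn) :=
  continuous_pi fun _ => continuous_clamp.comp (continuous_apply _)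

theorem boxCoord_mem_closedBall {n : ℕ} (hn : n ≤ D) (y : Fin D → ℝ) :
    boxCoord hn y ∈ Metric.closedBall (0 : Fin n → ℝ) 1 := by
  rw [mem_closedBall_zero_iff, pi_norm_le_iff_of_nonneg zero_le_one]
  exact fun a => abs_clamp_le _

theorem boxCoord_mem_ball_iff {n : ℕ} (hn : n ≤ D) {y : Fin D → ℝ} (hy : ClosedBox n y) :
    boxCoord hn y ∈ Metric.ball (0 : Fin n → ℝ) 1 ↔ OpenBox n y := by
  rw [mem_ball_zero_iff, pi_norm_lt_iff zero_lt_one]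
  constructor
  · intro h a
    refine ⟨fun ha => ?_, (hy a).2⟩
    have h1 := h ⟨a, ha⟩
    have h2 := (hy a).1 ha
    have h3 : boxCoord hn y ⟨a, ha⟩ = 2 * y a - 1 := clamp_of_mem h2.1 h2.2
    rw [h3, Real.norm_eq_abs, abs_lt] at h1
    constructor <;> linarith
  · intro h a
    have h1 := (h (Fin.castLE hn a)).1 a.2
    have h3 : boxCoord hn y a = 2 * y (Fin.castLE hn a) - 1 := clamp_of_mem h1.1.le h1.2.le
    rw [h3, Real.norm_eq_abs, abs_lt]
    constructor <;> linarith

theorem exists_boxCoord_eq {n : ℕ} (hn : n ≤ D) {b : Fin n → ℝ}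
    (hb : b ∈ Metric.ball (0 : Fin n → ℝ) 1) :
    ∃ y : Fin D → ℝ, OpenBox n y ∧ boxCoord hn y = b := by
  rw [mem_ball_zero_iff, pi_norm_lt_iff zero_lt_one] at hb
  have hb' : ∀ a, -1 < b a ∧ b a < 1 := fun a => abs_lt.mp (hb a)
  refine ⟨fun a => if h : (a : ℕ) < n then (b ⟨a, h⟩ + 1) / 2 else 0, fun a => ⟨fun h => ?_,
    fun h => dif_neg (not_lt.mpr h)⟩, funext fun a => ?_⟩
  · simp only [dif_pos h]
    have := hb' ⟨a, h⟩
    constructor <;> linarith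
  · have h := hb' a
    have e : boxCoord hn (fun a : Fin D => if h : (a : ℕ) < n then (b ⟨a, h⟩ + 1) / 2 else 0) a =
        clamp ((b a + 1) / 2) := by
      unfold boxCoord
      congr 1
      exact dif_pos a.2
    rw [e, clamp_of_mem (by linarith) (by linarith)]
    ring

theorem boxCoord_injOn {n : ℕ} (hn : n ≤ D) {y y' : Fin D → ℝ} (hy : OpenBox n y)
    (hy' : OpenBox n y') (h : boxCoord hn y = boxCoord hn y') : y = y' := by
  funext a
  by_cases ha : (a : ℕ) < n
  · have h1 := (hy a).1 ha
    have h2 := (hy' a).1 ha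
    have h3 : clamp (y a) = clamp (y' a) := congrFun h ⟨a, ha⟩
    rw [clamp_of_mem h1.1.le h1.2.le, clamp_of_mem h2.1.le h2.2.le] at h3
    linarith
  · rw [(hy a).2 (not_lt.mp ha), (hy' a).2 (not_lt.mp ha)]

/-- The characteristic map of a cell, on the ambient cube. -/
def Cell.charMap (c : Cell X) (hD : c.1 ≤ D) (y : Fin D → ℝ) : X :=
  RelCWComplex.map c.1 c.2 (boxCoord hD y)

theorem Cell.continuous_charMap (c : Cell X) (hD : c.1 ≤ D) : Continuous (c.charMap hD) :=
  (RelCWComplex.continuousOn c.1 c.2).comp_continuous (continuous_boxCoord hD)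
    fun _ => boxCoord_mem_closedBall hD _

theorem Cell.charMap_mem_openCell (c : Cell X) (hD : c.1 ≤ D) {y : Fin D → ℝ}
    (hy : OpenBox c.1 y) : c.charMap hD y ∈ c.openCell :=
  ⟨_, (boxCoord_mem_ball_iff hD hy.closedBox).mpr hy, rfl⟩

theorem Cell.exists_charMap_eq (c : Cell X) (hD : c.1 ≤ D) {x : X} (hx : x ∈ c.openCell) :
    ∃ y, OpenBox c.1 y ∧ c.charMap hD y = x := by
  obtain ⟨b, hb, rfl⟩ := hx
  obtain ⟨y, hy, rfl⟩ := exists_boxCoord_eq hD hb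
  exact ⟨y, hy, rfl⟩

theorem Cell.charMap_injOn (c : Cell X) (hD : c.1 ≤ D) {y y' : Fin D → ℝ} (hy : OpenBox c.1 y)
    (hy' : OpenBox c.1 y') (h : c.charMap hD y = c.charMap hD y') : y = y' := by
  refine boxCoord_injOn hD hy hy' ((RelCWComplex.map c.1 c.2).injOn ?_ ?_ h) <;>
  · rw [RelCWComplex.source_eq, boxCoord_mem_ball_iff _ (OpenBox.closedBox ‹_›)]
    assumption

theorem Cell.exists_of_frontier (c : Cell X) (hD : c.1 ≤ D) {y : Fin D → ℝ}
    (hy : ClosedBox c.1 y) (hy' : ¬ OpenBox c.1 y) :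
    ∃ c' : Cell X, c'.1 < c.1 ∧ c.charMap hD y ∈ c'.openCell := by
  have h : c.charMap hD y ∈ RelCWComplex.cellFrontier c.1 c.2 := by
    refine ⟨_, ?_, rfl⟩
    rw [← Metric.closedBall_sdiff_ball]
    exact ⟨boxCoord_mem_closedBall hD y, fun h => hy' ((boxCoord_mem_ball_iff hD hy).mp h)⟩
  obtain ⟨I, hI⟩ := CWComplex.cellFrontier_subset_finite_openCell c.1 c.2
  obtain ⟨m, hm⟩ := Set.mem_iUnion.mp (hI h)
  simp only [Set.mem_iUnion] at hm
  obtain ⟨hmn, j, -, hj⟩ := hm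
  exact ⟨⟨m, j⟩, hmn, hj⟩

variable {G : Type v} [Group G] [MulAction G X]

section Action

variable (hX : IsCellularAction G X)

/-- The action of `G` on the set of cells. -/
def cellSMul (g : G) (c : Cell X) : Cell X := ⟨c.1, (hX g c.1 c.2).1.choose⟩

theorem image_openCell (g : G) (c : Cell X) :
    (fun x : X => g • x) '' c.openCell = (cellSMul hX g c).openCell :=
  (hX g c.1 c.2).1.choose_spec

theorem smul_mem_openCell (g : G) {c : Cell X} {x : X} (hx : x ∈ c.openCell) :
    g • x ∈ (cellSMul hX g c).openCell := by
  rw [← image_openCell hX]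
  exact ⟨x, hx, rfl⟩

/-- The action of `G` on the set of cells. -/
abbrev cellAction : MulAction G (Cell X) where
  smul := cellSMul hX
  one_smul c := by
    obtain ⟨x, hx⟩ := c.nonempty
    exact Cell.eq_of_mem (smul_mem_openCell hX 1 hx) (by rwa [one_smul])
  mul_smul g g' c := by
    obtain ⟨x, hx⟩ := c.nonempty
    refine Cell.eq_of_mem (smul_mem_openCell hX (g * g') hx) ?_
    rw [mul_smul]
    exact smul_mem_openCell hX g (smul_mem_openCell hX g' hx)

/-- An element that maps a cell to itself fixes the open cell, hence by continuity the closed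
cell. -/
theorem smul_charMap_of_fixed [T2Space X] [ContinuousConstSMul G X] {g : G} {c : Cell X}
    (h : cellSMul hX g c = c) (hD : c.1 ≤ D) (y : Fin D → ℝ) :
    g • c.charMap hD y = c.charMap hD y := by
  have hclosed : IsClosed {x : X | g • x = x} :=
    isClosed_eq (continuous_const_smul g) continuous_id
  have hsub : c.openCell ⊆ {x : X | g • x = x} := (hX g c.1 c.2).2 (by
    have := image_openCell hX g c
    rwa [h] at this)
  have := closure_minimal hsub hclosed
  rw [RelCWComplex.closure_openCell_eq_closedCell] at this
  exact this ⟨_, boxCoord_mem_closedBall hD y, rfl⟩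

/-- Finite CW complexes with a cellular action admit compatible parametrizations of the cells:
choose characteristic maps for representatives of the orbits of cells and transport them. -/
theorem exists_cubicalCells [T2Space X] [ContinuousConstSMul G X] (hX : IsCellularAction G X)
    [CWComplex.Finite (Set.univ : Set X)] :
    Nonempty (CubicalCells G X) := by
  have hfin : Finite (Cell X) := RelCWComplex.finite_cells_of_finite
  let _ : Fintype (Cell X) := Fintype.ofFinite _
  let act : MulAction G (Cell X) := cellAction hX
  let D := Finset.univ.sup fun c : Cell X => c.1
  have hD : ∀ c : Cell X, c.1 ≤ D := fun c =>
    Finset.le_sup (f := fun c : Cell X => c.1) (Finset.mem_univ c)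
  let rep : Cell X → Cell X := fun c => (Quotient.mk (MulAction.orbitRel G (Cell X)) c).out
  have hrep : ∀ c, ∃ g : G, g • rep c = c := fun c =>
    (Quotient.exact (Quotient.out_eq (Quotient.mk (MulAction.orbitRel G (Cell X)) c)).symm)
  choose γ hγ using hrep
  have hdim : ∀ (g : G) (c : Cell X), (g • c).1 = c.1 := fun g c => rfl
  have hdr : ∀ c, (rep c).1 = c.1 := fun c => by
    conv_rhs => rw [← hγ c]
    exact (hdim _ _).symm
  have hrg : ∀ (g : G) (c : Cell X), rep (g • c) = rep c := fun g c =>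
    congrArg Quotient.out (Quotient.sound (s := MulAction.orbitRel G (Cell X)) ⟨g, rfl⟩)
  let χ : Cell X → (Fin D → ℝ) → X := fun c y => γ c • (rep c).charMap (hD _) y
  have hopen : ∀ {c : Cell X} {y : Fin D → ℝ}, OpenBox c.1 y → χ c y ∈ c.openCell := by
    intro c y hy
    have h1 := smul_mem_openCell hX (γ c) ((rep c).charMap_mem_openCell (hD _) (by rwa [hdr]))
    have h2 : cellSMul hX (γ c) (rep c) = c := hγ c
    rwa [h2] at h1
  have hex : ∀ {c : Cell X} {x : X}, x ∈ c.openCell → ∃ y, OpenBox c.1 y ∧ χ c y = x := by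
    intro c x hx
    have h1 : (γ c)⁻¹ • x ∈ (rep c).openCell := by
      have h2 := smul_mem_openCell hX (γ c)⁻¹ hx
      have h3 : cellSMul hX (γ c)⁻¹ c = rep c := inv_smul_eq_iff.mpr (hγ c).symm
      rwa [h3] at h2
    obtain ⟨y, hy, h⟩ := (rep c).exists_charMap_eq (hD _) h1
    exact ⟨y, by rwa [← hdr], by simp only [χ, h, smul_inv_smul]⟩
  refine ⟨⟨Cell X, inferInstance, act, D, fun c => c.1, hD, hdim, χ, fun c =>
    (Cell.continuous_charMap _ _).const_smul _, fun g c y => ?_, fun x => ?_, ?_, ?_⟩⟩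
  · -- the two transports differ by an element of the stabilizer, which fixes the closed cell
    have h1 : ∀ r : Cell X, r = rep c → γ (g • c) • r.charMap (hD _) y =
        g • γ c • r.charMap (hD _) y := by
      rintro r rfl
      have h2 : ((γ (g • c))⁻¹ * (g * γ c)) • rep c = rep c := by
        have := hγ (g • c)
        rw [hrg] at this
        rw [mul_smul, mul_smul, hγ c, inv_smul_eq_iff, this]
      have h3 := smul_charMap_of_fixed hX h2 (hD _) y
      rw [mul_smul, inv_smul_eq_iff, mul_smul] at h3
      exact h3.symm
    change γ (g • c) • (rep (g • c)).charMap (hD _) y = g • γ c • (rep c).charMap (hD _) y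
    rw [h1 _ (hrg g c)]
    congr 3
    exact hrg g c
  · obtain ⟨c, hc⟩ := Cell.exists_mem x
    obtain ⟨y, hy⟩ := hex hc
    exact ⟨c, y, hy⟩
  · intro c c' y y' hy hy' h
    obtain rfl : c = c' := Cell.eq_of_mem (hopen hy) (h ▸ hopen hy')
    exact ⟨rfl, (rep c).charMap_injOn (hD _) (by rwa [hdr]) (by rwa [hdr])
      (MulAction.injective _ h)⟩
  · intro c y hy hy'
    obtain ⟨c', hc', hm⟩ := (rep c).exists_of_frontier (hD _) (by rwa [hdr]) (by rwa [hdr])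
    obtain ⟨y', hy', h⟩ := hex (smul_mem_openCell hX (γ c) hm)
    exact ⟨_, y', hy', h, by rw [← hdr c]; exact hc'⟩

end Action

end Construction

end EquivariantCW

/-! ### Order types of finite families -/

namespace OrderType

variable {A W : Type*} [Fintype A] [LinearOrder W]

/-- The values of a family `y`, together with a base point `b`. -/
def values (b : W) (y : A → W) : Finset W := insert b (Finset.univ.image y)

/-- The rank of the value `y a` among all values of the family, where the base point `b` (a lower
bound of the family) has rank `0`. The function `rankOf b y` is the order type of the family. -/
def rankOf (b : W) (y : A → W) (a : A) : ℕ := {w ∈ values b y | w < y a}.card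

/-- The largest rank. -/
def depth (r : A → ℕ) : ℕ := Finset.univ.sup r

/-- The functions that arise as order types: the positive values form an interval `1, …, m`. -/
def IsRank (r : A → ℕ) : Prop := ∀ k, 0 < k → k ≤ depth r → ∃ a, r a = k

theorem le_depth (r : A → ℕ) (a : A) : r a ≤ depth r := Finset.le_sup (Finset.mem_univ a)

theorem values_comp {b : W} {r : A → ℕ} (hr : IsRank r) {s : ℕ → W} (hs : s 0 = b) :
    values b (s ∘ r) = (Finset.range (depth r + 1)).image s := by
  ext w
  simp only [values, Finset.mem_insert, Finset.mem_image, Finset.mem_univ, true_and,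
    Finset.mem_range, Function.comp_apply]
  constructor
  · rintro (rfl | ⟨a, rfl⟩)
    · exact ⟨0, by omega, hs⟩
    · exact ⟨r a, Nat.lt_succ_of_le (le_depth r a), rfl⟩
  · rintro ⟨k, hk, rfl⟩
    rcases Nat.eq_zero_or_pos k with rfl | hk0
    · exact Or.inl hs
    · obtain ⟨a, rfl⟩ := hr k hk0 (by omega)
      exact Or.inr ⟨a, rfl⟩

/-- A strictly increasing choice of levels has the prescribed order type. -/
theorem rankOf_comp {b : W} {r : A → ℕ} (hr : IsRank r) {s : ℕ → W} (hs : s 0 = b)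
    (hmono : StrictMonoOn s (Set.Iic (depth r))) : rankOf b (s ∘ r) = r := by
  funext a
  have ha := le_depth r a
  have h : {w ∈ values b (s ∘ r) | w < (s ∘ r) a} = (Finset.range (r a)).image s := by
    rw [values_comp hr hs]
    ext w
    simp only [Finset.mem_filter, Finset.mem_image, Finset.mem_range, Function.comp_apply]
    constructor
    · rintro ⟨⟨k, hk, rfl⟩, hlt⟩
      exact ⟨k, (hmono.lt_iff_lt (Nat.le_of_lt_succ hk) ha).mp hlt, rfl⟩
    · rintro ⟨k, hk, rfl⟩
      exact ⟨⟨k, by omega, rfl⟩, hmono (show k ≤ depth r by omega) ha hk⟩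
  rw [rankOf, h, Finset.card_image_of_injOn, Finset.card_range]
  refine hmono.injOn.mono fun k hk => ?_
  rw [Finset.coe_range, Set.mem_Iio] at hk
  exact show k ≤ depth r by omega

/-- A family is a strictly increasing function of its order type. -/
theorem exists_strictMonoOn {b : W} {y : A → W} (hb : ∀ a, b ≤ y a) :
    ∃ s : ℕ → W, s 0 = b ∧ StrictMonoOn s (Set.Iic (depth (rankOf b y))) ∧
      y = s ∘ rankOf b y ∧ IsRank (rankOf b y) := by
  have hne : (values b y).Nonempty := ⟨b, Finset.mem_insert_self _ _⟩
  obtain ⟨m, hm⟩ : ∃ m, (values b y).card = m + 1 := ⟨_, (Nat.succ_pred hne.card_ne_zero).symm⟩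
  let o := (values b y).orderEmbOfFin hm
  let s : ℕ → W := fun k => if h : k < m + 1 then o ⟨k, h⟩ else b
  have hsk : ∀ k (h : k < m + 1), s k = o ⟨k, h⟩ := fun k h => dif_pos h
  have hmono : StrictMonoOn s (Set.Iic m) := by
    intro k hk l hl hkl
    rw [Set.mem_Iic] at hk hl
    rw [hsk k (by omega), hsk l (by omega)]
    exact o.strictMono (by simpa using hkl)
  have hrange : ∀ w ∈ values b y, ∃ k, k ≤ m ∧ s k = w := by
    intro w hw
    have : w ∈ Set.range o := by rw [Finset.range_orderEmbOfFin]; exact hw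
    obtain ⟨⟨k, hk⟩, rfl⟩ := this
    exact ⟨k, by omega, hsk k hk⟩
  have hmem : ∀ k, k ≤ m → s k ∈ values b y := fun k hk => by
    rw [hsk k (by omega)]
    exact Finset.orderEmbOfFin_mem _ _ _
  have hle : ∀ w ∈ values b y, b ≤ w := by
    intro w hw
    rcases Finset.mem_insert.mp hw with rfl | hw
    · exact le_rfl
    · obtain ⟨a, -, rfl⟩ := Finset.mem_image.mp hw
      exact hb a
  have hs0 : s 0 = b := by
    obtain ⟨k, hk, hkb⟩ := hrange b (Finset.mem_insert_self _ _)
    refine le_antisymm ?_ (hle _ (hmem 0 (by omega)))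
    rw [← hkb]
    exact hmono.monotoneOn (Nat.zero_le m) hk (Nat.zero_le k)
  have hy : ∀ a, ∃ k, k ≤ m ∧ s k = y a := fun a =>
    hrange _ (Finset.mem_insert_of_mem (Finset.mem_image_of_mem _ (Finset.mem_univ a)))
  choose r hrm hr using hy
  have hsurj : ∀ k, 0 < k → k ≤ m → ∃ a, r a = k := by
    intro k hk0 hkm
    rcases Finset.mem_insert.mp (hmem k hkm) with h | h
    · rw [← hs0] at h
      exact absurd (hmono.injOn hkm (Nat.zero_le m) h) hk0.ne'
    · obtain ⟨a, -, ha⟩ := Finset.mem_image.mp h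
      exact ⟨a, hmono.injOn (hrm a) hkm ((hr a).trans ha)⟩
  have hdm : depth r ≤ m := Finset.sup_le fun a _ => hrm a
  have hrank : IsRank r := fun k hk0 hk => hsurj k hk0 (hk.trans hdm)
  have hyr : y = s ∘ r := funext fun a => (hr a).symm
  have hmono' : StrictMonoOn s (Set.Iic (depth r)) := hmono.mono (Set.Iic_subset_Iic.mpr hdm)
  have e : rankOf b y = r := by
    conv_lhs => rw [hyr]
    exact rankOf_comp hrank hs0 hmono'
  rw [e]
  exact ⟨s, hs0, hmono', hyr, hrank⟩

theorem isRank_rankOf {b : W} {y : A → W} (hb : ∀ a, b ≤ y a) : IsRank (rankOf b y) :=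
  (exists_strictMonoOn hb).choose_spec.2.2.2

theorem rankOf_eq_iff {b : W} {y : A → W} (hb : ∀ a, b ≤ y a) (a a' : A) :
    rankOf b y a = rankOf b y a' ↔ y a = y a' := by
  obtain ⟨s, -, hs, hy, -⟩ := exists_strictMonoOn hb
  constructor
  · intro h
    rw [hy, Function.comp_apply, Function.comp_apply, h]
  · intro h
    rw [hy] at h
    exact hs.injOn (le_depth _ _) (le_depth _ _) h

theorem rankOf_eq_zero_iff {b : W} {y : A → W} (hb : ∀ a, b ≤ y a) (a : A) :
    rankOf b y a = 0 ↔ y a = b := by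
  obtain ⟨s, hs0, hs, hy, -⟩ := exists_strictMonoOn hb
  constructor
  · intro h
    rw [hy, Function.comp_apply, h, hs0]
  · intro h
    have h' : s (rankOf b y a) = s 0 := (congrFun hy a).symm.trans (h.trans hs0.symm)
    exact hs.injOn (le_depth _ _) (Nat.zero_le _) h'

theorem depth_rankOf {b : W} {y : A → W} (hb : ∀ a, b ≤ y a) :
    depth (rankOf b y) + 1 = (values b y).card := by
  obtain ⟨s, hs0, hs, hy, hr⟩ := exists_strictMonoOn hb
  have h : values b y = (Finset.range (depth (rankOf b y) + 1)).image s := by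
    conv_lhs => rw [hy]
    exact values_comp hr hs0
  rw [h, Finset.card_image_of_injOn, Finset.card_range]
  refine hs.injOn.mono fun k hk => ?_
  rw [Finset.coe_range, Set.mem_Iio] at hk
  exact Nat.le_of_lt_succ hk

/-- A coincidence among the levels lowers the depth. -/
theorem depth_rankOf_comp_lt {b : W} {r : A → ℕ} (hr : IsRank r) {s : ℕ → W} (hs : s 0 = b)
    (hb : ∀ a, b ≤ s (r a)) {k : ℕ} (hk : k < depth r) (heq : s k = s (k + 1)) :
    depth (rankOf b (s ∘ r)) < depth r := by
  have h := depth_rankOf (b := b) (y := s ∘ r) hb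
  rw [values_comp hr hs] at h
  have h1 : (Finset.range (depth r + 1)).image s ⊆
      ((Finset.range (depth r + 1)).erase k).image s := by
    intro w hw
    obtain ⟨l, hl, rfl⟩ := Finset.mem_image.mp hw
    by_cases hlk : l = k
    · rw [hlk, heq]
      exact Finset.mem_image_of_mem _ (Finset.mem_erase.mpr ⟨by omega, Finset.mem_range.mpr
        (by omega)⟩)
    · exact Finset.mem_image_of_mem _ (Finset.mem_erase.mpr ⟨hlk, hl⟩)
  have h2 := (Finset.card_le_card h1).trans Finset.card_image_le
  rw [Finset.card_erase_of_mem (Finset.mem_range.mpr (by omega)), Finset.card_range] at h2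
  omega

theorem rankOf_comp_equiv (b : W) (y : A → W) (π : Equiv.Perm A) :
    rankOf b (y ∘ π) = rankOf b y ∘ π := by
  have h : values b (y ∘ π) = values b y := by
    unfold values
    congr 1
    ext w
    simp only [Finset.mem_image, Finset.mem_univ, true_and, Function.comp_apply]
    exact ⟨fun ⟨a, ha⟩ => ⟨π a, ha⟩, fun ⟨a, ha⟩ => ⟨π.symm a, by simpa using ha⟩⟩
  funext a
  simp only [rankOf, h, Function.comp_apply]

/-- The number of families with values in `{0, …, N}` of a given order type. -/
theorem card_rankOf_eq (N : ℕ) {r : A → ℕ} (hr : IsRank r) :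
    Nat.card {y : A → Fin (N + 1) // rankOf 0 (fun a => (y a : ℕ)) = r} = N.choose (depth r) := by
  classical
  have h0 : ∀ (y : A → Fin (N + 1)) (a : A), 0 ≤ (y a : ℕ) := fun _ _ => Nat.zero_le _
  have hcard : ((Finset.Ioc 0 N).powersetCard (depth r)).card = N.choose (depth r) := by
    rw [Finset.card_powersetCard, Nat.card_Ioc, Nat.sub_zero]
  rw [← hcard, Nat.card_eq_fintype_card, Fintype.card_subtype]
  refine Finset.card_bij (fun y _ => (values 0 fun a => (y a : ℕ)).erase 0) ?_ ?_ ?_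
  · intro y hy
    rw [Finset.mem_filter] at hy
    refine Finset.mem_powersetCard.mpr ⟨fun w hw => ?_, ?_⟩
    · obtain ⟨hw0, hw⟩ := Finset.mem_erase.mp hw
      rcases Finset.mem_insert.mp hw with h | h
      · exact absurd h hw0
      · obtain ⟨a, -, rfl⟩ := Finset.mem_image.mp h
        exact Finset.mem_Ioc.mpr ⟨Nat.pos_of_ne_zero hw0, Nat.lt_succ_iff.mp (y a).2⟩
    · have := depth_rankOf (h0 y)
      rw [hy.2] at this
      have hmem : (0 : ℕ) ∈ values 0 fun a => (y a : ℕ) := Finset.mem_insert_self _ _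
      rw [Finset.card_erase_of_mem hmem]
      omega
  · intro y hy y' hy' h
    rw [Finset.mem_filter] at hy hy'
    have hmem0 : ∀ y : A → Fin (N + 1), (0 : ℕ) ∈ values 0 fun a => (y a : ℕ) :=
      fun _ => Finset.mem_insert_self _ _
    have hv : (values 0 fun a => (y a : ℕ)) = values 0 fun a => (y' a : ℕ) :=
      (Finset.insert_erase (hmem0 y)).symm.trans
        ((congrArg (insert 0) h).trans (Finset.insert_erase (hmem0 y')))
    have hmem : ∀ (y : A → Fin (N + 1)) (a : A), (y a : ℕ) ∈ values 0 fun a => (y a : ℕ) :=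
      fun y a => Finset.mem_insert_of_mem (Finset.mem_image_of_mem _ (Finset.mem_univ a))
    funext a
    have h1 := congrFun (hy.2.trans hy'.2.symm) a
    unfold rankOf at h1
    rw [← hv] at h1
    apply Fin.ext
    rcases lt_trichotomy (y a : ℕ) (y' a) with hlt | heq | hlt
    · refine absurd h1 (Finset.card_lt_card ⟨fun w hw => ?_, fun hsub => ?_⟩).ne
      · rw [Finset.mem_filter] at hw ⊢
        exact ⟨hw.1, hw.2.trans hlt⟩
      · exact lt_irrefl _ (Finset.mem_filter.mp (hsub (Finset.mem_filter.mpr ⟨hmem y a, hlt⟩))).2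
    · exact heq
    · refine absurd h1.symm (Finset.card_lt_card ⟨fun w hw => ?_, fun hsub => ?_⟩).ne
      · rw [Finset.mem_filter] at hw ⊢
        exact ⟨hw.1, hw.2.trans hlt⟩
      · exact lt_irrefl _ (Finset.mem_filter.mp (hsub (Finset.mem_filter.mpr
          ⟨hv ▸ hmem y' a, hlt⟩))).2
  · intro S hS
    obtain ⟨hSN, hSc⟩ := Finset.mem_powersetCard.mp hS
    have h0S : 0 ∉ S := fun h => absurd (Finset.mem_Ioc.mp (hSN h)).1 (lt_irrefl 0)
    have hm : (insert 0 S).card = depth r + 1 := by rw [Finset.card_insert_of_notMem h0S, hSc]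
    let o := (insert 0 S).orderEmbOfFin hm
    let s : ℕ → ℕ := fun k => if h : k < depth r + 1 then o ⟨k, h⟩ else 0
    have hsk : ∀ k (h : k < depth r + 1), s k = o ⟨k, h⟩ := fun k h => dif_pos h
    have hmono : StrictMonoOn s (Set.Iic (depth r)) := by
      intro k hk l hl hkl
      rw [Set.mem_Iic] at hk hl
      rw [hsk k (by omega), hsk l (by omega)]
      exact o.strictMono (by simpa using hkl)
    have himg : (Finset.range (depth r + 1)).image s = insert 0 S := by
      ext w
      rw [Finset.mem_image]
      constructor
      · rintro ⟨k, hk, rfl⟩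
        rw [hsk k (Finset.mem_range.mp hk)]
        exact Finset.orderEmbOfFin_mem _ _ _
      · intro hw
        have : w ∈ Set.range o := by rw [Finset.range_orderEmbOfFin]; exact hw
        obtain ⟨⟨k, hk⟩, rfl⟩ := this
        exact ⟨k, Finset.mem_range.mpr hk, hsk k hk⟩
    have hs0 : s 0 = 0 := by
      have : 0 ∈ (Finset.range (depth r + 1)).image s := himg ▸ Finset.mem_insert_self 0 S
      obtain ⟨k, hk, hk0⟩ := Finset.mem_image.mp this
      have := hmono.monotoneOn (Nat.zero_le _) (Nat.lt_succ_iff.mp (Finset.mem_range.mp hk))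
        (Nat.zero_le k)
      omega
    have hsN : ∀ a, s (r a) < N + 1 := by
      intro a
      have : s (r a) ∈ insert 0 S := himg ▸ Finset.mem_image_of_mem s
        (Finset.mem_range.mpr (Nat.lt_succ_of_le (le_depth r a)))
      rcases Finset.mem_insert.mp this with h | h
      · omega
      · have := (Finset.mem_Ioc.mp (hSN h)).2
        omega
    refine ⟨fun a => ⟨s (r a), hsN a⟩, Finset.mem_filter.mpr
      ⟨Finset.mem_univ _, rankOf_comp hr hs0 hmono⟩, ?_⟩
    have : (values 0 fun a => s (r a)) = insert 0 S := (values_comp hr hs0).trans himg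
    change (values 0 fun a => s (r a)).erase 0 = S
    rw [this, Finset.erase_insert h0S]

end OrderType

/-! ### Labels: configurations written in coordinates -/

/-- A configuration of `n` points in a cell complex with set of cells `C`, together with a point of
the simplex on `E`, written in coordinates with values in `W`: the cell of each of the `n` points,
its `D` coordinates in that cell, and one coordinate for each vertex in `E`. -/
@[ext] structure Label (n : ℕ) (C : Type*) (D : ℕ) (E : Type*) (W : Type*) where
  /-- The cells of the points. -/
  cell : Fin n → C
  /-- The coordinates. -/
  val : (Fin n × Fin D) ⊕ E → W

namespace Label

open OrderType

variable {n : ℕ} {C : Type*} {D : ℕ} {E : Type*} {W W' : Type*} {G : Type*} [Group G]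
  [MulAction G C] [MulAction G E]

/-- Apply a function to all coordinates. -/
def map (f : W → W') (s : Label n C D E W) : Label n C D E W' := ⟨s.cell, f ∘ s.val⟩

/-- The coordinates of the `i`-th point. -/
def u (s : Label n C D E W) (i : Fin n) (a : Fin D) : W := s.val (Sum.inl (i, a))

/-- The coordinates of the point of the simplex. -/
def l (s : Label n C D E W) (e : E) : W := s.val (Sum.inr e)

theorem ext_iff' {s t : Label n C D E W} :
    s = t ↔ (∀ i, s.cell i = t.cell i) ∧ (∀ i a, s.u i a = t.u i a) ∧ ∀ e, s.l e = t.l e := by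
  constructor
  · rintro rfl
    exact ⟨fun _ => rfl, fun _ _ => rfl, fun _ => rfl⟩
  · rintro ⟨h1, h2, h3⟩
    refine Label.ext (funext h1) (funext fun a => ?_)
    rcases a with ⟨i, a⟩ | e
    exacts [h2 i a, h3 e]

/-- The permutation of the coordinates induced by an element of `G`. -/
def coordG (g : G) : Equiv.Perm ((Fin n × Fin D) ⊕ E) :=
  Equiv.sumCongr (Equiv.refl _) (MulAction.toPerm g⁻¹)

/-- The permutation of the coordinates induced by a permutation of the points. -/
def coordS (σ : Equiv.Perm (Fin n)) : Equiv.Perm ((Fin n × Fin D) ⊕ E) :=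
  Equiv.sumCongr (Equiv.prodCongr σ⁻¹ (Equiv.refl _)) (Equiv.refl _)

instance : MulAction G (Label n C D E W) where
  smul g s := ⟨fun i => g • s.cell i, s.val ∘ coordG g⟩
  one_smul s := Label.ext (funext fun i => one_smul G (s.cell i)) (funext fun a => by
    rcases a with a | e
    · rfl
    · exact congrArg (fun e => s.val (Sum.inr e)) (by simp))
  mul_smul g g' s := Label.ext (funext fun i => mul_smul g g' (s.cell i)) (funext fun a => by
    rcases a with a | e
    · rfl
    · exact congrArg (fun e => s.val (Sum.inr e)) (by simp [mul_smul]))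

instance : MulAction (Equiv.Perm (Fin n)) (Label n C D E W) where
  smul σ s := ⟨fun i => s.cell (σ⁻¹ i), s.val ∘ coordS σ⟩
  one_smul s := Label.ext rfl (funext fun a => by rcases a with a | e <;> rfl)
  mul_smul σ τ s := Label.ext rfl (funext fun a => by rcases a with a | e <;> rfl)

theorem smul_cell (g : G) (s : Label n C D E W) (i : Fin n) : (g • s).cell i = g • s.cell i := rfl

theorem smul_l (g : G) (s : Label n C D E W) (e : E) : (g • s).l e = s.l (g⁻¹ • e) := rfl

theorem perm_smul_cell (σ : Equiv.Perm (Fin n)) (s : Label n C D E W) (i : Fin n) :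
    (σ • s).cell i = s.cell (σ⁻¹ i) := rfl

theorem smul_perm_smul (g : G) (σ : Equiv.Perm (Fin n)) (s : Label n C D E W) :
    g • σ • s = σ • g • s :=
  Label.ext rfl (funext fun a => by rcases a with a | e <;> rfl)

theorem map_smul (f : W → W') (g : G) (s : Label n C D E W) : (g • s).map f = g • s.map f := rfl

theorem map_perm_smul (f : W → W') (σ : Equiv.Perm (Fin n)) (s : Label n C D E W) :
    (σ • s).map f = σ • s.map f := rfl

section Model

variable (dim : C → ℕ) (b : W)

/-- The coordinates of a configuration of distinct points: the nontrivial coordinates of a point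
are those of index less than the dimension of its cell, the smallest coordinate in `E` is
trivial, and the points are distinct. The base point `b` stands for the trivial coordinate. -/
structure IsModel (s : Label n C D E W) : Prop where
  u_eq_iff : ∀ i a, s.u i a = b ↔ dim (s.cell i) ≤ a
  exists_l : ∃ e, s.l e = b
  injective : ∀ i j, s.cell i = s.cell j → s.u i = s.u j → i = j

variable {dim b}

theorem IsModel.smul {s : Label n C D E W} (h : IsModel dim b s)
    (hdim : ∀ (g : G) (c : C), dim (g • c) = dim c) (g : G) : IsModel dim b (g • s) where
  u_eq_iff i a := by
    rw [smul_cell, hdim]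
    exact h.u_eq_iff i a
  exists_l := by
    obtain ⟨e, he⟩ := h.exists_l
    exact ⟨g • e, by rw [smul_l, inv_smul_smul, he]⟩
  injective i j hc hu := h.injective i j (MulAction.injective g hc) hu

theorem IsModel.perm_smul {s : Label n C D E W} (h : IsModel dim b s) (σ : Equiv.Perm (Fin n)) :
    IsModel dim b (σ • s) where
  u_eq_iff i a := h.u_eq_iff (σ⁻¹ i) a
  exists_l := h.exists_l
  injective _ _ hc hu := (σ⁻¹).injective (h.injective _ _ hc hu)

end Model

section Rank

variable [Fintype E] [LinearOrder W] {b : W}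

/-- Replace the coordinates by their ranks. -/
def rank (b : W) (s : Label n C D E W) : Label n C D E ℕ := ⟨s.cell, rankOf b s.val⟩

theorem rank_smul (g : G) (s : Label n C D E W) : rank b (g • s) = g • rank b s :=
  Label.ext rfl (rankOf_comp_equiv b s.val (coordG g))

theorem rank_perm_smul (σ : Equiv.Perm (Fin n)) (s : Label n C D E W) :
    rank b (σ • s) = σ • rank b s :=
  Label.ext rfl (rankOf_comp_equiv b s.val (coordS σ))

/-- Being a configuration only depends on the order type of the coordinates. -/
theorem isModel_rank_iff {dim : C → ℕ} {s : Label n C D E W} (hb : ∀ a, b ≤ s.val a) :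
    IsModel dim 0 (rank b s) ↔ IsModel dim b s := by
  have h0 : ∀ a, (rank b s).val a = 0 ↔ s.val a = b := rankOf_eq_zero_iff hb
  have h1 : ∀ a a', (rank b s).val a = (rank b s).val a' ↔ s.val a = s.val a' := rankOf_eq_iff hb
  have h2 : ∀ i j, (rank b s).u i = (rank b s).u j ↔ s.u i = s.u j := fun i j => by
    simp only [funext_iff]
    exact forall_congr' fun a => h1 _ _
  constructor
  · rintro ⟨hu, ⟨e, he⟩, hi⟩
    exact ⟨fun i a => (h0 _).symm.trans (hu i a), ⟨e, (h0 _).mp he⟩,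
      fun i j hc huu => hi i j hc ((h2 i j).mpr huu)⟩
  · rintro ⟨hu, ⟨e, he⟩, hi⟩
    exact ⟨fun i a => (h0 _).trans (hu i a), ⟨e, (h0 _).mpr he⟩,
      fun i j hc huu => hi i j hc ((h2 i j).mp huu)⟩

/-- Whether a label is fixed by a symmetry only depends on the order type of its coordinates. -/
theorem smul_smul_eq_of_rank {s : Label n C D E W} (hb : ∀ a, b ≤ s.val a) {g : G}
    {σ : Equiv.Perm (Fin n)} (h : σ • g • rank b s = rank b s) : σ • g • s = s := by
  have hc : (σ • g • rank b s).cell = (rank b s).cell := congrArg Label.cell h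
  refine Label.ext hc (funext fun a => ?_)
  exact (rankOf_eq_iff hb _ _).mp (congrFun (congrArg Label.val h) a)

/-- The order types of configurations. -/
structure IsValid (dim : C → ℕ) (r : Label n C D E ℕ) : Prop where
  isRank : IsRank r.val
  isModel : IsModel dim 0 r

theorem isValid_rank {dim : C → ℕ} {s : Label n C D E W} (hb : ∀ a, b ≤ s.val a)
    (hs : IsModel dim b s) : IsValid dim (rank b s) :=
  ⟨isRank_rankOf hb, (isModel_rank_iff hb).mpr hs⟩

theorem depth_comp_perm {A : Type*} [Fintype A] (r : A → ℕ) (π : Equiv.Perm A) :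
    depth (r ∘ π) = depth r := by
  refine le_antisymm (Finset.sup_le fun a _ => le_depth r (π a)) (Finset.sup_le fun a _ => ?_)
  have := le_depth (r ∘ π) (π.symm a)
  rwa [Function.comp_apply, Equiv.apply_symm_apply] at this

theorem isRank_comp_perm {A : Type*} [Fintype A] {r : A → ℕ} (hr : IsRank r) (π : Equiv.Perm A) :
    IsRank (r ∘ π) := by
  intro k hk hkd
  obtain ⟨a, ha⟩ := hr k hk (depth_comp_perm r π ▸ hkd)
  exact ⟨π.symm a, by simpa using ha⟩

theorem IsValid.smul {dim : C → ℕ} {r : Label n C D E ℕ} (h : IsValid dim r)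
    (hdim : ∀ (g : G) (c : C), dim (g • c) = dim c) (g : G) : IsValid dim (g • r) :=
  ⟨isRank_comp_perm h.1 _, h.2.smul hdim g⟩

theorem IsValid.perm_smul {dim : C → ℕ} {r : Label n C D E ℕ} (h : IsValid dim r)
    (σ : Equiv.Perm (Fin n)) : IsValid dim (σ • r) :=
  ⟨isRank_comp_perm h.1 _, h.2.perm_smul σ⟩

theorem depth_smul (g : G) (r : Label n C D E ℕ) : depth (g • r).val = depth r.val :=
  depth_comp_perm r.val _

theorem depth_perm_smul (σ : Equiv.Perm (Fin n)) (r : Label n C D E ℕ) :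
    depth (σ • r).val = depth r.val :=
  depth_comp_perm r.val _

theorem depth_le {A : Type*} [Fintype A] {r : A → ℕ} (hr : IsRank r) :
    depth r ≤ Fintype.card A := by
  classical
  have h : Finset.Icc 1 (depth r) ⊆ Finset.univ.image r := by
    intro k hk
    rw [Finset.mem_Icc] at hk
    obtain ⟨a, rfl⟩ := hr k hk.1 hk.2
    exact Finset.mem_image_of_mem _ (Finset.mem_univ a)
  have := (Finset.card_le_card h).trans Finset.card_image_le
  rw [Nat.card_Icc] at this
  exact this

theorem finite_isValid [Finite C] (dim : C → ℕ) : {r : Label n C D E ℕ | IsValid dim r}.Finite := by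
  classical
  let B := Fintype.card ((Fin n × Fin D) ⊕ E)
  refine Set.Finite.of_finite_image (f := fun r : Label n C D E ℕ => (r.cell, r.val)) ?_
    fun r _ r' _ h => Label.ext (congrArg Prod.fst h) (congrArg Prod.snd h)
  refine ((Set.finite_univ (α := Fin n → C)).prod
    (Set.Finite.pi' fun _ : (Fin n × Fin D) ⊕ E => Set.finite_Iic B)).subset ?_
  rintro _ ⟨r, hr, rfl⟩
  exact ⟨trivial, fun a => (le_depth _ a).trans (depth_le hr.1)⟩

end Rank

end Label

/-! ### Strata parametrized by cubes -/

namespace CompactSupportCohomology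

/-- A map to `P` whose composite with an embedding `j` extends continuously to a compact space `K`
is continuous and closed, if it is defined wherever the extension takes values in the range of `j`. -/
theorem isClosedMap_lift {K A P : Type*} [TopologicalSpace K] [CompactSpace K]
    [TopologicalSpace A] [T2Space A] [TopologicalSpace P] {g : K → A} (hg : Continuous g)
    {j : P → A} (hj : Topology.IsEmbedding j) (Φ : {v : K // g v ∈ Set.range j} → P)
    (h : ∀ v, j (Φ v) = g v) : Continuous Φ ∧ IsClosedMap Φ := by
  have hΦ : j ∘ Φ = fun v : {v : K // g v ∈ Set.range j} => g v := funext h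
  refine ⟨hj.continuous_iff.mpr (hΦ ▸ hg.comp continuous_subtype_val), fun F hF => ?_⟩
  obtain ⟨F', hF', rfl⟩ := isClosed_induced_iff.mp hF
  have : Φ '' (Subtype.val ⁻¹' F') = j ⁻¹' (g '' F') := by
    ext p
    constructor
    · rintro ⟨v, hv, rfl⟩
      exact ⟨v, hv, (h v).symm⟩
    · rintro ⟨v, hv, hvp⟩
      exact ⟨⟨v, ⟨p, hvp.symm⟩⟩, hv, hj.injective ((h _).trans hvp)⟩
  rw [this]
  exact (hg.isClosedMap _ hF').preimage hj.continuous

/-- A stratum is a cell with frontier in the strata of smaller rank if it is the bijective image of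
a cell `U` in a compact space `K` under a continuous map, the rest of `K` being mapped to smaller
strata. The map is only defined where its composite with the embedding `j` extends the map `g`
defined on `K`, and it is composed with a closed map `q`. -/
theorem stratum_of_compact {K A P Y I : Type*} [TopologicalSpace K] [CompactSpace K]
    [TopologicalSpace A] [T2Space A] [TopologicalSpace P] [TopologicalSpace Y] {g : K → A}
    (hg : Continuous g) {j : P → A} (hj : Topology.IsEmbedding j) {q : P → Y} (hq : Continuous q)
    (hqc : IsClosedMap q) {typ : Y → I} {rk : I → ℕ} {i : I} {d : ℕ} {U : Set K}
    (hU : ∀ v ∈ U, g v ∈ Set.range j)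
    (htyp : ∀ v ∈ U, ∀ p, j p = g v → typ (q p) = i)
    (hlow : ∀ v ∉ U, ∀ p, j p = g v → rk (typ (q p)) < rk i)
    (hinj : ∀ v ∈ U, ∀ v' ∈ U, ∀ p p', j p = g v → j p' = g v' → q p = q p' → v = v')
    (hsurj : ∀ p, typ (q p) = i → ∃ v ∈ U, ∃ p', j p' = g v ∧ q p' = q p)
    (hqs : Function.Surjective q) (hcell : IsCell d U) :
    IsCell d (typ ⁻¹' {i}) ∧ ∀ y ∈ closure (typ ⁻¹' {i}), typ y = i ∨ rk (typ y) < rk i := by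
  let Φ : {v : K // g v ∈ Set.range j} → P := fun v => v.2.choose
  have hΦ : ∀ v, j (Φ v) = g v := fun v => v.2.choose_spec
  obtain ⟨hc, hcl⟩ := isClosedMap_lift hg hj Φ hΦ
  have hiff : ∀ v : {v : K // g v ∈ Set.range j}, (v : K) ∈ U ↔ typ (q (Φ v)) = i := by
    intro v
    refine ⟨fun h => htyp v h _ (hΦ v), fun h => ?_⟩
    by_contra hv
    exact absurd (h ▸ hlow v hv _ (hΦ v)) (lt_irrefl _)
  have hsub : typ ⁻¹' {i} ⊆ Set.range (q ∘ Φ) := by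
    intro y hy
    obtain ⟨p, rfl⟩ := hqs y
    obtain ⟨v, -, p', hp', hqp⟩ := hsurj p hy
    exact ⟨⟨v, p', hp'⟩, by rw [← hqp]; exact congrArg q (hj.injective ((hΦ _).trans hp'.symm))⟩
  constructor
  · let S : Set Y := typ ⁻¹' {i}
    let f := S.restrictPreimage (q ∘ Φ)
    have hf : Function.Bijective f := by
      constructor
      · rintro ⟨v, hv⟩ ⟨v', hv'⟩ h
        refine Subtype.ext (Subtype.ext ?_)
        exact hinj v ((hiff v).mpr hv) v' ((hiff v').mpr hv') _ _ (hΦ v) (hΦ v')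
          (congrArg Subtype.val h)
      · rintro ⟨y, hy⟩
        obtain ⟨v, rfl⟩ := hsub hy
        exact ⟨⟨v, hy⟩, rfl⟩
    let e : (q ∘ Φ) ⁻¹' S ≃ₜ S := (Equiv.ofBijective f hf).toHomeomorphOfContinuousClosed
      (hq.comp hc).restrictPreimage ((hqc.comp hcl).restrictPreimage S)
    let e' : U ≃ₜ (q ∘ Φ) ⁻¹' S :=
      { toFun := fun v => ⟨⟨v, hU v v.2⟩, (hiff _).mp v.2⟩
        invFun := fun v => ⟨v.1, (hiff _).mpr v.2⟩
        left_inv := fun _ => rfl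
        right_inv := fun _ => rfl
        continuous_toFun := by fun_prop
        continuous_invFun := by fun_prop }
    exact hcell.congr (e'.trans e)
  · intro y hy
    obtain ⟨v, rfl⟩ := closure_minimal hsub (hqc.comp hcl).isClosed_range hy
    by_cases hv : (v : K) ∈ U
    · exact Or.inl ((hiff v).mp hv)
    · exact Or.inr (hlow v hv _ (hΦ v))

end CompactSupportCohomology

namespace EquivariantCW

open CompactSupportCohomology

/-- The unit cube. -/
abbrev Cube (D : ℕ) : Type := Fin D → Set.Icc (0 : ℝ) 1

/-- The point of the ambient cube with the given coordinates of index less than `d`, padded by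
zeros. -/
def pad {D : ℕ} (d : ℕ) (v : Cube d) (a : Fin D) : ℝ := if h : (a : ℕ) < d then v ⟨a, h⟩ else 0

theorem continuous_pad {D : ℕ} (d : ℕ) : Continuous (pad (D := D) d) := by
  refine continuous_pi fun a => ?_
  by_cases h : (a : ℕ) < d
  · simp only [pad, dif_pos h]
    fun_prop
  · simp only [pad, dif_neg h]
    fun_prop

theorem closedBox_pad {D d : ℕ} (v : Cube d) : ClosedBox d (pad (D := D) d v) := by
  intro a
  refine ⟨fun h => ?_, fun h => dif_neg (by omega)⟩
  rw [pad, dif_pos h]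
  exact (v _).2

theorem openBox_pad_iff {D d : ℕ} (hd : d ≤ D) (v : Cube d) :
    OpenBox d (pad (D := D) d v) ↔ ∀ a, 0 < (v a : ℝ) ∧ (v a : ℝ) < 1 := by
  constructor
  · intro h a
    have := (h ⟨a, a.2.trans_le hd⟩).1 a.2
    rwa [pad, dif_pos (show ((⟨a, a.2.trans_le hd⟩ : Fin D) : ℕ) < d from a.2)] at this
  · intro h a
    refine ⟨fun ha => ?_, (closedBox_pad v a).2⟩
    rw [pad, dif_pos ha]
    exact h _

theorem pad_injective {D d : ℕ} (hd : d ≤ D) : Function.Injective (pad (D := D) d) := by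
  intro v v' h
  funext a
  have := congrFun h ⟨a, a.2.trans_le hd⟩
  rw [pad, pad, dif_pos (show ((⟨a, a.2.trans_le hd⟩ : Fin D) : ℕ) < d from a.2),
    dif_pos (show ((⟨a, a.2.trans_le hd⟩ : Fin D) : ℕ) < d from a.2)] at this
  exact Subtype.ext this

theorem exists_pad {D d : ℕ} {y : Fin D → ℝ} (hd : d ≤ D) (hy : ClosedBox d y) :
    ∃ v : Cube d, pad d v = y := by
  refine ⟨fun a => ⟨y ⟨a, a.2.trans_le hd⟩, (hy ⟨a, a.2.trans_le hd⟩).1 a.2⟩, funext fun a => ?_⟩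
  by_cases h : (a : ℕ) < d
  · rw [pad, dif_pos h]
  · rw [pad, dif_neg h, (hy a).2 (by omega)]

/-- The interior of the unit cube. -/
def cubeInterior (d : ℕ) : Set (Cube d) := {v | ∀ a, 0 < (v a : ℝ) ∧ (v a : ℝ) < 1}

theorem isCell_cubeInterior (d : ℕ) : IsCell d (cubeInterior d) := by
  refine (isCell_openCube d).congr
    { toFun := fun v => ⟨fun a => ⟨v.1 a, (v.2 a).1.le, (v.2 a).2.le⟩, v.2⟩
      invFun := fun v => ⟨fun a => v.1 a, v.2⟩
      left_inv := fun _ => rfl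
      right_inv := fun _ => rfl
      continuous_toFun := by
        refine Continuous.subtype_mk (continuous_pi fun a => Continuous.subtype_mk ?_ _) _
        exact (continuous_apply a).comp continuous_subtype_val
      continuous_invFun := by
        refine Continuous.subtype_mk (continuous_pi fun a => ?_) _
        exact continuous_subtype_val.comp ((continuous_apply a).comp continuous_subtype_val) }

end EquivariantCW

/-! ### The cells of the loci of given orbit length -/

theorem ncard_orbit_eq {H A B : Type*} [Group H] [MulAction H A] [MulAction H B] {φ : A → B} {a : A}
    (hφ : ∀ h : H, φ (h • a) = h • φ a) (hinj : Set.InjOn φ (MulAction.orbit H a)) :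
    (MulAction.orbit H (φ a)).ncard = (MulAction.orbit H a).ncard := by
  have h : MulAction.orbit H (φ a) = φ '' MulAction.orbit H a := by
    ext b
    constructor
    · rintro ⟨g, rfl⟩
      exact ⟨g • a, ⟨g, rfl⟩, hφ g⟩
    · rintro ⟨_, ⟨g, rfl⟩, rfl⟩
      exact ⟨g, (hφ g).symm⟩
  rw [h]
  exact hinj.ncard_image

namespace EquivariantCW

open CompactSupportCohomology

namespace CubicalCells

attribute [instance] CubicalCells.fintype CubicalCells.action

universe u v

variable {G : Type v} [Group G] {X : Type u} [TopologicalSpace X] [MulAction G X]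
  (K : CubicalCells G X)

/-- The cell containing a point in its interior. -/
def cellOf (x : X) : K.C := (K.exists_eq x).choose

/-- The coordinates of a point in its cell. -/
def coordOf (x : X) : Fin K.D → ℝ := (K.exists_eq x).choose_spec.choose

theorem openBox_coordOf (x : X) : OpenBox (K.dim (K.cellOf x)) (K.coordOf x) :=
  (K.exists_eq x).choose_spec.choose_spec.1

theorem χ_coordOf (x : X) : K.χ (K.cellOf x) (K.coordOf x) = x :=
  (K.exists_eq x).choose_spec.choose_spec.2

theorem cellOf_χ {c : K.C} {y : Fin K.D → ℝ} (hy : OpenBox (K.dim c) y) :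
    K.cellOf (K.χ c y) = c :=
  (K.eq_of_eq (K.openBox_coordOf _) hy (K.χ_coordOf _)).1

theorem coordOf_χ {c : K.C} {y : Fin K.D → ℝ} (hy : OpenBox (K.dim c) y) :
    K.coordOf (K.χ c y) = y :=
  (K.eq_of_eq (K.openBox_coordOf _) hy (K.χ_coordOf _)).2

theorem ext_point {x x' : X} (hc : K.cellOf x = K.cellOf x') (hy : K.coordOf x = K.coordOf x') :
    x = x' := by
  rw [← K.χ_coordOf x, ← K.χ_coordOf x', hc, hy]

theorem openBox_smul (g : G) {c : K.C} {y : Fin K.D → ℝ} (hy : OpenBox (K.dim c) y) :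
    OpenBox (K.dim (g • c)) y := by rwa [K.dim_smul]

theorem smul_eq_χ (g : G) (x : X) : g • x = K.χ (g • K.cellOf x) (K.coordOf x) := by
  rw [K.smul_χ, K.χ_coordOf]

theorem cellOf_smul (g : G) (x : X) : K.cellOf (g • x) = g • K.cellOf x := by
  rw [K.smul_eq_χ]
  exact K.cellOf_χ (K.openBox_smul g (K.openBox_coordOf x))

theorem coordOf_smul (g : G) (x : X) : K.coordOf (g • x) = K.coordOf x := by
  rw [K.smul_eq_χ]
  exact K.coordOf_χ (K.openBox_smul g (K.openBox_coordOf x))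

theorem dim_cellOf_lt {c : K.C} {y : Fin K.D → ℝ} (hy : ClosedBox (K.dim c) y)
    (hn : ¬ OpenBox (K.dim c) y) : K.dim (K.cellOf (K.χ c y)) < K.dim c := by
  obtain ⟨c', y', hy', he, hlt⟩ := K.frontier hy hn
  rwa [← he, K.cellOf_χ hy']

theorem dim_cellOf_le {c : K.C} {y : Fin K.D → ℝ} (hy : ClosedBox (K.dim c) y) :
    K.dim (K.cellOf (K.χ c y)) ≤ K.dim c := by
  by_cases h : OpenBox (K.dim c) y
  · rw [K.cellOf_χ h]
  · exact (K.dim_cellOf_lt hy h).le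

theorem compactSpace (K : CubicalCells G X) : CompactSpace X := by
  have h : ∀ c, IsCompact (Set.range fun v : Cube (K.dim c) => K.χ c (pad (K.dim c) v)) :=
    fun c => isCompact_range ((K.continuous_χ c).comp (continuous_pad _))
  refine ⟨(isCompact_iUnion h).of_isClosed_subset isClosed_univ fun x _ => ?_⟩
  obtain ⟨v, hv⟩ := exists_pad (K.dim_le _) (K.openBox_coordOf x).closedBox
  exact Set.mem_iUnion.mpr ⟨K.cellOf x, v, (congrArg _ hv).trans (K.χ_coordOf x)⟩

/-- The orbits of a point and of its cell have the same length, since an element that fixes a cell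
fixes its points. -/
theorem ncard_orbit_cellOf (H : Subgroup G) (x : X) :
    (MulAction.orbit H (K.cellOf x)).ncard = (MulAction.orbit H x).ncard := by
  refine ncard_orbit_eq (fun h : H => K.cellOf_smul (h : G) x) ?_
  rintro _ ⟨g, rfl⟩ _ ⟨g', rfl⟩ hc
  exact K.ext_point hc ((K.coordOf_smul _ x).trans (K.coordOf_smul _ x).symm)

/-- The locus is the difference of the fixed locus of `g ^ k` and those of the smaller powers. -/
theorem isLocallyClosed_orbitLengthLocus [T2Space X] [ContinuousConstSMul G X]
    [Finite G] (g : G) {k : ℕ} (hk : 1 ≤ k) : IsLocallyClosed (orbitLengthLocus X g k) := by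
  have hp : ∀ j : ℕ, IsClosed {x : X | g ^ j • x = x} := fun j =>
    isClosed_eq (continuous_const_smul _) continuous_id
  have h : orbitLengthLocus X g k =
      {x : X | g ^ k • x = x} ∩ ⋂ j ∈ Finset.Ioo 0 k, {x : X | g ^ j • x = x}ᶜ := by
    ext x
    have hper : ∀ j, Function.IsPeriodicPt (g • ·) j x ↔ g ^ j • x = x := fun j => by
      rw [Function.IsPeriodicPt, Function.IsFixedPt, smul_iterate]
    have hfin : Finite (MulAction.orbit (Subgroup.zpowers g) x) := Set.finite_range _
    have : Fintype (MulAction.orbit (Subgroup.zpowers g) x) := Fintype.ofFinite _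
    have hc : (MulAction.orbit (Subgroup.zpowers g) x).ncard =
        Function.minimalPeriod (g • ·) x := by
      rw [MulAction.minimalPeriod_eq_card, ← Nat.card_eq_fintype_card, Nat.card_coe_set_eq]
    change _ = k ↔ _
    rw [hc]
    simp only [Set.mem_inter_iff, Set.mem_ofPred_eq, Set.mem_iInter, Set.mem_compl_iff, ← hper,
      Finset.mem_Ioo]
    constructor
    · rintro rfl
      exact ⟨Function.isPeriodicPt_minimalPeriod _ _, fun j hj hjp =>
        absurd (hjp.minimalPeriod_le hj.1) (not_le.mpr hj.2)⟩
    · rintro ⟨h1, h2⟩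
      refine le_antisymm (h1.minimalPeriod_le hk) ?_
      by_contra hlt
      exact h2 _ ⟨h1.minimalPeriod_pos hk, not_le.mp hlt⟩ (Function.isPeriodicPt_minimalPeriod _ _)
  rw [h]
  refine (hp k).isLocallyClosed.inter (IsOpen.isLocallyClosed ?_)
  exact isOpen_biInter_finset fun j _ => (hp j).isOpen_compl

open Classical in
/-- `X_k(g)` is the union of the open cells whose orbit under `g` has length `k`. -/
theorem isStratification_orbitLengthLocus [T2Space X] (g : G) (k : ℕ) :
    IsStratification (fun x : orbitLengthLocus X g k => K.cellOf x) K.dim K.dim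
      {c | (MulAction.orbit (Subgroup.zpowers g) c).ncard = k} := by
  have key : ∀ c : K.C, (MulAction.orbit (Subgroup.zpowers g) c).ncard = k → _ := fun c hc =>
    stratum_of_compact (K := Cube (K.dim c)) (A := X) (P := orbitLengthLocus X g k)
      (Y := orbitLengthLocus X g k) (g := fun v => K.χ c (pad (K.dim c) v))
      ((K.continuous_χ c).comp (continuous_pad _)) (j := Subtype.val)
      Topology.IsEmbedding.subtypeVal
      (q := id) continuous_id IsClosedMap.id (typ := fun x => K.cellOf x) (rk := K.dim) (i := c)
      (d := K.dim c) (U := cubeInterior (K.dim c))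
      (by
        intro v hv
        have hv' := (openBox_pad_iff (K.dim_le c) v).mpr hv
        refine ⟨⟨_, ?_⟩, rfl⟩
        change _ = k
        rw [← K.ncard_orbit_cellOf, K.cellOf_χ hv', hc])
      (by
        rintro v hv p hp
        rw [id, hp]
        exact K.cellOf_χ ((openBox_pad_iff (K.dim_le c) v).mpr hv))
      (by
        rintro v hv p hp
        rw [id, hp]
        exact K.dim_cellOf_lt (closedBox_pad v)
          fun h => hv ((openBox_pad_iff (K.dim_le c) v).mp h))
      (by
        intro v hv v' hv' p p' hp hp' hpp
        have h : K.χ c (pad (K.dim c) v) = K.χ c (pad (K.dim c) v') := by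
          rw [← hp, ← hp']
          exact congrArg Subtype.val hpp
        exact pad_injective (K.dim_le c) (K.eq_of_eq
          ((openBox_pad_iff (K.dim_le c) v).mpr hv)
          ((openBox_pad_iff (K.dim_le c) v').mpr hv') h).2)
      (by
        rintro p hp
        obtain ⟨v, hv⟩ := exists_pad (K.dim_le _) (K.openBox_coordOf p.1).closedBox
        have h := K.openBox_coordOf p.1
        have h' := K.χ_coordOf p.1
        change K.cellOf p.1 = c at hp
        subst hp
        rw [← hv] at h h'
        exact ⟨v, (openBox_pad_iff (K.dim_le _) v).mp h, p, h'.symm, rfl⟩)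
      Function.surjective_id (isCell_cubeInterior _)
  refine ⟨fun x => ?_, fun c hc => (key c ?_).2, fun c hc => (key c ?_).1⟩
  · rw [Finset.mem_filter]
    exact ⟨Finset.mem_univ _, (K.ncard_orbit_cellOf _ _).trans x.2⟩
  · exact (Finset.mem_filter.mp hc).2
  · exact (Finset.mem_filter.mp hc).2

section Locus

variable [T2Space X] [ContinuousConstSMul G X] [Finite G]

theorem hasFiniteHc_orbitLengthLocus (K : CubicalCells G X) (g : G) {k : ℕ} (hk : 1 ≤ k) :
    HasFiniteHc (orbitLengthLocus X g k) := by
  have := K.compactSpace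
  have := (isLocallyClosed_orbitLengthLocus (X := X) g hk).locallyCompactSpace
  exact (K.isStratification_orbitLengthLocus g k).hasFiniteHc _ rfl

open Classical in
theorem chiC_orbitLengthLocus (g : G) {k : ℕ} (hk : 1 ≤ k) :
    (chiC (orbitLengthLocus X g k) : ℚ) =
      ∑ c : K.C with (MulAction.orbit (Subgroup.zpowers g) c).ncard = k, (-1) ^ K.dim c := by
  have := K.compactSpace
  have := (isLocallyClosed_orbitLengthLocus (X := X) g hk).locallyCompactSpace
  rw [cast_chiC (K.hasFiniteHc_orbitLengthLocus g hk),
    IsStratification.lefschetzNumber_eq (1 : Equiv.Perm K.C) (fun _ => rfl) _ rfl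
      (K.isStratification_orbitLengthLocus g k) _ (fun _ => rfl) (fun _ => Iff.rfl)
      (fun _ _ => rfl)]
  refine Finset.sum_congr ?_ fun _ _ => rfl
  exact Finset.filter_true_of_mem fun _ _ => rfl

end Locus

end CubicalCells

end EquivariantCW

/-! ### Real coordinates on the configuration spaces -/

namespace EquivariantCW

open OrderType

/-- The levels `t₀ = 0 ≤ t₁ ≤ … ≤ t_m` with `1 - t_{k+1} = (1 - t_k) v_k`. They parametrize the
increasing sequences in `[0, 1)` by the cube. -/
def levels {m : ℕ} (v : Cube m) (k : ℕ) : ℝ :=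
  1 - ∏ j ∈ Finset.range k, if h : j < m then (v ⟨j, h⟩ : ℝ) else 1

section Levels

variable {m : ℕ} (v : Cube m)

theorem levels_zero : levels v 0 = 0 := by simp [levels]

theorem levels_succ {k : ℕ} (hk : k < m) :
    1 - levels v (k + 1) = (1 - levels v k) * v ⟨k, hk⟩ := by
  simp [levels, Finset.prod_range_succ, hk]

theorem continuous_levels (k : ℕ) : Continuous fun v : Cube m => levels v k := by
  refine continuous_const.sub (continuous_finsetProd _ fun j _ => ?_)
  by_cases h : j < m
  · simp only [dif_pos h]
    fun_prop
  · simp only [dif_neg h]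
    fun_prop

theorem levels_nonneg (k : ℕ) : 0 ≤ levels v k := by
  refine sub_nonneg.mpr (Finset.prod_le_one (fun j _ => ?_) fun j _ => ?_) <;> split_ifs with h
  exacts [(v ⟨j, h⟩).2.1, zero_le_one, (v ⟨j, h⟩).2.2, le_rfl]

theorem levels_le_one (k : ℕ) : levels v k ≤ 1 := by
  refine sub_le_self _ (Finset.prod_nonneg fun j _ => ?_)
  split_ifs with h
  exacts [(v ⟨j, h⟩).2.1, zero_le_one]

theorem levels_eq_one {j : Fin m} (hj : (v j : ℝ) = 0) : levels v m = 1 := by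
  rw [levels, Finset.prod_eq_zero (Finset.mem_range.mpr j.2), sub_zero]
  rw [dif_pos j.2]
  exact hj

variable {v}

theorem levels_lt_one (hv : v ∈ cubeInterior m) (k : ℕ) : levels v k < 1 := by
  refine sub_lt_self _ (Finset.prod_pos fun j _ => ?_)
  split_ifs with h
  exacts [(hv ⟨j, h⟩).1, zero_lt_one]

theorem levels_lt_succ (hv : v ∈ cubeInterior m) {k : ℕ} (hk : k < m) :
    levels v k < levels v (k + 1) := by
  have h1 := levels_succ v hk
  have h2 := sub_pos.mpr (levels_lt_one hv k)
  have h3 := mul_lt_mul_of_pos_left (hv ⟨k, hk⟩).2 h2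
  linarith

theorem strictMonoOn_levels (hv : v ∈ cubeInterior m) :
    StrictMonoOn (levels v) (Set.Iic m) := by
  intro k _ l hl hkl
  have hl' : l ≤ m := hl
  clear hl
  induction l, hkl using Nat.le_induction with
  | base => exact levels_lt_succ hv hl'
  | succ l _ ih => exact (ih (by omega)).trans (levels_lt_succ hv hl')

theorem levels_injOn {v' : Cube m} (hv : v ∈ cubeInterior m)
    (h : ∀ k ≤ m, levels v k = levels v' k) : v = v' := by
  funext j
  have h1 := levels_succ v j.2
  have h2 := levels_succ v' j.2
  rw [← h j j.2.le, ← h (j + 1) j.2, h1] at h2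
  exact Subtype.ext (mul_left_cancel₀ (sub_pos.mpr (levels_lt_one hv j)).ne' h2)

/-- The increasing sequences in `[0, 1)` starting at zero are the levels of interior points. -/
theorem exists_levels {t : ℕ → ℝ} (h0 : t 0 = 0) (ht : StrictMonoOn t (Set.Iic m))
    (h1 : ∀ k ≤ m, t k < 1) : ∃ v ∈ cubeInterior m, ∀ k ≤ m, levels v k = t k := by
  have key : ∀ j : Fin m, 0 < (1 - t (j + 1)) / (1 - t j) ∧ (1 - t (j + 1)) / (1 - t j) < 1 := by
    intro j
    have hj : 0 < 1 - t j := sub_pos.mpr (h1 j j.2.le)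
    refine ⟨div_pos (sub_pos.mpr (h1 (j + 1) j.2)) hj, (div_lt_one hj).mpr ?_⟩
    have := ht (show (j : ℕ) ≤ m from j.2.le) (show (j : ℕ) + 1 ≤ m from j.2) (Nat.lt_succ_self j)
    linarith
  refine ⟨fun j => ⟨_, (key j).1.le, (key j).2.le⟩, key, fun k => ?_⟩
  induction k with
  | zero => exact fun _ => (levels_zero _).trans h0.symm
  | succ k ih =>
    intro hk
    have h2 := levels_succ (fun j : Fin m => ⟨_, (key j).1.le, (key j).2.le⟩) hk
    have h3 : 1 - t k ≠ 0 := (sub_pos.mpr (h1 k (by omega))).ne'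
    rw [ih (by omega)] at h2
    simp only at h2
    rw [mul_div_cancel₀ _ h3] at h2
    linarith

end Levels

namespace CubicalCells

open CompactSupportCohomology

universe u v

variable {G : Type v} [Group G] {X : Type u} [TopologicalSpace X] [MulAction G X]
  (K : CubicalCells G X) {E : Type*} [Fintype E] {n : ℕ}

/-- The labels that are the coordinates of a point of `Conf_n(X) × Δ°`. -/
structure IsReal (s : Label n K.C K.D E ℝ) : Prop where
  nonneg : ∀ a, 0 ≤ s.val a
  lt_one : ∀ a, s.val a < 1
  isModel : s.IsModel K.dim 0

/-- The point with the given coordinates. The coordinate of the vertex `e` is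
`1 - ℓ(e) / max ℓ`. -/
def realize (s : Label n K.C K.D E ℝ) : (Fin n → X) × (E → ℝ) :=
  (fun i => K.χ (s.cell i) (s.u i), fun e => (1 - s.l e) / ∑ e', (1 - s.l e'))

variable {K}

theorem IsReal.openBox {s : Label n K.C K.D E ℝ} (hs : K.IsReal s) (i : Fin n) :
    OpenBox (K.dim (s.cell i)) (s.u i) := by
  refine fun a => ⟨fun ha => ⟨lt_of_le_of_ne (hs.nonneg _) ?_, hs.lt_one _⟩, fun ha =>
    (hs.isModel.u_eq_iff i a).mpr ha⟩
  exact fun h => absurd ((hs.isModel.u_eq_iff i a).mp h.symm) (not_le.mpr ha)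

theorem IsReal.sum_pos {s : Label n K.C K.D E ℝ} (hs : K.IsReal s) :
    0 < ∑ e, (1 - s.l e) := by
  obtain ⟨e, -⟩ := hs.isModel.exists_l
  exact Finset.sum_pos (fun e _ => sub_pos.mpr (hs.lt_one _)) ⟨e, Finset.mem_univ e⟩

variable (X E n) in
/-- The inclusion of `Conf_n(X) × Δ°` in `Xⁿ × ℝ^E`. -/
def inclusion (p : Conf n X × OpenSimplex E) : (Fin n → X) × (E → ℝ) := (p.1.1, p.2.1)

theorem inclusion_injective : Function.Injective (inclusion X E n) := fun _ _ h =>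
  Prod.ext (Subtype.ext (congrArg Prod.fst h)) (Subtype.ext (congrArg Prod.snd h))

theorem IsReal.exists_inclusion_eq {s : Label n K.C K.D E ℝ} (hs : K.IsReal s) :
    ∃ p, inclusion X E n p = K.realize s := by
  refine ⟨(⟨_, fun i j h => ?_⟩, ⟨_, fun e => ?_, ?_⟩), rfl⟩
  · obtain ⟨hc, hu⟩ := K.eq_of_eq (hs.openBox i) (hs.openBox j) h
    exact hs.isModel.injective i j hc hu
  · exact div_pos (sub_pos.mpr (hs.lt_one _)) hs.sum_pos
  · rw [← Finset.sum_div, div_self hs.sum_pos.ne']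

/-- The coordinates of a point are unique. -/
theorem IsReal.eq_of_realize_eq {s s' : Label n K.C K.D E ℝ} (hs : K.IsReal s) (hs' : K.IsReal s')
    (h : K.realize s = K.realize s') : s = s' := by
  have h1 : ∀ i, s.cell i = s'.cell i ∧ s.u i = s'.u i := fun i =>
    K.eq_of_eq (hs.openBox i) (hs'.openBox i) (congrFun (congrArg Prod.fst h) i)
  have h2 : ∀ e, (1 - s.l e) / ∑ e', (1 - s.l e') = (1 - s'.l e) / ∑ e', (1 - s'.l e') := fun e =>
    congrFun (congrArg Prod.snd h) e
  -- Both totals are `1 / max ℓ`: compare at a vertex whose coordinate for one label is zero.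
  have key : ∀ {t t' : Label n K.C K.D E ℝ}, K.IsReal t → K.IsReal t' →
      (∀ e, (1 - t.l e) / ∑ e', (1 - t.l e') = (1 - t'.l e) / ∑ e', (1 - t'.l e')) →
      ∑ e', (1 - t'.l e') ≤ ∑ e', (1 - t.l e') := by
    intro t t' ht ht' h
    obtain ⟨e, he⟩ := ht.isModel.exists_l
    have h3 := h e
    rw [he, sub_zero, div_eq_div_iff ht.sum_pos.ne' ht'.sum_pos.ne', one_mul] at h3
    rw [h3]
    refine mul_le_of_le_one_left ht.sum_pos.le ?_
    have := ht'.nonneg (Sum.inr e)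
    change 1 - t'.val (Sum.inr e) ≤ 1
    linarith
  have h3 := le_antisymm (key hs' hs fun e => (h2 e).symm) (key hs hs' h2)
  refine Label.ext_iff'.mpr ⟨fun i => (h1 i).1, fun i a => congrFun (h1 i).2 a, fun e => ?_⟩
  have h4 := h2 e
  rw [h3, div_left_inj' hs'.sum_pos.ne'] at h4
  linarith

variable (K)

theorem exists_isReal [Nonempty E] (p : Conf n X × OpenSimplex E) :
    ∃ s, K.IsReal s ∧ K.realize s = inclusion X E n p := by
  obtain ⟨x, l⟩ := p
  obtain ⟨e₀, he₀⟩ := Finite.exists_max l.1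
  have hM : 0 < l.1 e₀ := l.2.1 e₀
  let s : Label n K.C K.D E ℝ := ⟨fun i => K.cellOf (x.1 i),
    Sum.elim (fun p => K.coordOf (x.1 p.1) p.2) fun e => 1 - l.1 e / l.1 e₀⟩
  have hb : ∀ i, OpenBox (K.dim (s.cell i)) (s.u i) := fun i => K.openBox_coordOf _
  have hl : ∀ e, 1 - s.l e = l.1 e / l.1 e₀ := fun e => sub_sub_cancel _ _
  refine ⟨s, ⟨?_, ?_, ?_, ⟨e₀, ?_⟩, ?_⟩, Prod.ext ?_ ?_⟩
  · rintro (⟨i, a⟩ | e)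
    · by_cases ha : (a : ℕ) < K.dim (s.cell i)
      · exact ((hb i a).1 ha).1.le
      · exact ((hb i a).2 (not_lt.mp ha)).ge
    · exact sub_nonneg.mpr ((div_le_one hM).mpr (he₀ e))
  · rintro (⟨i, a⟩ | e)
    · by_cases ha : (a : ℕ) < K.dim (s.cell i)
      · exact ((hb i a).1 ha).2
      · exact ((hb i a).2 (not_lt.mp ha)).trans_lt zero_lt_one
    · exact sub_lt_self _ (div_pos (l.2.1 e) hM)
  · intro i a
    refine ⟨fun h => ?_, (hb i a).2⟩
    by_contra ha
    exact ((hb i a).1 (not_le.mp ha)).1.ne' h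
  · have := hl e₀
    rw [div_self hM.ne'] at this
    linarith
  · exact fun i j hc hu => x.2 (K.ext_point hc hu)
  · exact funext fun i => K.χ_coordOf _
  · funext e
    simp only [realize, hl, inclusion]
    rw [← Finset.sum_div, l.2.2, div_div_div_cancel_right₀ hM.ne', div_one]

section Coord

variable [Nonempty E]

/-- The coordinates of a point of `Conf_n(X) × Δ°`. -/
def coord (p : Conf n X × OpenSimplex E) : Label n K.C K.D E ℝ := (K.exists_isReal p).choose

theorem isReal_coord (p : Conf n X × OpenSimplex E) : K.IsReal (K.coord p) :=
  (K.exists_isReal p).choose_spec.1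

theorem realize_coord (p : Conf n X × OpenSimplex E) :
    K.realize (K.coord p) = inclusion X E n p :=
  (K.exists_isReal p).choose_spec.2

variable {K}

theorem IsReal.coord_eq {s : Label n K.C K.D E ℝ} (hs : K.IsReal s)
    {p : Conf n X × OpenSimplex E} (h : inclusion X E n p = K.realize s) : K.coord p = s :=
  (K.isReal_coord p).eq_of_realize_eq hs ((K.realize_coord p).trans h)

variable (K)

/-- The order type of the coordinates of a point. -/
def typ (p : Conf n X × OpenSimplex E) : Label n K.C K.D E ℕ := (K.coord p).rank 0

variable {K}

theorem isValid_typ (p : Conf n X × OpenSimplex E) : (K.typ p).IsValid K.dim :=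
  Label.isValid_rank (K.isReal_coord p).nonneg (K.isReal_coord p).isModel

theorem eq_of_coord_eq {p p' : Conf n X × OpenSimplex E} (h : K.coord p = K.coord p') : p = p' :=
  inclusion_injective ((K.realize_coord p).symm.trans (h ▸ K.realize_coord p'))

variable [MulAction G E]

theorem IsReal.smul {s : Label n K.C K.D E ℝ} (hs : K.IsReal s) (g : G) : K.IsReal (g • s) :=
  ⟨fun _ => hs.nonneg _, fun _ => hs.lt_one _, hs.isModel.smul K.dim_smul g⟩

theorem IsReal.perm_smul {s : Label n K.C K.D E ℝ} (hs : K.IsReal s) (σ : Equiv.Perm (Fin n)) :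
    K.IsReal (σ • s) :=
  ⟨fun _ => hs.nonneg _, fun _ => hs.lt_one _, hs.isModel.perm_smul σ⟩

theorem coord_smul (g : G) (p : Conf n X × OpenSimplex E) : K.coord (g • p) = g • K.coord p := by
  refine ((K.isReal_coord p).smul g).coord_eq ?_
  have h := K.realize_coord p
  refine Prod.ext (funext fun i => ?_) (funext fun e => ?_)
  · refine Eq.trans ?_ (K.smul_χ g _ _).symm
    exact congrArg (g • ·) (congrFun (congrArg Prod.fst h) i).symm
  · refine (congrFun (congrArg Prod.snd h) (g⁻¹ • e)).symm.trans ?_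
    refine congrArg (fun S => (1 - (K.coord p).l (g⁻¹ • e)) / S) ?_
    exact (Equiv.sum_comp (MulAction.toPerm g⁻¹ : Equiv.Perm E) fun e => 1 - (K.coord p).l e).symm

theorem coord_perm_smul (σ : Equiv.Perm (Fin n)) (p : Conf n X × OpenSimplex E) :
    K.coord (σ • p.1, p.2) = σ • K.coord p := by
  refine ((K.isReal_coord p).perm_smul σ).coord_eq ?_
  have h := K.realize_coord p
  refine Prod.ext (funext fun i => ?_) (congrArg Prod.snd h).symm
  exact (congrFun (congrArg Prod.fst h) (σ⁻¹ i)).symm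

theorem typ_smul (g : G) (p : Conf n X × OpenSimplex E) : K.typ (g • p) = g • K.typ p := by
  rw [typ, coord_smul, Label.rank_smul, typ]

theorem typ_perm_smul (σ : Equiv.Perm (Fin n)) (p : Conf n X × OpenSimplex E) :
    K.typ (σ • p.1, p.2) = σ • K.typ p := by
  rw [typ, coord_perm_smul, Label.rank_perm_smul, typ]

end Coord

/-- The rank of a stratum: the dimension of the cells first, then the number of levels, which is at
most the number of coordinates. -/
def stratumRank (r : Label n K.C K.D E ℕ) : ℕ :=
  (∑ i, K.dim (r.cell i)) * (Fintype.card ((Fin n × Fin K.D) ⊕ E) + 1) + depth r.val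

theorem stratumRank_smul [MulAction G E] (g : G) (r : Label n K.C K.D E ℕ) :
    K.stratumRank (g • r) = K.stratumRank r := by
  simp only [stratumRank, Label.smul_cell, K.dim_smul, Label.depth_smul]

theorem stratumRank_perm_smul (σ : Equiv.Perm (Fin n)) (r : Label n K.C K.D E ℕ) :
    K.stratumRank (σ • r) = K.stratumRank r := by
  simp only [stratumRank, Label.perm_smul_cell, Label.depth_perm_smul]
  rw [Equiv.sum_comp σ⁻¹ fun i => K.dim (r.cell i)]

end CubicalCells

end EquivariantCW

/-! ### The stratification of the quotient -/

namespace OpenSimplex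

variable {E : Type*} [Fintype E]

instance : T2Space (OpenSimplex E) :=
  inferInstanceAs (T2Space {l : E → ℝ // (∀ e, 0 < l e) ∧ ∑ e, l e = 1})

instance : LocallyCompactSpace (OpenSimplex E) := by
  have h1 : IsOpen {l : E → ℝ | ∀ e, 0 < l e} := by
    rw [Set.ofPred_forall]
    exact isOpen_iInter_of_finite fun e => isOpen_lt continuous_const (continuous_apply e)
  have h2 : IsClosed {l : E → ℝ | ∑ e, l e = 1} :=
    isClosed_eq (continuous_finsetSum _ fun e _ => continuous_apply e) continuous_const
  exact (h1.isLocallyClosed.inter h2.isLocallyClosed).locallyCompactSpace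

instance {G : Type*} [Group G] [MulAction G E] : ContinuousConstSMul G (OpenSimplex E) where
  continuous_const_smul g := Continuous.subtype_mk
    (f := fun l : {l : E → ℝ // (∀ e, 0 < l e) ∧ ∑ e, l e = 1} => fun e => l.1 (g⁻¹ • e))
    (continuous_pi fun e => (continuous_apply (g⁻¹ • e)).comp continuous_subtype_val) _

end OpenSimplex

namespace Conf

variable {n : ℕ} {X : Type*} [TopologicalSpace X]

instance [T2Space X] : T2Space (Conf n X) :=
  inferInstanceAs (T2Space {x : Fin n → X // Function.Injective x})

instance [T2Space X] [LocallyCompactSpace X] : LocallyCompactSpace (Conf n X) := by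
  have h : {x : Fin n → X | Function.Injective x} = ⋂ (i) (j), {x | x i = x j → i = j} := by
    ext x
    simp only [Set.mem_iInter]
    rfl
  have h1 : IsOpen {x : Fin n → X | Function.Injective x} := by
    rw [h]
    refine isOpen_iInter_of_finite fun i => isOpen_iInter_of_finite fun j => ?_
    by_cases hij : i = j
    · simp [hij]
    · simp only [hij, imp_false]
      exact (isClosed_eq (continuous_apply i) (continuous_apply j)).isOpen_compl
  exact h1.locallyCompactSpace

instance {G : Type*} [Group G] [MulAction G X] [ContinuousConstSMul G X] :
    ContinuousConstSMul G (Conf n X) where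
  continuous_const_smul g := Continuous.subtype_mk (p := Function.Injective)
    (f := fun x : {x : Fin n → X // Function.Injective x} => fun i => g • x.1 i)
    (continuous_pi fun i => ((continuous_apply i).comp continuous_subtype_val).const_smul g) _

end Conf

theorem isClosedMap_orbitRel_mk (G : Type*) [Group G] [Finite G] (P : Type*) [TopologicalSpace P]
    [MulAction G P] [ContinuousConstSMul G P] :
    IsClosedMap (Quotient.mk (MulAction.orbitRel G P)) := by
  intro F hF
  refine isQuotientMap_quotient_mk'.isClosed_preimage.mp ?_
  refine Eq.mpr (congrArg IsClosed (MulAction.quotient_preimage_image_eq_union_mul (G := G) F)) ?_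
  exact isClosed_iUnion_of_finite fun g => isClosedMap_smul g F hF

namespace EquivariantCW

open OrderType CompactSupportCohomology

namespace CubicalCells

universe u v w

variable {G : Type v} [Group G] {X : Type u} [TopologicalSpace X] [MulAction G X]
  {K : CubicalCells G X} {E : Type w} [Fintype E] {n : ℕ}

theorem isEmbedding_inclusion : Topology.IsEmbedding (inclusion X E n) :=
  Topology.IsEmbedding.prodMap (Topology.IsEmbedding.subtypeVal (p := Function.Injective))
    (Topology.IsEmbedding.subtypeVal (p := fun l : E → ℝ => (∀ e, 0 < l e) ∧ ∑ e, l e = 1))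

section Parametrization

variable {r : Label n K.C K.D E ℕ}

theorem rank_map_levels (hr : r.IsValid K.dim) {v : Cube (depth r.val)}
    (hv : v ∈ cubeInterior _) : (r.map (levels v)).rank 0 = r :=
  Label.ext rfl (rankOf_comp hr.isRank (levels_zero v) (strictMonoOn_levels hv))

theorem isReal_map_levels (hr : r.IsValid K.dim) {v : Cube (depth r.val)}
    (hv : v ∈ cubeInterior _) : K.IsReal (r.map (levels v)) where
  nonneg _ := levels_nonneg v _
  lt_one _ := levels_lt_one hv _
  isModel := (Label.isModel_rank_iff fun _ => levels_nonneg v _).mp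
    (by rw [rank_map_levels hr hv]; exact hr.isModel)

theorem continuous_realize_levels (hr : r.IsValid K.dim) :
    Continuous fun v : Cube (depth r.val) => K.realize (r.map (levels v)) := by
  refine Continuous.prodMk (continuous_pi fun i => (K.continuous_χ _).comp
    (continuous_pi fun a => continuous_levels _)) (continuous_pi fun e => ?_)
  refine Continuous.div (continuous_const.sub (continuous_levels _))
    (continuous_finsetSum _ fun e _ => continuous_const.sub (continuous_levels _)) fun v => ?_
  obtain ⟨e, he⟩ := hr.isModel.exists_l
  refine (Finset.sum_pos' (fun e _ => sub_nonneg.mpr (levels_le_one v _))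
    ⟨e, Finset.mem_univ e, ?_⟩).ne'
  change 0 < 1 - levels v (r.l e)
  rw [he, levels_zero]
  norm_num

theorem closedBox_levels (hr : r.IsValid K.dim) (v : Cube (depth r.val)) (i : Fin n) :
    ClosedBox (K.dim (r.cell i)) ((r.map (levels v)).u i) := by
  refine fun a => ⟨fun _ => ⟨levels_nonneg v _, levels_le_one v _⟩, fun ha => ?_⟩
  change levels v (r.u i a) = 0
  rw [(hr.isModel.u_eq_iff i a).mpr ha, levels_zero]

/-- All levels are values of the coordinates, so the coordinates determine the point of the cube. -/
theorem map_levels_injOn (hr : r.IsValid K.dim) {v v' : Cube (depth r.val)}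
    (hv : v ∈ cubeInterior _) (h : r.map (levels v) = r.map (levels v')) : v = v' := by
  refine levels_injOn hv fun k hk => ?_
  rcases Nat.eq_zero_or_pos k with rfl | hk0
  · rw [levels_zero, levels_zero]
  · obtain ⟨a, rfl⟩ := hr.isRank k hk0 hk
    exact congrFun (congrArg Label.val h) a

variable [Nonempty E]

theorem coord_cell (p : Conf n X × OpenSimplex E) (i : Fin n) :
    (K.coord p).cell i = K.cellOf (p.1.1 i) := by
  have h : K.χ ((K.coord p).cell i) ((K.coord p).u i) = p.1.1 i :=
    congrFun (congrArg Prod.fst (K.realize_coord p)) i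
  rw [← h, K.cellOf_χ ((K.isReal_coord p).openBox i)]

/-- On the boundary of the cube either a point of the configuration moves to a cell of smaller
dimension, or two levels coincide. -/
theorem stratumRank_lt (hr : r.IsValid K.dim) {v : Cube (depth r.val)} (hv : v ∉ cubeInterior _)
    {p : Conf n X × OpenSimplex E} (hp : inclusion X E n p = K.realize (r.map (levels v))) :
    K.stratumRank (K.typ p) < K.stratumRank r := by
  have hx : ∀ i, p.1.1 i = K.χ (r.cell i) ((r.map (levels v)).u i) := fun i =>
    congrFun (congrArg Prod.fst hp) i
  have hl : ∀ e, p.2.1 e = (1 - (r.map (levels v)).l e) / ∑ e', (1 - (r.map (levels v)).l e') :=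
    fun e => congrFun (congrArg Prod.snd hp) e
  -- if all points stay in their cells, no level is equal to `1`, and some coordinate of `v` is `1`
  by_cases hbox : ∀ i, OpenBox (K.dim (r.cell i)) ((r.map (levels v)).u i)
  · have hs : K.IsReal (r.map (levels v)) := by
      refine ⟨fun a => levels_nonneg v _, ?_, ?_, ?_, ?_⟩
      · rintro (⟨i, a⟩ | e)
        · by_cases ha : (a : ℕ) < K.dim (r.cell i)
          · exact ((hbox i a).1 ha).2
          · exact ((hbox i a).2 (not_lt.mp ha)).trans_lt zero_lt_one
        · refine lt_of_le_of_ne (levels_le_one v _) fun h => ?_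
          have h1 := hl e
          have h2 : (r.map (levels v)).l e = 1 := h
          rw [h2, sub_self, zero_div] at h1
          exact (p.2.2.1 e).ne' h1
      · intro i a
        refine ⟨fun h => ?_, (hbox i a).2⟩
        by_contra ha
        exact ((hbox i a).1 (not_le.mp ha)).1.ne' h
      · obtain ⟨e, he⟩ := hr.isModel.exists_l
        refine ⟨e, ?_⟩
        change levels v (r.l e) = 0
        rw [he, levels_zero]
      · intro i j hc hu
        refine p.1.2 ?_
        rw [hx, hx, hu]
        exact congrArg (fun c => K.χ c _) hc
    have hc := hs.coord_eq hp
    have hdepth : depth (rankOf 0 (levels v ∘ r.val)) < depth r.val := by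
      obtain ⟨j, hj⟩ := not_forall.mp hv
      have h1 : (v j : ℝ) ≠ 0 := by
        intro h0
        obtain ⟨a, ha⟩ := hr.isRank (depth r.val) (j.pos) le_rfl
        have h2 : levels v (r.val a) < 1 := hs.lt_one a
        rw [ha, levels_eq_one v h0] at h2
        exact lt_irrefl _ h2
      have h2 : (v j : ℝ) = 1 := by
        by_contra h3
        exact hj ⟨lt_of_le_of_ne (v j).2.1 h1.symm, lt_of_le_of_ne (v j).2.2 h3⟩
      refine depth_rankOf_comp_lt hr.isRank (levels_zero v) (fun a => levels_nonneg v _) j.2 ?_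
      have h3 := levels_succ v j.2
      rw [h2, mul_one] at h3
      linarith
    rw [typ, hc]
    exact Nat.add_lt_add_left hdepth _
  -- otherwise the total dimension drops, which outweighs any change in the number of levels
  · obtain ⟨i, hi⟩ := not_forall.mp hbox
    have hcell : ∀ i, (K.typ p).cell i = K.cellOf (K.χ (r.cell i) ((r.map (levels v)).u i)) :=
      fun i => by rw [← hx]; exact coord_cell p i
    have hsum : ∑ i, K.dim ((K.typ p).cell i) < ∑ i, K.dim (r.cell i) := by
      refine Finset.sum_lt_sum (fun i _ => ?_) ⟨i, Finset.mem_univ i, ?_⟩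
      · rw [hcell]
        exact K.dim_cellOf_le (closedBox_levels hr v i)
      · rw [hcell]
        exact K.dim_cellOf_lt (closedBox_levels hr v i) hi
    have hd : depth (K.typ p).val ≤ Fintype.card ((Fin n × Fin K.D) ⊕ E) :=
      Label.depth_le (isValid_typ p).isRank
    unfold stratumRank
    calc _ < (∑ i, K.dim ((K.typ p).cell i) + 1) * (Fintype.card ((Fin n × Fin K.D) ⊕ E) + 1) := by
          rw [add_mul]
          omega
      _ ≤ (∑ i, K.dim (r.cell i)) * (Fintype.card ((Fin n × Fin K.D) ⊕ E) + 1) :=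
          Nat.mul_le_mul_right _ hsum
      _ ≤ _ := Nat.le_add_right _ _

end Parametrization

variable [MulAction G E]

/-- Order types up to the action of `G`: the strata of the quotient. -/
abbrev Strata (K : CubicalCells G X) (E : Type w) [MulAction G E] (n : ℕ) : Type _ :=
  Quotient (MulAction.orbitRel G (Label n K.C K.D E ℕ))

/-- The permutation of the strata induced by a permutation of the points. -/
def permStrata (σ : Equiv.Perm (Fin n)) : Equiv.Perm (K.Strata E n) :=
  Quotient.congr (MulAction.toPerm σ) fun r r' => by
    simp only [MulAction.orbitRel_apply, MulAction.mem_orbit_iff]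
    refine exists_congr fun g => ?_
    change g • r' = r ↔ g • σ • r' = σ • r
    rw [Label.smul_perm_smul]
    exact (MulAction.injective σ).eq_iff.symm

/-- The dimension of a stratum. -/
def Strata.dim : K.Strata E n → ℕ :=
  Quotient.lift (fun r => depth r.val) (by
    rintro _ r ⟨g, rfl⟩
    exact Label.depth_smul g r)

/-- The rank of a stratum of the quotient. -/
def Strata.rank : K.Strata E n → ℕ :=
  Quotient.lift K.stratumRank (by
    rintro _ r ⟨g, rfl⟩
    exact K.stratumRank_smul g r)

open Classical in
variable (K E n) in
/-- The nonempty strata. -/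
def validStrata : Finset (K.Strata E n) :=
  (Label.finite_isValid (n := n) (D := K.D) (E := E) K.dim).toFinset.image (Quotient.mk _)

open Classical in
theorem mk_mem_validStrata {r : Label n K.C K.D E ℕ} :
    (Quotient.mk _ r : K.Strata E n) ∈ K.validStrata E n ↔ r.IsValid K.dim := by
  rw [validStrata, Finset.mem_image]
  constructor
  · rintro ⟨r', hr', h⟩
    obtain ⟨g, rfl⟩ := Quotient.exact h
    rw [Set.Finite.mem_toFinset] at hr'
    have := Label.IsValid.smul hr' K.dim_smul g⁻¹
    simpa using this
  · exact fun hr => ⟨r, (Set.Finite.mem_toFinset _).mpr hr, rfl⟩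

variable [Nonempty E]

/-- The stratum containing a point of the quotient. -/
def stratumOf : ConfSimplexQuotient G X E n → K.Strata E n :=
  Quotient.map K.typ (by
    rintro _ p ⟨g, rfl⟩
    exact ⟨g, (typ_smul g p).symm⟩)

theorem stratumOf_perm_smul (σ : Equiv.Perm (Fin n)) (y : ConfSimplexQuotient G X E n) :
    (stratumOf (σ • y) : K.Strata E n) = permStrata σ (stratumOf y) := by
  induction y using Quotient.inductionOn with
  | h p => exact congrArg (Quotient.mk _) (typ_perm_smul σ p)

/-- A permutation of the points fixes the strata that it maps to themselves pointwise. -/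
theorem perm_smul_eq_of_stratum {σ : Equiv.Perm (Fin n)} {y : ConfSimplexQuotient G X E n}
    (h : permStrata σ (stratumOf y : K.Strata E n) = stratumOf y) : σ • y = y := by
  induction y using Quotient.inductionOn with
  | h p =>
    obtain ⟨g, hg⟩ := Quotient.exact h
    change g • K.typ p = σ • K.typ p at hg
    have h1 : σ • g⁻¹ • K.typ p = K.typ p := by
      rw [← Label.smul_perm_smul, ← hg, inv_smul_smul]
    have h2 := Label.smul_smul_eq_of_rank (K.isReal_coord p).nonneg h1
    rw [← coord_smul, ← coord_perm_smul] at h2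
    have h3 := eq_of_coord_eq h2
    refine Quotient.sound ⟨g, ?_⟩
    have h4 : p = (σ • (g⁻¹ • p).1, (g⁻¹ • p).2) := h3.symm
    change g • p = (σ • p.1, p.2)
    conv_lhs => rw [h4]
    refine Prod.ext ?_ (smul_inv_smul g p.2)
    refine Subtype.ext (funext fun i => ?_)
    exact smul_inv_smul g (p.1.1 (σ⁻¹ i))

variable [T2Space X] [ContinuousConstSMul G X] [Finite G]

/-- The strata of the quotient are open cells. The order types of a stratum are only defined up to
the action of `G`, but an element of `G` that preserves an order type fixes all points having it, so the
parametrization by a cube stays injective in the quotient. -/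
theorem isStratification_stratumOf :
    IsStratification (stratumOf : ConfSimplexQuotient G X E n → K.Strata E n) Strata.rank
      Strata.dim (K.validStrata E n) := by
  have key : ∀ r : Label n K.C K.D E ℕ, r.IsValid K.dim → _ := fun r hr =>
    stratum_of_compact (g := fun v : Cube (depth r.val) => K.realize (r.map (levels v)))
      (continuous_realize_levels hr) (j := inclusion X E n) isEmbedding_inclusion
      (q := Quotient.mk (MulAction.orbitRel G (Conf n X × OpenSimplex E))) continuous_quotient_mk'
      (isClosedMap_orbitRel_mk G _) (typ := (stratumOf : _ → K.Strata E n)) (rk := Strata.rank)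
      (i := Quotient.mk _ r) (d := depth r.val) (U := cubeInterior (depth r.val))
      (fun v hv => (isReal_map_levels hr hv).exists_inclusion_eq)
      (fun v hv p hp => congrArg (Quotient.mk _) (by
        rw [typ, (isReal_map_levels hr hv).coord_eq hp, rank_map_levels hr hv]))
      (fun v hv p hp => stratumRank_lt hr hv hp)
      (by
        intro v hv v' hv' p p' hp hp' h
        obtain ⟨g, rfl⟩ := Quotient.exact h
        have h1 := (isReal_map_levels hr hv).coord_eq hp
        have h2 := (isReal_map_levels hr hv').coord_eq hp'
        change K.coord (g • p') = _ at h1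
        have h3 : g • r = r := by
          conv_rhs => rw [← rank_map_levels hr hv, ← h1, coord_smul, h2, Label.rank_smul,
            rank_map_levels hr hv']
        rw [coord_smul, h2, ← Label.map_smul, h3] at h1
        exact (map_levels_injOn hr hv h1.symm))
      (by
        intro p hp
        obtain ⟨g, hg⟩ := Quotient.exact hp
        change g • r = K.typ p at hg
        have h1 : K.typ (g⁻¹ • p) = r := by rw [typ_smul, ← hg, inv_smul_smul]
        have hs := K.isReal_coord (g⁻¹ • p)
        have h2 : rankOf 0 (K.coord (g⁻¹ • p)).val = r.val := congrArg Label.val h1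
        obtain ⟨t, ht0, ht, hty, -⟩ := exists_strictMonoOn (b := 0) hs.nonneg
        rw [h2] at ht hty
        obtain ⟨v, hv, hvt⟩ := exists_levels ht0 ht (by
          intro k hk
          rcases Nat.eq_zero_or_pos k with rfl | hk0
          · rw [ht0]
            exact zero_lt_one
          · obtain ⟨a, rfl⟩ := hr.isRank k hk0 hk
            exact (congrFun hty a).symm.trans_lt (hs.lt_one a))
        refine ⟨v, hv, g⁻¹ • p, ?_, Quotient.sound ⟨g⁻¹, rfl⟩⟩
        rw [← K.realize_coord]
        have hcell : (K.typ (g⁻¹ • p)).cell = r.cell := congrArg Label.cell h1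
        refine congrArg K.realize (Label.ext hcell ?_)
        exact hty.trans (funext fun a => (hvt _ (le_depth _ a)).symm))
      Quotient.mk_surjective (isCell_cubeInterior _)
  refine ⟨fun y => ?_, fun i => ?_, fun i => ?_⟩
  · induction y using Quotient.inductionOn with
    | h p => exact mk_mem_validStrata.mpr (isValid_typ p)
  · induction i using Quotient.inductionOn with
    | h r => exact fun hr => (key r (mk_mem_validStrata.mp hr)).2
  · induction i using Quotient.inductionOn with
    | h r => exact fun hr => (key r (mk_mem_validStrata.mp hr)).1

theorem hasFiniteHc_confSimplexQuotient (K : CubicalCells G X) (E : Type w) [Fintype E]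
    [Nonempty E] [MulAction G E] (n : ℕ) : HasFiniteHc (ConfSimplexQuotient G X E n) := by
  have := K.compactSpace
  have : T2Space (ConfSimplexQuotient G X E n) :=
    inferInstanceAs (T2Space (Quotient (MulAction.orbitRel G (Conf n X × OpenSimplex E))))
  have : LocallyCompactSpace (ConfSimplexQuotient G X E n) :=
    (MulAction.isOpenQuotientMap_quotientMk (Γ := G)
      (T := Conf n X × OpenSimplex E)).locallyCompactSpace
  exact (isStratification_stratumOf (K := K)).hasFiniteHc _ rfl

open Classical in
theorem lefschetzNumber_smul (K : CubicalCells G X) (E : Type w) [Fintype E]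
    [Nonempty E] [MulAction G E] (n : ℕ) (σ : Equiv.Perm (Fin n)) :
    lefschetzNumber (Homeomorph.smul σ : ConfSimplexQuotient G X E n ≃ₜ _) =
      ∑ i ∈ K.validStrata E n with permStrata σ i = i, (-1) ^ i.dim := by
  have := K.compactSpace
  have : T2Space (ConfSimplexQuotient G X E n) :=
    inferInstanceAs (T2Space (Quotient (MulAction.orbitRel G (Conf n X × OpenSimplex E))))
  have : LocallyCompactSpace (ConfSimplexQuotient G X E n) :=
    (MulAction.isOpenQuotientMap_quotientMk (Γ := G)
      (T := Conf n X × OpenSimplex E)).locallyCompactSpace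
  refine IsStratification.lefschetzNumber_eq (permStrata σ) (fun i => ?_) _ rfl
    (isStratification_stratumOf (K := K)) _ (stratumOf_perm_smul σ) (fun i => ?_)
    fun y => perm_smul_eq_of_stratum
  · induction i using Quotient.inductionOn with
    | h r => exact K.stratumRank_perm_smul σ r
  · induction i using Quotient.inductionOn with
    | h r =>
      refine mk_mem_validStrata.trans (Iff.trans ?_ mk_mem_validStrata.symm)
      change _ ↔ (σ • r).IsValid K.dim
      refine ⟨fun h => h.perm_smul σ, fun h => ?_⟩
      have := h.perm_smul σ⁻¹
      rwa [inv_smul_smul] at this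

end CubicalCells

end EquivariantCW

/-! ### Orbits of a permutation of a finite set -/

namespace PermOrbit

open Equiv.Perm

variable {A : Type*} [Fintype A]

/-- The set of orbits of a permutation. -/
abbrev Orb (τ : Equiv.Perm A) : Type _ := Quotient (SameCycle.setoid τ)

instance (τ : Equiv.Perm A) : Fintype (Orb τ) := Fintype.ofFinite _

/-- The orbit of an element. -/
abbrev orb (τ : Equiv.Perm A) (a : A) : Orb τ := Quotient.mk _ a

theorem orb_eq_iff {τ : Equiv.Perm A} {a b : A} : orb τ a = orb τ b ↔ τ.SameCycle a b :=
  Quotient.eq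

open Classical in
/-- The number of elements of an orbit. -/
def size {τ : Equiv.Perm A} (q : Orb τ) : ℕ := ({a | orb τ a = q} : Finset A).card

theorem size_pos {τ : Equiv.Perm A} (q : Orb τ) : 0 < size q := by
  classical
  induction q using Quotient.inductionOn with
  | h a => exact Finset.card_pos.mpr ⟨a, Finset.mem_filter.mpr ⟨Finset.mem_univ a, rfl⟩⟩

theorem size_orb_eq_one_iff {τ : Equiv.Perm A} {a : A} : size (orb τ a) = 1 ↔ τ a = a := by
  classical
  rw [size, Finset.card_eq_one]
  constructor
  · rintro ⟨b, hb⟩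
    have h1 : a ∈ ({b} : Finset A) := hb ▸ Finset.mem_filter.mpr ⟨Finset.mem_univ a, rfl⟩
    have h2 : τ a ∈ ({b} : Finset A) := hb ▸ Finset.mem_filter.mpr ⟨Finset.mem_univ _,
      orb_eq_iff.mpr (sameCycle_apply_left.mpr (SameCycle.refl τ a))⟩
    rw [Finset.mem_singleton] at h1 h2
    rw [h1] at h2 ⊢
    exact h2
  · intro h
    refine ⟨a, Finset.ext fun b => ?_⟩
    rw [Finset.mem_filter, Finset.mem_singleton, orb_eq_iff]
    constructor
    · rintro ⟨-, hb⟩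
      exact (hb.symm.eq_of_left h).symm
    · rintro rfl
      exact ⟨Finset.mem_univ _, SameCycle.refl _ _⟩

/-- The parts of the cycle type, fixed points included, are the sizes of the orbits. -/
theorem prod_parts_partition [DecidableEq A] {M : Type*} [CommMonoid M] (τ : Equiv.Perm A)
    (f : ℕ → M) : (τ.partition.parts.map f).prod = ∏ q : Orb τ, f (size q) := by
  classical
  rw [parts_partition, Multiset.map_add, Multiset.prod_add, Multiset.map_replicate,
    Multiset.prod_replicate, cycleType, Multiset.map_map,
    ← Finset.prod_filter_not_mul_prod_filter Finset.univ fun q : Orb τ => size q = 1]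
  have hsupp : ∀ a, size (orb τ a) ≠ 1 ↔ a ∈ τ.support := fun a => by
    rw [mem_support, Ne, size_orb_eq_one_iff]
  congr 1
  · let c : Orb τ → Equiv.Perm A := Quotient.lift (cycleOf τ) fun a b h => SameCycle.cycleOf_eq h
    refine (Finset.prod_bij (fun q _ => c q) (fun q hq => ?_) (fun q hq q' hq' h => ?_)
      (fun p hp => ?_) fun q hq => ?_).symm
    · induction q using Quotient.inductionOn with
      | h a =>
        exact cycleOf_mem_cycleFactorsFinset_iff.mpr ((hsupp a).mp (Finset.mem_filter.mp hq).2)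
    · induction q using Quotient.inductionOn with
      | h a =>
        induction q' using Quotient.inductionOn with
        | h b =>
          have ha := (hsupp a).mp (Finset.mem_filter.mp hq).2
          have hb := (hsupp b).mp (Finset.mem_filter.mp hq').2
          change cycleOf τ a = cycleOf τ b at h
          have h1 : b ∈ (cycleOf τ a).support := by
            rw [h, mem_support_cycleOf_iff]
            exact ⟨SameCycle.refl _ _, hb⟩
          exact orb_eq_iff.mpr (mem_support_cycleOf_iff.mp h1).1
    · obtain ⟨a, ha⟩ := (mem_cycleFactorsFinset_iff.mp hp).1.nonempty_support
      have h1 := cycle_is_cycleOf ha hp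
      have h2 := mem_cycleFactorsFinset_support_le hp ha
      exact ⟨orb τ a, Finset.mem_filter.mpr ⟨Finset.mem_univ _, (hsupp a).mpr h2⟩, h1.symm⟩
    · induction q using Quotient.inductionOn with
      | h a =>
        have ha := (hsupp a).mp (Finset.mem_filter.mp hq).2
        change f _ = f (cycleOf τ a).support.card
        refine congrArg (fun s : Finset A => f s.card) (Finset.ext fun b => ?_)
        rw [mem_support_cycleOf_iff, Finset.mem_filter]
        constructor
        · exact fun h => ⟨(orb_eq_iff.mp h.2).symm, ha⟩
        · exact fun h => ⟨Finset.mem_univ _, orb_eq_iff.mpr h.1.symm⟩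
  · rw [Finset.prod_congr rfl fun q hq => congrArg f (Finset.mem_filter.mp hq).2,
      Finset.prod_const]
    congr 1
    have h1 : τ.supportᶜ.card = Fintype.card A - τ.support.card := Finset.card_compl _
    rw [← h1]
    refine Finset.card_bij (fun a _ => orb τ a) (fun a ha => ?_) (fun a ha b hb h => ?_)
      fun q hq => ?_
    · rw [Finset.mem_compl, ← hsupp, not_not] at ha
      exact Finset.mem_filter.mpr ⟨Finset.mem_univ _, ha⟩
    · rw [Finset.mem_compl, ← hsupp, not_not] at ha
      obtain ⟨c, hc⟩ := Finset.card_eq_one.mp ha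
      have h1 : a ∈ ({c} : Finset A) := hc ▸ Finset.mem_filter.mpr ⟨Finset.mem_univ a, rfl⟩
      have h2 : b ∈ ({c} : Finset A) := hc ▸ Finset.mem_filter.mpr ⟨Finset.mem_univ b, h.symm⟩
      rw [Finset.mem_singleton] at h1 h2
      rw [h1, h2]
    · induction q using Quotient.inductionOn with
      | h a =>
        refine ⟨a, ?_, rfl⟩
        rw [Finset.mem_compl, ← hsupp, not_not]
        exact (Finset.mem_filter.mp hq).2

/-- The parity of the number of orbits is determined by the sign. -/
theorem neg_one_pow_card_orb [DecidableEq A] (τ : Equiv.Perm A) :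
    (-1 : ℚ) ^ Fintype.card (Orb τ) = (-1) ^ Fintype.card A * ((sign τ : ℤ) : ℚ) := by
  have h1 := prod_parts_partition τ fun _ => (-1 : ℚ)
  rw [Finset.prod_const, Finset.card_univ] at h1
  rw [← h1, Multiset.map_const', Multiset.prod_replicate, sign_of_cycleType]
  have h2 := τ.partition.parts_sum
  rw [parts_partition] at h2 ⊢
  simp only [Multiset.card_add, Multiset.card_replicate, Multiset.sum_add, Multiset.sum_replicate,
    smul_eq_mul, mul_one] at h2 ⊢
  push_cast
  rw [← pow_add]
  refine neg_one_pow_congr ?_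
  rw [Nat.even_iff, Nat.even_iff]
  omega

open Classical in
theorem card_filter_size (τ : Equiv.Perm A) (k : ℕ) :
    ({a | size (orb τ a) = k} : Finset A).card =
      ({q | size q = k} : Finset (Orb τ)).card * k := by
  rw [Finset.card_eq_sum_card_fiberwise (f := orb τ) (t := {q | size q = k}), ← smul_eq_mul,
    ← Finset.sum_const]
  · refine Finset.sum_congr rfl fun q hq => ?_
    rw [Finset.mem_filter] at hq
    rw [Finset.filter_filter]
    refine Eq.trans ?_ hq.2
    refine congrArg Finset.card (Finset.filter_congr fun a _ => ?_)
    exact ⟨fun h => h.2, fun h => ⟨h ▸ hq.2, h⟩⟩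
  · intro a ha
    simpa using ha

section Transport

variable {B : Type*} [Fintype B] {τ : Equiv.Perm A} {σ : Equiv.Perm B} {x : B ↪ A}

theorem zpow_apply_embedding (h : ∀ i, τ (x i) = x (σ i)) (k : ℤ) (i : B) :
    (τ ^ k) (x i) = x ((σ ^ k) i) := by
  have hn : ∀ (k : ℕ) (i : B), (τ ^ k) (x i) = x ((σ ^ k) i) := by
    intro k
    induction k with
    | zero => exact fun _ => rfl
    | succ k ih =>
      intro i
      rw [pow_succ, pow_succ, Equiv.Perm.mul_apply, h, ih, Equiv.Perm.mul_apply]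
  cases k with
  | ofNat k => exact hn k i
  | negSucc k =>
    rw [zpow_negSucc, zpow_negSucc, Equiv.Perm.inv_eq_iff_eq, hn, ← Equiv.Perm.mul_apply,
      mul_inv_cancel, Equiv.Perm.one_apply]

theorem orb_embedding_eq_iff (h : ∀ i, τ (x i) = x (σ i)) {i j : B} :
    orb τ (x i) = orb τ (x j) ↔ orb σ i = orb σ j := by
  rw [orb_eq_iff, orb_eq_iff]
  refine exists_congr fun k => ?_
  rw [zpow_apply_embedding h]
  exact x.injective.eq_iff

open Classical in
/-- The orbits met by the image of an embedding. -/
def image (τ : Equiv.Perm A) (x : B ↪ A) : Finset (Orb τ) :=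
  Finset.univ.image fun i => orb τ (x i)

/-- The image of an equivariant embedding is a union of orbits. -/
theorem orb_mem_image_iff (h : ∀ i, τ (x i) = x (σ i)) {a : A} :
    orb τ a ∈ image τ x ↔ a ∈ Set.range x := by
  classical
  rw [image, Finset.mem_image]
  constructor
  · rintro ⟨i, -, hi⟩
    obtain ⟨k, hk⟩ := orb_eq_iff.mp hi
    exact ⟨(σ ^ k) i, by rw [← hk, zpow_apply_embedding h]⟩
  · rintro ⟨i, rfl⟩
    exact ⟨i, Finset.mem_univ i, rfl⟩

theorem size_orb_embedding (h : ∀ i, τ (x i) = x (σ i)) (i : B) :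
    size (orb τ (x i)) = size (orb σ i) := by
  classical
  symm
  refine Finset.card_bij (fun j _ => x j) (fun j hj => ?_) (fun _ _ _ _ he => x.injective he)
    fun a ha => ?_
  · exact Finset.mem_filter.mpr ⟨Finset.mem_univ _,
      (orb_embedding_eq_iff h).mpr (Finset.mem_filter.mp hj).2⟩
  · have ha := (Finset.mem_filter.mp ha).2
    obtain ⟨j, rfl⟩ := (orb_mem_image_iff h (a := a)).mp
      (ha ▸ Finset.mem_image_of_mem _ (Finset.mem_univ i))
    exact ⟨j, Finset.mem_filter.mpr ⟨Finset.mem_univ _, (orb_embedding_eq_iff h).mp ha⟩, rfl⟩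

/-- An equivariant embedding identifies the orbits of `σ` with orbits of `τ` of the same sizes. -/
theorem prod_size_image {M : Type*} [CommMonoid M] (h : ∀ i, τ (x i) = x (σ i)) (f : ℕ → M) :
    ∏ q : Orb σ, f (size q) = ∏ q ∈ image τ x, f (size q) := by
  classical
  let φ : Orb σ → Orb τ := Quotient.lift (fun i => orb τ (x i)) fun i j hij =>
    (orb_embedding_eq_iff h).mpr (Quotient.sound hij)
  refine Finset.prod_bij (fun q _ => φ q) (fun q _ => ?_) (fun q _ q' _ hq => ?_) (fun q hq => ?_)
    fun q _ => ?_
  · induction q using Quotient.inductionOn with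
    | h i => exact Finset.mem_image_of_mem _ (Finset.mem_univ i)
  · induction q using Quotient.inductionOn with
    | h i =>
      induction q' using Quotient.inductionOn with
      | h j => exact (orb_embedding_eq_iff h).mp hq
  · obtain ⟨i, -, rfl⟩ := Finset.mem_image.mp hq
    exact ⟨orb σ i, Finset.mem_univ _, rfl⟩
  · induction q using Quotient.inductionOn with
    | h i => exact congrArg f (size_orb_embedding h i).symm

end Transport

open Classical in
theorem card_orb_mem (τ : Equiv.Perm A) (T : Finset (Orb τ)) :
    ({a | orb τ a ∈ T} : Finset A).card = ∑ q ∈ T, size q := by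
  rw [Finset.card_eq_sum_card_fiberwise (f := orb τ) (t := T) fun a ha => by simpa using ha]
  refine Finset.sum_congr rfl fun q hq => ?_
  rw [Finset.filter_filter]
  refine congrArg Finset.card (Finset.filter_congr fun a _ => ?_)
  exact ⟨fun h => h.2, fun h => ⟨h ▸ hq, h⟩⟩

theorem sum_size_image {n : ℕ} {τ : Equiv.Perm A} {σ : Equiv.Perm (Fin n)} {x : Fin n ↪ A}
    (h : ∀ i, τ (x i) = x (σ i)) : ∑ q ∈ image τ x, size q = n := by
  classical
  rw [← card_orb_mem]
  have h1 : ({a | orb τ a ∈ image τ x} : Finset A) = Finset.univ.map x := by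
    ext a
    rw [Finset.mem_filter, orb_mem_image_iff h]
    simp
  rw [h1, Finset.card_map, Finset.card_univ, Fintype.card_fin]

/-- An enumeration of a union of orbits transports `τ` to a unique permutation of the indices. -/
theorem card_equivariant_embeddings {n : ℕ} (τ : Equiv.Perm A) {T : Finset (Orb τ)}
    (hT : ∑ q ∈ T, size q = n) :
    Nat.card {y : Equiv.Perm (Fin n) × (Fin n ↪ A) //
      (∀ i, τ (y.2 i) = y.2 (y.1 i)) ∧ image τ y.2 = T} = n.factorial := by
  classical
  let S := {a // orb τ a ∈ T}
  have hS : ∀ a, orb τ a ∈ T ↔ orb τ (τ a) ∈ T := fun a => by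
    rw [orb_eq_iff.mpr (sameCycle_apply_left.mpr (SameCycle.refl τ a))]
  have hcard : Fintype.card S = n := by rw [Fintype.card_subtype, card_orb_mem, hT]
  let ρ : Equiv.Perm S := τ.subtypePerm fun a => (hS a).symm
  let F : (Fin n ≃ S) → {y : Equiv.Perm (Fin n) × (Fin n ↪ A) //
      (∀ i, τ (y.2 i) = y.2 (y.1 i)) ∧ image τ y.2 = T} := fun e =>
    ⟨((e.trans ρ).trans e.symm, e.toEmbedding.trans (Function.Embedding.subtype _)), fun i => by
      change τ (e i) = ((e (e.symm (ρ (e i))) : S) : A)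
      rw [Equiv.apply_symm_apply]
      rfl, by
      ext q
      rw [image, Finset.mem_image]
      constructor
      · rintro ⟨i, -, rfl⟩
        exact (e i).2
      · intro hq
        induction q using Quotient.inductionOn with
        | h a => exact ⟨e.symm ⟨a, hq⟩, Finset.mem_univ _, by
            change orb τ ((e (e.symm ⟨a, hq⟩) : S) : A) = _
            rw [Equiv.apply_symm_apply]⟩⟩
  have hF : Function.Bijective F := by
    constructor
    · intro e e' h
      have h2 := congrArg (fun y => y.1.2) h
      ext i
      exact DFunLike.congr_fun h2 i
    · rintro ⟨⟨σ, x⟩, hx, hT'⟩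
      have hr : ∀ a, orb τ a ∈ T ↔ a ∈ Set.range x := fun a => by
        rw [← hT']
        exact orb_mem_image_iff hx
      let e : Fin n ≃ S := Equiv.ofBijective (fun i => ⟨x i, (hr _).mpr ⟨i, rfl⟩⟩)
        ⟨fun i j hij => x.injective (congrArg Subtype.val hij), fun a => by
          obtain ⟨i, hi⟩ := (hr a.1).mp a.2
          exact ⟨i, Subtype.ext hi⟩⟩
      refine ⟨e, Subtype.ext (Prod.ext (Equiv.ext fun i => ?_) (DFunLike.ext _ _ fun i => rfl))⟩
      change e.symm (ρ (e i)) = σ i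
      rw [Equiv.symm_apply_eq]
      exact Subtype.ext (hx i)
  rw [← Nat.card_eq_of_bijective F hF, Nat.card_eq_fintype_card,
    Fintype.card_equiv (Fintype.equivFinOfCardEq hcard).symm, Fintype.card_fin]

open Classical in
/-- The Frobenius characteristic of the equivariant embeddings of `{1, …, n}` in a finite set with a
permutation `τ`, in terms of the `τ`-orbits. -/
theorem sum_card_equivariant_embeddings {R : Type*} [CommSemiring R] (n : ℕ) (τ : Equiv.Perm A)
    (f : ℕ → R) :
    ∑ σ : Equiv.Perm (Fin n),
      (Nat.card {x : Fin n ↪ A // ∀ i, τ (x i) = x (σ i)} : R) * (σ.partition.parts.map f).prod =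
    n.factorial * ∑ T : Finset (Orb τ) with ∑ q ∈ T, size q = n, ∏ q ∈ T, f (size q) := by
  let Z : Finset (Equiv.Perm (Fin n) × (Fin n ↪ A)) := {y | ∀ i, τ (y.2 i) = y.2 (y.1 i)}
  have h1 : ∀ σ : Equiv.Perm (Fin n),
      (Nat.card {x : Fin n ↪ A // ∀ i, τ (x i) = x (σ i)} : R) * (σ.partition.parts.map f).prod =
        ∑ x : Fin n ↪ A, if ∀ i, τ (x i) = x (σ i) then ∏ q ∈ image τ x, f (size q) else 0 := by
    intro σ
    rw [← Finset.sum_filter, Nat.card_eq_fintype_card, Fintype.card_subtype, ← nsmul_eq_mul,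
      ← Finset.sum_const]
    refine Finset.sum_congr rfl fun x hx => ?_
    rw [prod_parts_partition, prod_size_image (Finset.mem_filter.mp hx).2]
  rw [Finset.sum_congr rfl fun σ _ => h1 σ, ← Fintype.sum_prod_type', ← Finset.sum_filter]
  rw [← Finset.sum_fiberwise_of_maps_to (s := Z) (t := {T | ∑ q ∈ T, size q = n})
    (g := fun y => image τ y.2) fun y hy => ?_, Finset.mul_sum]
  · refine Finset.sum_congr rfl fun T hT => ?_
    rw [← card_equivariant_embeddings τ (Finset.mem_filter.mp hT).2, ← nsmul_eq_mul,
      Nat.card_eq_fintype_card, Fintype.card_subtype, ← Finset.sum_const, Finset.filter_filter]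
    refine Finset.sum_congr rfl fun y hy => ?_
    rw [(Finset.mem_filter.mp hy).2.2]
  · exact Finset.mem_filter.mpr ⟨Finset.mem_univ _, sum_size_image (Finset.mem_filter.mp hy).2⟩

end PermOrbit

/-! ### Power sums and binomial series -/

namespace SymmetricFunction

/-- All monomials of `f` have degree `n`. -/
def IsHomog (f : MvPowerSeries ℕ ℚ) (n : ℕ) : Prop :=
  ∀ d : ℕ →₀ ℕ, d.degree ≠ n → MvPowerSeries.coeff d f = 0

theorem isHomog_powerSum (k : ℕ) : IsHomog (powerSum k) k := by
  classical
  intro d hd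
  refine if_neg ?_
  rintro ⟨n, rfl⟩
  exact hd (by simp)

theorem isHomog_one : IsHomog 1 0 := by
  classical
  intro d hd
  rw [MvPowerSeries.coeff_one, if_neg]
  rintro rfl
  exact hd (by simp)

theorem IsHomog.mul {f g : MvPowerSeries ℕ ℚ} {m n : ℕ} (hf : IsHomog f m) (hg : IsHomog g n) :
    IsHomog (f * g) (m + n) := by
  classical
  intro d hd
  rw [MvPowerSeries.coeff_mul]
  refine Finset.sum_eq_zero fun p hp => ?_
  rw [Finset.HasAntidiagonal.mem_antidiagonal] at hp
  by_cases h1 : p.1.degree = m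
  · rw [hg p.2 fun h2 => hd (by rw [← hp, map_add, h1, h2]), mul_zero]
  · rw [hf p.1 h1, zero_mul]

theorem IsHomog.smul {f : MvPowerSeries ℕ ℚ} {n : ℕ} (hf : IsHomog f n) (c : ℚ) :
    IsHomog (c • f) n := fun d hd => by
  rw [MvPowerSeries.coeff_smul, hf d hd, mul_zero]

theorem IsHomog.sum {ι : Type*} {s : Finset ι} {f : ι → MvPowerSeries ℕ ℚ} {n : ℕ}
    (hf : ∀ i ∈ s, IsHomog (f i) n) : IsHomog (∑ i ∈ s, f i) n := fun d hd => by
  rw [map_sum]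
  exact Finset.sum_eq_zero fun i hi => hf i hi d hd

theorem isHomog_prod_powerSum (s : Multiset ℕ) : IsHomog (s.map powerSum).prod s.sum := by
  induction s using Multiset.induction with
  | empty => simpa using isHomog_one
  | cons k s ih =>
    rw [Multiset.map_cons, Multiset.prod_cons, Multiset.sum_cons]
    exact (isHomog_powerSum k).mul ih

theorem isHomog_powerSum_pow (k j : ℕ) : IsHomog (powerSum k ^ j) (j * k) := by
  have := isHomog_prod_powerSum (Multiset.replicate j k)
  simpa using this

theorem isHomog_finset_prod_powerSum {ι : Type*} (s : Finset ι) (k : ι → ℕ) :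
    IsHomog (∏ i ∈ s, powerSum (k i)) (∑ i ∈ s, k i) := by
  have := isHomog_prod_powerSum (s.val.map k)
  rwa [Multiset.map_map] at this

theorem hasSubst_powerSum {k : ℕ} (hk : 1 ≤ k) : PowerSeries.HasSubst (powerSum k) :=
  PowerSeries.HasSubst.of_constantCoeff_zero
    (isHomog_powerSum k 0 (by rw [map_zero]; omega))

theorem coeff_onePlusPow {k : ℕ} (hk : 1 ≤ k) (a : ℚ) (d : ℕ →₀ ℕ) :
    MvPowerSeries.coeff d (onePlusPow (powerSum k) a) =
      ∑ j ∈ Finset.range (d.degree + 1),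
        Ring.choose a j * MvPowerSeries.coeff d (powerSum k ^ j) := by
  rw [onePlusPow, PowerSeries.coeff_subst (hasSubst_powerSum hk),
    finsum_eq_sum_of_support_subset (s := Finset.range (d.degree + 1))]
  · refine Finset.sum_congr rfl fun j _ => ?_
    rw [PowerSeries.binomialSeries_coeff, smul_eq_mul, smul_eq_mul, mul_one]
  · intro j hj
    rw [Finset.coe_range, Set.mem_Iio]
    by_contra hlt
    refine hj ?_
    simp only
    rw [isHomog_powerSum_pow k j d, smul_zero]
    have := Nat.le_mul_of_pos_right j hk
    omega

theorem onePlusPow_natCast {k : ℕ} (hk : 1 ≤ k) (r : ℕ) :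
    onePlusPow (powerSum k) (r : ℚ) = (1 + powerSum k) ^ r := by
  have h := hasSubst_powerSum hk
  rw [onePlusPow, PowerSeries.binomialSeries_nat, PowerSeries.subst_pow h,
    PowerSeries.subst_add h, PowerSeries.subst_X h, ← PowerSeries.coe_substAlgHom h, map_one]

theorem onePlusPow_zero {k : ℕ} (hk : 1 ≤ k) : onePlusPow (powerSum k) 0 = 1 := by
  have := onePlusPow_natCast hk 0
  rwa [Nat.cast_zero, pow_zero] at this

/-! ### Polynomial dependence on a parameter -/

theorem exists_polynomial_choose (m : ℕ) :
    ∃ Q : Polynomial ℚ, ∀ a : ℚ, Q.eval a = Ring.choose a m := by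
  refine ⟨Polynomial.C ((m.factorial : ℚ)⁻¹) * (descPochhammer ℤ m).map (Int.castRingHom ℚ),
    fun a => ?_⟩
  have h := Ring.descPochhammer_eq_factorial_smul_choose a m
  rw [← Polynomial.aeval_eq_smeval, Polynomial.aeval_def, nsmul_eq_mul] at h
  rw [Polynomial.eval_mul, Polynomial.eval_C, Polynomial.eval_map,
    inv_mul_eq_iff_eq_mul₀ (Nat.cast_ne_zero.mpr m.factorial_ne_zero), ← h]
  rfl

/-- The reciprocity that turns counts of points in finite models into signs. -/
theorem choose_neg_one (m : ℕ) : Ring.choose (-1 : ℚ) m = (-1) ^ m := by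
  induction m with
  | zero => rw [Ring.choose_zero_right, pow_zero]
  | succ m ih =>
    have h := Ring.choose_succ_succ (-1 : ℚ) m
    rw [neg_add_cancel, Ring.choose_zero_succ, ih] at h
    rw [pow_succ]
    linarith

/-- The coefficients of the power series `F a` are polynomial functions of the parameter `a`. -/
def IsPolynomial (F : ℚ → MvPowerSeries ℕ ℚ) : Prop :=
  ∀ d, ∃ Q : Polynomial ℚ, ∀ a, MvPowerSeries.coeff d (F a) = Q.eval a

theorem isPolynomial_const (f : MvPowerSeries ℕ ℚ) : IsPolynomial fun _ => f := fun d =>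
  ⟨Polynomial.C (MvPowerSeries.coeff d f), fun _ => Polynomial.eval_C.symm⟩

theorem IsPolynomial.mul {F F' : ℚ → MvPowerSeries ℕ ℚ} (hF : IsPolynomial F)
    (hF' : IsPolynomial F') : IsPolynomial fun a => F a * F' a := by
  classical
  intro d
  choose Q hQ using hF
  choose Q' hQ' using hF'
  refine ⟨∑ p ∈ Finset.HasAntidiagonal.antidiagonal d, Q p.1 * Q' p.2, fun a => ?_⟩
  rw [MvPowerSeries.coeff_mul, Polynomial.eval_finsetSum]
  exact Finset.sum_congr rfl fun p _ => by rw [hQ, hQ', Polynomial.eval_mul]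

theorem IsPolynomial.prod {ι : Type*} (s : Finset ι) {F : ι → ℚ → MvPowerSeries ℕ ℚ}
    (hF : ∀ i ∈ s, IsPolynomial (F i)) : IsPolynomial fun a => ∏ i ∈ s, F i a := by
  classical
  induction s using Finset.induction_on with
  | empty =>
    simp only [Finset.prod_empty]
    exact isPolynomial_const 1
  | insert i s his ih =>
    simp only [Finset.prod_insert his]
    exact (hF i (Finset.mem_insert_self i s)).mul
      (ih fun j hj => hF j (Finset.mem_insert_of_mem hj))

theorem IsPolynomial.sum {ι : Type*} (s : Finset ι) {F : ι → ℚ → MvPowerSeries ℕ ℚ}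
    (hF : ∀ i ∈ s, IsPolynomial (F i)) : IsPolynomial fun a => ∑ i ∈ s, F i a := by
  classical
  intro d
  choose! Q hQ using fun i hi => hF i hi d
  refine ⟨∑ i ∈ s, Q i, fun a => ?_⟩
  rw [map_sum, Polynomial.eval_finsetSum]
  exact Finset.sum_congr rfl fun i hi => hQ i hi a

theorem isPolynomial_smul (Q : Polynomial ℚ) (f : MvPowerSeries ℕ ℚ) :
    IsPolynomial fun a => Q.eval a • f := fun d =>
  ⟨Q * Polynomial.C (MvPowerSeries.coeff d f), fun a => by
    rw [MvPowerSeries.coeff_smul, Polynomial.eval_mul, Polynomial.eval_C]⟩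

theorem isPolynomial_onePlusPow {k : ℕ} (hk : 1 ≤ k) (R : Polynomial ℚ) :
    IsPolynomial fun a => onePlusPow (powerSum k) (R.eval a) := by
  intro d
  choose Q hQ using exists_polynomial_choose
  refine ⟨∑ j ∈ Finset.range (d.degree + 1),
    (Q j).comp R * Polynomial.C (MvPowerSeries.coeff d (powerSum k ^ j)), fun a => ?_⟩
  rw [coeff_onePlusPow hk, Polynomial.eval_finsetSum]
  refine Finset.sum_congr rfl fun j _ => ?_
  rw [Polynomial.eval_mul, Polynomial.eval_C, Polynomial.eval_comp, hQ]

/-- Identities between series depending polynomially on a parameter may be checked at the natural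
numbers. -/
theorem IsPolynomial.coeff_eq {F F' : ℚ → MvPowerSeries ℕ ℚ} (hF : IsPolynomial F)
    (hF' : IsPolynomial F') {d : ℕ →₀ ℕ}
    (h : ∀ N : ℕ, MvPowerSeries.coeff d (F N) = MvPowerSeries.coeff d (F' N)) (a : ℚ) :
    MvPowerSeries.coeff d (F a) = MvPowerSeries.coeff d (F' a) := by
  obtain ⟨Q, hQ⟩ := hF d
  obtain ⟨Q', hQ'⟩ := hF' d
  have : Q = Q' := by
    refine Polynomial.eq_of_infinite_eval_eq Q Q'
      ((Set.infinite_range_of_injective (Nat.cast_injective (R := ℚ))).mono ?_)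
    rintro _ ⟨N, rfl⟩
    exact (hQ N).symm.trans ((h N).trans (hQ' N))
  rw [hQ, hQ', this]

/-! ### Equivariant embeddings and power sums -/

open PermOrbit

/-- The Frobenius characteristic of the equivariant embeddings of `{1, …, n}` in a finite set with a
permutation `τ` is the part of degree `n` of `∏ (1 + p_{|ω|})`, over the orbits `ω` of `τ`. -/
theorem coeff_prod_orbits {A : Type*} [Fintype A] (τ : Equiv.Perm A) (d : ℕ →₀ ℕ) :
    MvPowerSeries.coeff d (∏ q : Orb τ, (1 + powerSum (size q))) =
      MvPowerSeries.coeff d ((1 / (d.degree.factorial : ℚ)) • ∑ σ : Equiv.Perm (Fin d.degree),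
        (Nat.card {x : Fin d.degree ↪ A // ∀ i, τ (x i) = x (σ i)} : ℚ) •
          (σ.partition.parts.map powerSum).prod) := by
  classical
  have h := sum_card_equivariant_embeddings d.degree τ powerSum
  have h1 : ∀ (c : ℕ) (f : MvPowerSeries ℕ ℚ), (c : MvPowerSeries ℕ ℚ) * f = (c : ℚ) • f :=
    fun c f => by rw [← nsmul_eq_mul, Nat.cast_smul_eq_nsmul]
  simp only [h1] at h
  rw [h, smul_smul, one_div, inv_mul_cancel₀ (Nat.cast_ne_zero.mpr (Nat.factorial_ne_zero _)),
    one_smul, Finset.prod_one_add, Finset.powerset_univ, map_sum, map_sum, Finset.sum_filter]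
  refine Finset.sum_congr rfl fun T _ => ?_
  split_ifs with hT
  · rfl
  · exact isHomog_finset_prod_powerSum T _ d (Ne.symm hT)

/-- Collecting the orbits of the same size. The quotient in the exponent is the number of orbits. -/
theorem prod_orbits_eq {A : Type*} [Fintype A] (τ : Equiv.Perm A) {M : ℕ}
    (hM : ∀ q : Orb τ, size q ≤ M) :
    ∏ q : Orb τ, (1 + powerSum (size q)) = ∏ k ∈ Finset.Icc 1 M, onePlusPow (powerSum k)
      ((Nat.card {a // size (orb τ a) = k} : ℚ) / k) := by
  classical
  rw [← Finset.prod_fiberwise_of_maps_to (t := Finset.Icc 1 M) (g := size) fun q _ =>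
    Finset.mem_Icc.mpr ⟨size_pos q, hM q⟩]
  refine Finset.prod_congr rfl fun k hk => ?_
  have hk1 := (Finset.mem_Icc.mp hk).1
  have h1 : (Nat.card {a // size (orb τ a) = k} : ℚ) / k =
      (({q | size q = k} : Finset (Orb τ)).card : ℕ) := by
    rw [Nat.card_eq_fintype_card, Fintype.card_subtype, card_filter_size, Nat.cast_mul,
      mul_div_cancel_right₀]
    exact Nat.cast_ne_zero.mpr (by omega)
  rw [h1, onePlusPow_natCast hk1, ← Finset.prod_const]
  exact Finset.prod_congr rfl fun q hq => by rw [(Finset.mem_filter.mp hq).2]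

end SymmetricFunction

/-! ### Fixed orbits and fixed points -/

section Burnside

variable {G α I : Type*} [Group G] [Fintype G] [MulAction G α]

open Classical in
/-- If `f` commutes with the action and maps the orbit of `s₀` to itself, the number of pairs
`(g, s)` with `s` in the orbit and `f (g • s) = s` is the order of the group. -/
theorem sum_card_fixed_orbit {f : α → α} (hf : ∀ (g : G) s, f (g • s) = g • f s) {s₀ : α}
    (h₀ : f s₀ ∈ MulAction.orbit G s₀) {V : Finset α} (hV : ∀ s, s ∈ V ↔ s ∈ MulAction.orbit G s₀) :
    ∑ s ∈ V, ({g | f (g • s) = s} : Finset G).card = Fintype.card G := by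
  rw [← Finset.card_univ, Finset.card_eq_sum_card_fiberwise (f := fun g : G => g • s₀) (t := V)
    fun g _ => (hV _).mpr ⟨g, rfl⟩]
  refine Finset.sum_congr rfl fun s hs => ?_
  obtain ⟨h, rfl⟩ := (hV s).mp hs
  obtain ⟨k, hk⟩ := h₀
  change k • s₀ = f s₀ at hk
  refine Finset.card_equiv (Equiv.mulRight (h * k)) fun g => ?_
  simp only [Finset.mem_filter, Finset.mem_univ, true_and, Equiv.coe_mulRight, hf, ← hk, mul_smul]

open Classical in
/-- A weighted form of the orbit counting lemma for the orbits fixed by a commuting map. -/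
theorem card_mul_sum_fixed_orbits {V : Finset α} (hV : ∀ (g : G), ∀ s ∈ V, g • s ∈ V) {f : α → α}
    (hf : ∀ (g : G) s, f (g • s) = g • f s)
    (τ : Quotient (MulAction.orbitRel G α) → Quotient (MulAction.orbitRel G α))
    (hτ : ∀ s, τ (Quotient.mk _ s) = Quotient.mk _ (f s))
    (w : Quotient (MulAction.orbitRel G α) → ℚ) :
    (Fintype.card G : ℚ) * ∑ i ∈ V.image (Quotient.mk _) with τ i = i, w i =
      ∑ g : G, ∑ s ∈ V with f (g • s) = s, w (Quotient.mk _ s) := by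
  simp only [Finset.sum_filter]
  rw [Finset.sum_comm, Finset.mul_sum,
    ← Finset.sum_fiberwise_of_maps_to (g := Quotient.mk (MulAction.orbitRel G α))
      fun s hs => Finset.mem_image_of_mem _ hs]
  refine Finset.sum_congr rfl fun i hi => ?_
  have h1 : ∀ s, s ∈ V.filter (fun s => (Quotient.mk _ s : Quotient (MulAction.orbitRel G α)) = i) →
      ∑ g : G, (if f (g • s) = s then w (Quotient.mk _ s) else 0) =
        ({g | f (g • s) = s} : Finset G).card * w i := fun s hs => by
    rw [(Finset.mem_filter.mp hs).2, ← Finset.sum_filter, Finset.sum_const, nsmul_eq_mul]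
  rw [Finset.sum_congr rfl h1, ← Finset.sum_mul, ← Nat.cast_sum]
  obtain ⟨s₀, hs₀, rfl⟩ := Finset.mem_image.mp hi
  have hmem : ∀ s, s ∈ V.filter (fun s => (Quotient.mk _ s : Quotient (MulAction.orbitRel G α)) =
      Quotient.mk _ s₀) ↔ s ∈ MulAction.orbit G s₀ := by
    intro s
    rw [Finset.mem_filter, Quotient.eq, MulAction.orbitRel_apply]
    refine ⟨fun h => h.2, fun h => ⟨?_, h⟩⟩
    obtain ⟨g, rfl⟩ := h
    exact hV g s₀ hs₀
  split_ifs with h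
  · rw [hτ] at h
    rw [sum_card_fixed_orbit hf (Quotient.exact h) hmem]
  · rw [Finset.sum_eq_zero, Nat.cast_zero, zero_mul, mul_zero]
    intro s hs
    rw [Finset.card_eq_zero, Finset.filter_eq_empty_iff]
    intro g _ hg
    refine h ?_
    have h2 := (Finset.mem_filter.mp hs).2
    have h3 : (Quotient.mk _ (g • s) : Quotient (MulAction.orbitRel G α)) = Quotient.mk _ s :=
      Quotient.sound ⟨g, rfl⟩
    rw [← h2]
    conv_lhs => rw [← h3, hτ, hg]

end Burnside

/-! ### Finite models of the configuration spaces -/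

namespace PermOrbit

open Equiv.Perm

/-- The `g`-orbits of a permutation action are the orbits of the cyclic group generated by `g`. -/
theorem size_orb_toPerm {G A : Type*} [Group G] [Fintype A] [MulAction G A] (g : G) (a : A) :
    size (orb (MulAction.toPerm g : Equiv.Perm A) a) =
      (MulAction.orbit (Subgroup.zpowers g) a).ncard := by
  classical
  rw [size, ← Set.ncard_coe_finset]
  congr 1
  ext b
  rw [Finset.coe_filter, Set.mem_ofPred_eq, orb_eq_iff]
  have h : ∀ k : ℤ, ((MulAction.toPerm g : Equiv.Perm A) ^ k) = MulAction.toPerm (g ^ k) := fun k =>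
    ((MulAction.toPermHom G A).map_zpow g k).symm
  constructor
  · rintro ⟨-, hb⟩
    obtain ⟨k, hk⟩ := hb.symm
    rw [h] at hk
    exact ⟨⟨g ^ k, k, rfl⟩, hk⟩
  · rintro ⟨⟨_, k, rfl⟩, hb⟩
    refine ⟨Finset.mem_univ _, SameCycle.symm ⟨k, ?_⟩⟩
    rw [h]
    exact hb

theorem size_orb_toPerm_le {G A : Type*} [Group G] [Fintype G] [Fintype A] [MulAction G A] (g : G)
    (q : Orb (MulAction.toPerm g : Equiv.Perm A)) : size q ≤ Fintype.card G := by
  induction q using Quotient.inductionOn with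
  | h a =>
    refine (size_orb_toPerm g a).trans_le ?_
    rw [← Nat.card_coe_set_eq, ← Nat.card_eq_fintype_card]
    exact (Finite.card_range_le _).trans (Subgroup.card_le_card_group _)

/-- A function is invariant if and only if it is a function of the orbit. -/
def invariantEquiv {A W : Type*} (τ : Equiv.Perm A) :
    {y : A → W // ∀ a, y (τ a) = y a} ≃ (Quotient (SameCycle.setoid τ) → W) where
  toFun y := Quotient.lift y.1 (by
    have hn : ∀ (k : ℕ) a, y.1 ((τ ^ k) a) = y.1 a := by
      intro k
      induction k with
      | zero => exact fun _ => rfl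
      | succ k ih =>
        intro a
        rw [pow_succ, Equiv.Perm.mul_apply, ih, y.2]
    rintro a b ⟨k, rfl⟩
    cases k with
    | ofNat k => exact (hn k a).symm
    | negSucc k =>
      have h := hn (k + 1) ((τ ^ Int.negSucc k) a)
      rwa [zpow_negSucc, ← Equiv.Perm.mul_apply, mul_inv_cancel, Equiv.Perm.one_apply] at h)
  invFun z := ⟨fun a => z (Quotient.mk _ a), fun a =>
    congrArg z (Quotient.sound (sameCycle_apply_left.mpr (SameCycle.refl τ a)))⟩
  left_inv _ := rfl
  right_inv z := by
    funext q
    induction q using Quotient.inductionOn with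
    | h a => rfl

/-- The number of invariant functions with values in `{0, …, N}` that take the value `0`. -/
theorem card_invariant_exists_zero {A : Type*} [Fintype A] (τ : Equiv.Perm A) (N : ℕ) :
    (Nat.card {y : A → Fin (N + 1) // (∀ a, y (τ a) = y a) ∧ ∃ a, y a = 0} : ℚ) =
      ((N : ℚ) + 1) ^ Fintype.card (Orb τ) - (N : ℚ) ^ Fintype.card (Orb τ) := by
  classical
  let e : {y : A → Fin (N + 1) // (∀ a, y (τ a) = y a) ∧ ∃ a, y a = 0} ≃
      {z : Orb τ → Fin (N + 1) // ∃ q, z q = 0} :=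
    (Equiv.subtypeSubtypeEquivSubtypeInter _ _).symm.trans
      ((invariantEquiv τ).subtypeEquiv fun y => by
        constructor
        · rintro ⟨a, ha⟩
          exact ⟨Quotient.mk _ a, ha⟩
        · rintro ⟨q, hq⟩
          induction q using Quotient.inductionOn with
          | h a => exact ⟨a, hq⟩)
  have h1 := Fintype.card_subtype_compl fun z : Orb τ → Fin (N + 1) => ∃ q, z q = 0
  have h2 : Fintype.card {z : Orb τ → Fin (N + 1) // ¬ ∃ q, z q = 0} =
      N ^ Fintype.card (Orb τ) := by
    simp only [not_exists]
    rw [Fintype.card_congr (Equiv.subtypePiEquivPi (p := fun _ (w : Fin (N + 1)) => ¬ w = 0)),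
      Fintype.card_fun, Fintype.card_subtype_compl, Fintype.card_fin, Fintype.card_subtype_eq]
    rfl
  have h3 : Fintype.card {z : Orb τ → Fin (N + 1) // ∃ q, z q = 0} ≤
      Fintype.card (Orb τ → Fin (N + 1)) := Fintype.card_subtype_le _
  rw [h2, Fintype.card_fun, Fintype.card_fin] at h1
  rw [Fintype.card_fun, Fintype.card_fin] at h3
  have h4 : Fintype.card {z : Orb τ → Fin (N + 1) // ∃ q, z q = 0} + N ^ Fintype.card (Orb τ) =
      (N + 1) ^ Fintype.card (Orb τ) := by omega
  rw [Nat.card_congr e, Nat.card_eq_fintype_card, eq_sub_iff_add_eq]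
  exact_mod_cast h4

end PermOrbit

namespace EquivariantCW

open OrderType PermOrbit

/-- The finite model of the cell complex: each cell of dimension `m` is replaced by the set
`{1, …, N}^m`, padded by zeros to a set of `D`-tuples. -/
def Model {C : Type*} (dim : C → ℕ) (D N : ℕ) : Type _ :=
  {p : C × (Fin D → Fin (N + 1)) // ∀ a, p.2 a = 0 ↔ dim p.1 ≤ a}

namespace Model

variable {C : Type*} {dim : C → ℕ} {D N : ℕ}

instance [Fintype C] : Fintype (Model dim D N) :=
  letI := Classical.decPred fun p : C × (Fin D → Fin (N + 1)) => ∀ a, p.2 a = 0 ↔ dim p.1 ≤ a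
  inferInstanceAs (Fintype
    {p : C × (Fin D → Fin (N + 1)) // ∀ a, p.2 a = 0 ↔ dim p.1 ≤ a})

theorem card_fiber {c : C} (hc : dim c ≤ D) :
    Nat.card {z : Fin D → Fin (N + 1) // ∀ a, z a = 0 ↔ dim c ≤ a} = N ^ dim c := by
  classical
  rw [Nat.card_congr (Equiv.subtypePiEquivPi
    (p := fun (a : Fin D) (w : Fin (N + 1)) => w = 0 ↔ dim c ≤ a)), Nat.card_pi]
  have h : ∀ a : Fin D, Nat.card {w : Fin (N + 1) // w = 0 ↔ dim c ≤ a} =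
      if (a : ℕ) < dim c then N else 1 := by
    intro a
    rw [Nat.card_eq_fintype_card]
    split_ifs with ha
    · simp only [not_le.mpr ha, iff_false]
      rw [Fintype.card_subtype_compl, Fintype.card_fin, Fintype.card_subtype_eq]
      rfl
    · simp only [not_lt.mp ha, iff_true]
      exact Fintype.card_subtype_eq _
  rw [Finset.prod_congr rfl fun a _ => h a, Finset.prod_ite, Finset.prod_const,
    Finset.prod_const_one, mul_one]
  congr 1
  rw [Fin.card_filter_val_lt, min_eq_right hc]

variable {G : Type*} [Group G] [MulAction G C]

/-- The action on the finite model induced by an action on the cells that preserves the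
dimensions. -/
@[reducible]
def mulAction (hdim : ∀ (g : G) (c : C), dim (g • c) = dim c) : MulAction G (Model dim D N) where
  smul g p := ⟨(g • p.1.1, p.1.2), fun a => by rw [hdim]; exact p.2 a⟩
  one_smul p := Subtype.ext (Prod.ext (one_smul G p.1.1) rfl)
  mul_smul g g' p := Subtype.ext (Prod.ext (mul_smul g g' p.1.1) rfl)

open Classical in
/-- The points of the finite model with orbits of length `k` lie in the cells with orbits of length
`k`, since the action does not change coordinates. -/
theorem card_orbit_size [Fintype C] (hdim : ∀ (g : G) (c : C), dim (g • c) = dim c)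
    (hD : ∀ c, dim c ≤ D) (g : G) (k : ℕ) :
    letI := mulAction (D := D) (N := N) hdim
    Nat.card {p : Model dim D N // size (orb (MulAction.toPerm g) p) = k} =
      ∑ c : C with (MulAction.orbit (Subgroup.zpowers g) c).ncard = k, N ^ dim c := by
  let := mulAction (D := D) (N := N) hdim
  have h1 : ∀ p : Model dim D N, size (orb (MulAction.toPerm g) p) =
      (MulAction.orbit (Subgroup.zpowers g) p.1.1).ncard := by
    intro p
    rw [size_orb_toPerm]
    refine (ncard_orbit_eq (φ := fun p : Model dim D N => p.1.1) (fun _ => rfl) ?_).symm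
    rintro _ ⟨h, rfl⟩ _ ⟨h', rfl⟩ hc
    exact Subtype.ext (Prod.ext hc rfl)
  let e : {p : Model dim D N // size (orb (MulAction.toPerm g) p) = k} ≃
      Σ c : {c : C // (MulAction.orbit (Subgroup.zpowers g) c).ncard = k},
        {z : Fin D → Fin (N + 1) // ∀ a, z a = 0 ↔ dim c.1 ≤ a} :=
    { toFun := fun p => ⟨⟨p.1.1.1, (h1 p.1).symm.trans p.2⟩, ⟨p.1.1.2, p.1.2⟩⟩
      invFun := fun q => ⟨⟨(q.1.1, q.2.1), q.2.2⟩, (h1 _).trans q.1.2⟩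
      left_inv := fun _ => rfl
      right_inv := fun _ => rfl }
  rw [Nat.card_congr e, Nat.card_sigma, Finset.sum_congr rfl fun c _ => card_fiber (hD c.1)]
  exact (Finset.sum_subtype _ (fun c => by simp) fun c => N ^ dim c).symm

end Model

end EquivariantCW

/-! ### The generating series of labels -/

namespace Label

open OrderType PermOrbit EquivariantCW

variable {n : ℕ} {C : Type*} {D : ℕ} {E : Type*} {W W' : Type*} {G : Type*} [Group G]
  [MulAction G C] [MulAction G E] {dim : C → ℕ}

theorem isModel_map_iff {f : W → W'} (hf : Function.Injective f) {b : W}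
    {t : Label n C D E W} : (t.map f).IsModel dim (f b) ↔ t.IsModel dim b := by
  have hu : ∀ i j, (t.map f).u i = (t.map f).u j ↔ t.u i = t.u j := fun i j =>
    ⟨fun h => funext fun a => hf (congrFun h a), fun h => funext fun a => congrArg f (congrFun h a)⟩
  constructor
  · rintro ⟨h1, ⟨e, he⟩, h3⟩
    exact ⟨fun i a => hf.eq_iff.symm.trans (h1 i a), ⟨e, hf he⟩,
      fun i j hc h => h3 i j hc ((hu i j).mpr h)⟩
  · rintro ⟨h1, ⟨e, he⟩, h3⟩
    exact ⟨fun i a => hf.eq_iff.trans (h1 i a), ⟨e, congrArg f he⟩,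
      fun i j hc h => h3 i j hc ((hu i j).mp h)⟩

theorem map_injective {f : W → W'} (hf : Function.Injective f) :
    Function.Injective (map f : Label n C D E W → Label n C D E W') := fun s t h =>
  have hc : (s.map f).cell = (t.map f).cell := congrArg Label.cell h
  Label.ext hc (funext fun a => hf (congrFun (congrArg Label.val h) a))

theorem smul_smul_eq_iff {g : G} {σ : Equiv.Perm (Fin n)} {t : Label n C D E W} :
    σ • g • t = t ↔ (∀ i, g • t.cell i = t.cell (σ i)) ∧ (∀ i a, t.u i a = t.u (σ i) a) ∧
      ∀ e, t.l (g • e) = t.l e := by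
  rw [ext_iff']
  refine and_congr ?_ (and_congr ?_ ?_)
  · refine ⟨fun h i => ?_, fun h i => ?_⟩
    · have h' : g • t.cell (σ.symm (σ i)) = t.cell (σ i) := h (σ i)
      rwa [Equiv.symm_apply_apply] at h'
    · have h' := h (σ.symm i)
      rwa [Equiv.apply_symm_apply] at h'
  · refine ⟨fun h i a => ?_, fun h i a => ?_⟩
    · have h' : t.u (σ.symm (σ i)) a = t.u (σ i) a := h (σ i) a
      rwa [Equiv.symm_apply_apply] at h'
    · have h' := h (σ.symm i) a
      rwa [Equiv.apply_symm_apply] at h'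
  · refine ⟨fun h e => ?_, fun h e => ?_⟩
    · have h' : t.l (g⁻¹ • g • e) = t.l (g • e) := h (g • e)
      rw [inv_smul_smul] at h'
      exact h'.symm
    · have h' := h (g⁻¹ • e)
      rw [smul_inv_smul] at h'
      exact h'.symm

/-- The labels with values in `{0, …, N}` fixed by a symmetry are pairs of an equivariant embedding
in the finite model and an invariant function on `E`. -/
theorem card_fixed_models (hdim : ∀ (g : G) (c : C), dim (g • c) = dim c) (N : ℕ) (g : G)
    (σ : Equiv.Perm (Fin n)) :
    letI := Model.mulAction (D := D) (N := N) hdim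
    Nat.card {t : Label n C D E (Fin (N + 1)) // t.IsModel dim 0 ∧ σ • g • t = t} =
      Nat.card {x : Fin n ↪ Model dim D N //
        ∀ i, (MulAction.toPerm g : Equiv.Perm (Model dim D N)) (x i) = x (σ i)} *
      Nat.card {y : E → Fin (N + 1) //
        (∀ e, y ((MulAction.toPerm g : Equiv.Perm E) e) = y e) ∧ ∃ e, y e = 0} := by
  let := Model.mulAction (D := D) (N := N) hdim
  rw [← Nat.card_prod]
  refine Nat.card_congr
    { toFun := fun t => ⟨⟨⟨fun i => ⟨(t.1.cell i, t.1.u i), t.2.1.u_eq_iff i⟩, fun i j h => ?_⟩,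
        fun i => ?_⟩, ⟨t.1.l, (smul_smul_eq_iff.mp t.2.2).2.2, t.2.1.exists_l⟩⟩
      invFun := fun q => ⟨⟨fun i => (q.1.1 i).1.1,
        Sum.elim (fun p => (q.1.1 p.1).1.2 p.2) q.2.1⟩, ?_, ?_⟩
      left_inv := fun t => Subtype.ext (ext_iff'.mpr
        ⟨fun _ => rfl, fun _ _ => rfl, fun _ => rfl⟩)
      right_inv := fun _ => rfl }
  · have h' := congrArg Subtype.val h
    exact t.2.1.injective i j (congrArg Prod.fst h') (congrArg Prod.snd h')
  · obtain ⟨h1, h2, -⟩ := smul_smul_eq_iff.mp t.2.2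
    exact Subtype.ext (Prod.ext (h1 i) (funext fun a => h2 i a))
  · exact ⟨fun i a => (q.1.1 i).2 a, q.2.2.2, fun i j hc hu =>
      q.1.1.injective (Subtype.ext (Prod.ext hc hu))⟩
  · have h : ∀ i, (g • (q.1.1 i).1.1, (q.1.1 i).1.2) = (q.1.1 (σ i)).1 := fun i =>
      congrArg Subtype.val (q.1.2 i)
    exact smul_smul_eq_iff.mpr ⟨fun i => congrArg Prod.fst (h i),
      fun i a => congrFun (congrArg Prod.snd (h i)) a, q.2.2.1⟩

open Classical in
/-- Counting the labels with values in `{0, …, N}` by their order types. -/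
theorem sum_choose_depth [Fintype C] [Fintype E] (N : ℕ) (g : G) (σ : Equiv.Perm (Fin n)) :
    ∑ r ∈ (finite_isValid (n := n) (D := D) (E := E) dim).toFinset with σ • g • r = r,
      N.choose (depth r.val) =
    Nat.card {t : Label n C D E (Fin (N + 1)) // t.IsModel dim 0 ∧ σ • g • t = t} := by
  let T := {t : Label n C D E (Fin (N + 1)) // t.IsModel dim 0 ∧ σ • g • t = t}
  let V := (finite_isValid (n := n) (D := D) (E := E) dim).toFinset.filter fun r => σ • g • r = r
  have h0 : ∀ t : Label n C D E (Fin (N + 1)), ∀ a, 0 ≤ (t.map Fin.val).val a :=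
    fun _ _ => Nat.zero_le _
  have hV : ∀ r, r ∈ V ↔ r.IsValid dim ∧ σ • g • r = r := fun r => by
    rw [Finset.mem_filter, Set.Finite.mem_toFinset, Set.mem_ofPred_eq]
  let φ : T → V := fun t => ⟨rank 0 (t.1.map Fin.val), (hV _).mpr
    ⟨isValid_rank (h0 t.1) ((isModel_map_iff Fin.val_injective).mpr t.2.1), by
      rw [← rank_smul, ← rank_perm_smul, ← map_smul, ← map_perm_smul, t.2.2]⟩⟩
  have hfib : ∀ r : V, Nat.card {t : T // φ t = r} = N.choose (depth r.1.val) := by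
    intro r
    obtain ⟨hr, hfix⟩ := (hV r.1).mp r.2
    rw [← card_rankOf_eq N hr.isRank]
    refine Nat.card_congr
      { toFun := fun t => ⟨t.1.1.val, congrArg (fun s : V => s.1.val) t.2⟩
        invFun := fun y =>
          have he : rank 0 ((⟨r.1.cell, y.1⟩ : Label n C D E (Fin (N + 1))).map Fin.val) = r.1 :=
            Label.ext rfl y.2
          ⟨⟨⟨r.1.cell, y.1⟩, (isModel_map_iff Fin.val_injective).mp
            ((isModel_rank_iff (h0 _)).mp (by rw [he]; exact hr.isModel)),
            map_injective Fin.val_injective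
              (smul_smul_eq_of_rank (h0 ⟨r.1.cell, y.1⟩) (by rw [he]; exact hfix))⟩,
            Subtype.ext he⟩
        left_inv := fun t => ?_
        right_inv := fun _ => rfl }
    refine Subtype.ext (Subtype.ext (Label.ext ?_ rfl))
    exact (congrArg (fun s : V => s.1.cell) t.2).symm
  have hfin : ∀ r : V, Finite {t : T // φ t = r} := fun r => by
    have : Finite T := Finite.of_injective
      (fun t : T => (t.1.cell, t.1.val)) fun s t h =>
        Subtype.ext (Label.ext (congrArg Prod.fst h) (congrArg Prod.snd h))
    infer_instance
  change ∑ r ∈ V, N.choose (depth r.val) = Nat.card T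
  rw [Nat.card_congr (Equiv.sigmaFiberEquiv φ).symm, Nat.card_sigma,
    Finset.sum_congr rfl fun r _ => hfib r]
  exact (Finset.sum_coe_sort V fun r => N.choose (depth r.val)).symm

end Label

namespace EquivariantCW

open OrderType PermOrbit SymmetricFunction CompactSupportCohomology

namespace CubicalCells

universe u v w

variable {G : Type v} [Group G] [Fintype G] {X : Type u} [TopologicalSpace X] [MulAction G X]
  (K : CubicalCells G X) (E : Type w) [Fintype E] [MulAction G E]

open Classical in
/-- The contribution of an element of `G` to the equivariant Euler characteristic is the value at
`a = -1` of this series; the values at `a = N` are given by the finite models. -/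
def labelSeries (n : ℕ) (g : G) (a : ℚ) : MvPowerSeries ℕ ℚ :=
  (1 / (n.factorial : ℚ)) • ∑ σ : Equiv.Perm (Fin n),
    (∑ r ∈ (Label.finite_isValid (n := n) (D := K.D) (E := E) K.dim).toFinset with σ • g • r = r,
      Ring.choose a (depth r.val)) • (σ.partition.parts.map powerSum).prod

open Classical in
/-- The number of cells of orbit length `k`, weighted by `a ^ dim`. -/
def weightedCells (g : G) (k : ℕ) (a : ℚ) : ℚ :=
  ∑ c : K.C with (MulAction.orbit (Subgroup.zpowers g) c).ncard = k, a ^ K.dim c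

/-- The product formula for the sum of the series `labelSeries`. -/
def productSeries (g : G) (a : ℚ) : MvPowerSeries ℕ ℚ :=
  ((a + 1) ^ Fintype.card (Orb (MulAction.toPerm g : Equiv.Perm E)) -
      a ^ Fintype.card (Orb (MulAction.toPerm g : Equiv.Perm E))) •
    ∏ k ∈ Finset.Icc 1 (Fintype.card G), onePlusPow (powerSum k) (K.weightedCells g k a / k)

theorem isPolynomial_labelSeries (n : ℕ) (g : G) : IsPolynomial (K.labelSeries E n g) := by
  classical
  choose Q hQ using exists_polynomial_choose
  have h : IsPolynomial fun a => ∑ σ : Equiv.Perm (Fin n),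
      (Polynomial.C (1 / (n.factorial : ℚ)) * ∑ r ∈ (Label.finite_isValid (n := n) (D := K.D)
        (E := E) K.dim).toFinset with σ • g • r = r, Q (depth r.val)).eval a •
          (σ.partition.parts.map powerSum).prod :=
    IsPolynomial.sum _ fun σ _ => isPolynomial_smul _ _
  refine Eq.mpr (congrArg IsPolynomial (funext fun a => ?_)) h
  simp only [labelSeries, Polynomial.eval_mul, Polynomial.eval_C, Polynomial.eval_finsetSum, hQ,
    Finset.smul_sum, smul_smul]

theorem isPolynomial_productSeries (g : G) : IsPolynomial (K.productSeries E g) := by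
  classical
  let o := Fintype.card (Orb (MulAction.toPerm g : Equiv.Perm E))
  let R : ℕ → Polynomial ℚ := fun k => Polynomial.C ((k : ℚ)⁻¹) *
    ∑ c : K.C with (MulAction.orbit (Subgroup.zpowers g) c).ncard = k, Polynomial.X ^ K.dim c
  have h := (isPolynomial_smul ((Polynomial.X + 1) ^ o - Polynomial.X ^ o) 1).mul
    (IsPolynomial.prod (Finset.Icc 1 (Fintype.card G)) fun k hk =>
      isPolynomial_onePlusPow (Finset.mem_Icc.mp hk).1 (R k))
  have hR : ∀ k a, (R k).eval a = K.weightedCells g k a / k := fun k a => by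
    simp only [R, weightedCells, Polynomial.eval_mul, Polynomial.eval_C, Polynomial.eval_finsetSum,
      Polynomial.eval_pow, Polynomial.eval_X]
    rw [div_eq_inv_mul]
  refine Eq.mpr (congrArg IsPolynomial (funext fun a => ?_)) h
  simp only [productSeries, hR, Polynomial.eval_sub, Polynomial.eval_pow, Polynomial.eval_add,
    Polynomial.eval_X, Polynomial.eval_one, smul_one_mul]
  rfl

/-- On the finite models the identity is the orbit formula for equivariant embeddings. -/
theorem coeff_labelSeries_natCast (g : G) (N : ℕ) (d : ℕ →₀ ℕ) :
    MvPowerSeries.coeff d (K.labelSeries E d.degree g N) =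
      MvPowerSeries.coeff d (K.productSeries E g N) := by
  classical
  let := Model.mulAction (D := K.D) (N := N) K.dim_smul
  let τ : Equiv.Perm (Model K.dim K.D N) := MulAction.toPerm g
  have h1 : ∀ k, (Nat.card {p // size (orb τ p) = k} : ℚ) = K.weightedCells g k N := by
    intro k
    rw [Model.card_orbit_size K.dim_smul K.dim_le g k, weightedCells]
    push_cast
    rfl
  have h2 := prod_orbits_eq τ (size_orb_toPerm_le g)
  simp only [h1] at h2
  rw [productSeries, ← h2, MvPowerSeries.coeff_smul, coeff_prod_orbits, labelSeries,
    ← PermOrbit.card_invariant_exists_zero, ← MvPowerSeries.coeff_smul, smul_comm]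
  congr 2
  rw [Finset.smul_sum]
  refine Finset.sum_congr rfl fun σ _ => ?_
  rw [smul_smul]
  congr 1
  simp only [Ring.choose_natCast]
  rw [← Nat.cast_sum, Label.sum_choose_depth, Label.card_fixed_models K.dim_smul, Nat.cast_mul,
    mul_comm]

/-- Both sides are polynomial in `a`, so the identity for the finite models extends to all `a`. -/
theorem coeff_labelSeries (g : G) (a : ℚ) (d : ℕ →₀ ℕ) :
    MvPowerSeries.coeff d (K.labelSeries E d.degree g a) =
      MvPowerSeries.coeff d (K.productSeries E g a) :=
  (K.isPolynomial_labelSeries E d.degree g).coeff_eq (K.isPolynomial_productSeries E g)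
    (fun N => K.coeff_labelSeries_natCast E g N d) a

theorem isHomog_labelSeries (n : ℕ) (g : G) (a : ℚ) : IsHomog (K.labelSeries E n g a) n := by
  refine IsHomog.smul (IsHomog.sum fun σ _ => IsHomog.smul ?_ _) _
  have h := isHomog_prod_powerSum σ.partition.parts
  rw [σ.partition.parts_sum] at h
  exact fun d hd => h d (by rwa [Fintype.card_fin])

/-- The series indexed by `n` is homogeneous of degree `n`, so the sum converges to `productSeries`,
whose part of degree `n` it is. -/
theorem hasSum_labelSeries (g : G) (a : ℚ) :
    HasSum (fun n => K.labelSeries E n g a) (K.productSeries E g a) := by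
  rw [MvPowerSeries.WithPiTopology.hasSum_iff_hasSum_coeff]
  intro d
  rw [← coeff_labelSeries]
  exact hasSum_single d.degree fun n hn => K.isHomog_labelSeries E n g a d hn.symm

end CubicalCells

end EquivariantCW

/-! ### The equivariant Euler characteristic of the quotient -/

namespace SymmetricFunction

open CompactSupportCohomology GradedTrace

/-- The equivariant Euler characteristic in terms of Lefschetz numbers. The group element `σ` acts
on cohomology by `(σ⁻¹)^*`. -/
theorem equivariantChiC_eq (n : ℕ) {Y : Type*} [TopologicalSpace Y]
    [MulAction (Equiv.Perm (Fin n)) Y] [ContinuousConstSMul (Equiv.Perm (Fin n)) Y]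
    (hY : HasFiniteHc Y) :
    equivariantChiC n Y = (1 / (n.factorial : ℚ)) • ∑ σ : Equiv.Perm (Fin n),
      lefschetzNumber (Homeomorph.smul σ⁻¹ : Y ≃ₜ Y) • (σ.partition.parts.map powerSum).prod := by
  obtain ⟨-, N, hN⟩ := hY
  have h1 : ∀ p, N ≤ p → frobeniusChar (Hc.rep (Equiv.Perm (Fin n)) Y p) = 0 := by
    intro p hp
    have := hN p hp
    rw [frobeniusChar, Finset.sum_eq_zero, smul_zero]
    intro σ _
    rw [Subsingleton.elim (Hc.rep (Equiv.Perm (Fin n)) Y p σ) 0, map_zero, zero_smul]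
  rw [equivariantChiC, finsum_eq_sum_of_support_subset (s := Finset.range N)]
  · simp only [frobeniusChar, smul_comm _ (1 / (n.factorial : ℚ)), ← Finset.smul_sum]
    congr 1
    simp only [Finset.smul_sum, smul_smul]
    rw [Finset.sum_comm]
    refine Finset.sum_congr rfl fun σ _ => ?_
    rw [← Finset.sum_smul, lefschetzNumber, lefschetz_eq_sum_range _ hN]
    rfl
  · intro p hp
    rw [Finset.coe_range, Set.mem_Iio]
    by_contra hlt
    exact hp (by simp only [h1 p (not_lt.mp hlt), smul_zero])

end SymmetricFunction

namespace EquivariantCW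

open OrderType PermOrbit SymmetricFunction CompactSupportCohomology

namespace CubicalCells

universe u v w

variable {G : Type v} [Group G] [Fintype G] {X : Type u} [TopologicalSpace X] [T2Space X]
  [MulAction G X] [ContinuousConstSMul G X] (K : CubicalCells G X) (E : Type w) [Fintype E]
  [Nonempty E] [MulAction G E]

open Classical in
/-- Orbit counting: the strata of the quotient are the `G`-orbits of labels, and those fixed by `σ`
are counted, with multiplicity `|G|`, by the labels fixed by `σ` composed with elements of `G`. -/
theorem card_mul_lefschetzNumber (n : ℕ) (σ : Equiv.Perm (Fin n)) :
    (Fintype.card G : ℚ) *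
        lefschetzNumber (Homeomorph.smul σ⁻¹ : ConfSimplexQuotient G X E n ≃ₜ _) =
      ∑ g : G, ∑ r ∈ (Label.finite_isValid (n := n) (D := K.D) (E := E) K.dim).toFinset
        with σ • g • r = r, (-1) ^ depth r.val := by
  rw [K.lefschetzNumber_smul E n σ⁻¹]
  have h := card_mul_sum_fixed_orbits (G := G)
    (V := (Label.finite_isValid (n := n) (D := K.D) (E := E) K.dim).toFinset)
    (fun g r hr => by
      rw [Set.Finite.mem_toFinset] at hr ⊢
      exact Label.IsValid.smul hr K.dim_smul g)
    (f := fun r => σ⁻¹ • r) (fun g r => (Label.smul_perm_smul g σ⁻¹ r).symm)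
    (permStrata σ⁻¹) (fun _ => rfl) fun i => (-1) ^ Strata.dim (K := K) i
  refine h.trans ?_
  -- the fixed labels of `σ⁻¹ g⁻¹` are those of `σ g`
  rw [← Equiv.sum_comp (Equiv.inv G)]
  refine Finset.sum_congr rfl fun g _ => ?_
  refine Finset.sum_congr (Finset.filter_congr fun r _ => ?_) fun _ _ => rfl
  change σ⁻¹ • g⁻¹ • r = r ↔ σ • g • r = r
  rw [inv_smul_eq_iff, inv_smul_eq_iff, Label.smul_perm_smul, eq_comm]

/-- For `a = -1` the binomial coefficients in `labelSeries` are the signs `(-1) ^ depth` of the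
strata. -/
theorem equivariantChiC_confSimplexQuotient (n : ℕ) :
    equivariantChiC n (ConfSimplexQuotient G X E n) =
      (1 / (Fintype.card G : ℚ)) • ∑ g : G, K.labelSeries E n g (-1) := by
  classical
  have hG : (Fintype.card G : ℚ) ≠ 0 := Nat.cast_ne_zero.mpr Fintype.card_ne_zero
  rw [equivariantChiC_eq n (K.hasFiniteHc_confSimplexQuotient E n), one_div (Fintype.card G : ℚ),
    eq_inv_smul_iff₀ hG]
  simp only [labelSeries, choose_neg_one]
  rw [← Finset.smul_sum, smul_comm, Finset.sum_comm, Finset.smul_sum]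
  congr 1
  refine Finset.sum_congr rfl fun σ _ => ?_
  rw [smul_smul, card_mul_lefschetzNumber K, Finset.sum_smul]

theorem weightedCells_neg_one (g : G) {k : ℕ} (hk : 1 ≤ k) :
    K.weightedCells g k (-1) = chiC (orbitLengthLocus X g k) :=
  (K.chiC_orbitLengthLocus g hk).symm

/-- For `a = -1` the term `(a + 1) ^ o` vanishes, where `o ≥ 1` is the number of `g`-orbits on `E`,
and `-a ^ o` contributes the sign of `g`. -/
theorem productSeries_neg_one [DecidableEq E] (g : G) :
    K.productSeries E g (-1) =
      (-((-1 : ℚ) ^ Fintype.card E *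
          ((Equiv.Perm.sign (MulAction.toPerm g : Equiv.Perm E) : ℤ) : ℚ))) •
        ∏ᶠ (k : ℕ) (_ : 1 ≤ k), onePlusPow (powerSum k)
          ((chiC (orbitLengthLocus X g k) : ℚ) / (k : ℚ)) := by
  classical
  have ho : Fintype.card (Orb (MulAction.toPerm g : Equiv.Perm E)) ≠ 0 := by
    obtain ⟨e⟩ := ‹Nonempty E›
    exact (Fintype.card_pos_iff.mpr ⟨orb _ e⟩).ne'
  rw [productSeries, neg_add_cancel, zero_pow ho, zero_sub, neg_one_pow_card_orb]
  congr 1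
  -- orbits have at most `|G|` elements, so the infinite product is a finite one
  have h1 : ∀ k, 1 ≤ k → Fintype.card G < k → chiC (orbitLengthLocus X g k) = 0 := by
    intro k hk hlt
    have h2 := K.chiC_orbitLengthLocus g hk
    rw [Finset.filter_false_of_mem, Finset.sum_empty] at h2
    · exact_mod_cast h2
    · intro c _ hc
      have h3 := size_orb_toPerm_le g (orb (MulAction.toPerm g : Equiv.Perm K.C) c)
      rw [size_orb_toPerm, hc] at h3
      omega
  rw [finprod_cond_eq_prod_of_cond_iff (t := Finset.Icc 1 (Fintype.card G))]
  · refine Finset.prod_congr rfl fun k hk => ?_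
    rw [K.weightedCells_neg_one g (Finset.mem_Icc.mp hk).1]
  · intro k hk
    rw [Finset.mem_Icc]
    refine ⟨fun hk1 => ⟨hk1, ?_⟩, fun h => h.1⟩
    by_contra hlt
    refine hk ?_
    rw [h1 k hk1 (not_le.mp hlt), Int.cast_zero, zero_div, onePlusPow_zero hk1]

end CubicalCells

end EquivariantCW

end

theorem mainTheorem6
    {X : Type*} [TopologicalSpace X] [T2Space X]
    [Topology.CWComplex (Set.univ : Set X)] [Topology.CWComplex.Finite (Set.univ : Set X)]
    {E : Type*} [Fintype E] [DecidableEq E] [Nonempty E]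
    {G : Type*} [Group G] [Fintype G]
    [MulAction G X] [ContinuousConstSMul G X]
    [MulAction G E] (hX : IsCellularAction G X) :
    (∀ n : ℕ, CompactSupportCohomology.HasFiniteHc (ConfSimplexQuotient G X E n)) ∧
    (∀ (g : G) (k : ℕ), 1 ≤ k →
      CompactSupportCohomology.HasFiniteHc (orbitLengthLocus X g k)) ∧
    HasSum
      (fun n : ℕ => SymmetricFunction.equivariantChiC n (ConfSimplexQuotient G X E n))
      (-((-1 : ℚ) ^ Fintype.card E / (Fintype.card G : ℚ)) •
        ∑ g : G, ((Equiv.Perm.sign (MulAction.toPerm g : Equiv.Perm E) : ℤ) : ℚ) •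
          ∏ᶠ (k : ℕ) (_ : 1 ≤ k), SymmetricFunction.onePlusPow (SymmetricFunction.powerSum k)
            ((CompactSupportCohomology.chiC (orbitLengthLocus X g k) : ℚ) / (k : ℚ))) := by
  obtain ⟨K⟩ := EquivariantCW.exists_cubicalCells hX
  refine ⟨fun n => K.hasFiniteHc_confSimplexQuotient E n,
    fun g k hk => K.hasFiniteHc_orbitLengthLocus g hk, ?_⟩
  have h : HasSum (fun n => (1 / (Fintype.card G : ℚ)) • ∑ g : G, K.labelSeries E n g (-1))
      ((1 / (Fintype.card G : ℚ)) • ∑ g : G, K.productSeries E g (-1)) :=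
    HasSum.const_smul _ (hasSum_sum fun g _ => K.hasSum_labelSeries E g (-1))
  simp only [← K.equivariantChiC_confSimplexQuotient E] at h
  convert h using 1
  simp only [K.productSeries_neg_one E, Finset.smul_sum, smul_smul]
  refine Finset.sum_congr rfl fun g _ => ?_
  congr 1
  ring
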